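/- All multimaps are set-valued (in fixed universes), and an $n$-ary multimap is written $f\colon a_1,\dots,a_n\to b$. **Skew multicategories.** A *skew multicategory* $\mathbb M$ has objects, sets $\mathbb M^t_n(a_1,\dots,a_n;b)$ of *tight* multimaps for $n\ge 1$ and $\mathbb M^l_n(a_1,\dots,a_n;b)$ of *loose* multimaps for $n\ge 0$ (there are no tight nullary maps), functions $j\colon \mathbb M^t_n\to\mathbb M^l_n$, tight identities $1_a\colon a\to a$, and substitutions $f\circ_i g$. The map $f\circ_i g$ is tight if $f$ and $g$ are tight, or if $f$ is tight, $g$ is loose and $i\neq 1$; otherwise it is loose. Substitution is unital and associative, substitutions in different variables commute, and $j$ is compatible with substitution in both arguments. A morphism is a function on objects with functions on tight and on loose multimaps that preserve identities, substitution and $j$. The tight unary maps form the underlying category. $\mathbb M$ is *closed* if for all $b,c$ there is a tight $e_{b,c}\colon [b,c],b\to c$ such that $e_{b,c}\circ_1-$ is a bijection $\mathbb M^x_n(\bar a;[b,c])\to\mathbb M^x_{n+1}(\bar a,b;c)$ for $x=t$, $n\geq 1$ and for $x=l$, $n\ge0$. It has a *nullary map classifier* (is *with units*) if there is $u\in\mathbb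 M^l_0(\ ;i)$ such that $f\mapsto f\circ_1u$ is a bijection $\mathbb M^t_1(i;a)\to\mathbb M_0^l(\ ;a)$ for all $a$. **Short skew multicategories.** A *short skew multicategory* $\mathbb C$ consists of a category $\mathcal C$ (put $\mathbb C_1^t(a;b)=\mathcal C(a,b)$), functors $\mathbb C^t_n\colon(\mathcal C^n)^{op}\times\mathcal C\to\mathbf{Set}$ for $n=2,3,4$ and $\mathbb C^l_n\colon(\mathcal C^n)^{op}\times\mathcal C\to\mathbf{Set}$ for $n=0,1,2$, natural transformations $j\colon\mathbb C^t_n\to\mathbb C^l_n$ for $n=1,2$, and substitutions, natural in all free variables and dinatural in the object substituted at, of: a tight binary map in any variable of a tight binary or ternary map; a tight ternary map in either variable of a tight binary map; a nullary map in any variable of a tight binary or ternary map; a loose unary map in either variable of a tight binary map; a nullary map, and a tight binary map, in a loose unary map (tight or loose results according to the rule above; a substitution of a loose map in a later variable of a tight map is tight). The axioms are $f\circ_i(g\circ_jh)=(f\circ_ig)\circ_{i+j-1}h$ for $f,g$ tight binary and $h$ tight binary or nullary, and $(f\circ_1g)\circ_{m+1}h=(f\circ_2h)\circ_1g$ for $f$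 tight binary, $g$ of arity $m$, and each of $g,h$ tight binary or nullary; moreover substituting $j(p)$ in a binary map, or a binary or nullary map in $j(p)$, for a morphism $p$ of $\mathcal C$, agrees, up to $j$ where the result is loose, with the action of $p$. A morphism is a functor with natural families on all the sets of multimaps that commute with $j$ and with all the substitutions. $\mathbb C$ is *closed* if for all $b,c$ there is $e_{b,c}\in\mathbb C_2^t([b,c],b;c)$ with all functions $e_{b,c}\circ_1-\colon \mathbb C^x_n(\bar a;[b,c])\to\mathbb C^x_{n+1}(\bar a,b;c)$ bijective for $x=t$, $n=1,2,3$ and for $x=l$, $n=0,1$; a *nullary map classifier* is defined as above. **Skew closed categories.** A *skew closed category* is a category $\mathcal V$ with a functor $[-,-]\colon\mathcal V^{op}\times\mathcal V\to\mathcal V$, an object $i$, and maps $I_a\colon[i,a]\to a$, $J_a\colon i\to[a,a]$, $L^a_{b,c}\colon[b,c]\to[[a,b],[a,c]]$, natural or extranatural in each variable, such that $$[L^a_{b,c},1]\,L^{[a,b]}_{[a,c],[a,d]}\,L^a_{c,d}=[1,L^a_{b,d}]\,L^b_{c,d},\qquad I_{[a,c]}\,[J_a,1]\,L^a_{a,c}=1,$$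 $$L^a_{b,b}J_b=J_{[a,b]},\qquad [1,I_c]\,L^i_{b,c}=[I_b,1],\qquad I_iJ_i=1 .$$ A *closed functor* is a functor $F$ with a map $f_0\colon i\to Fi$ and natural maps $f_{a,b}\colon F[a,b]\to[Fa,Fb]$ such that $$I_{Fa}\,[f_0,1]\,f_{i,a}=F(I_a),\quad f_{a,a}\,F(J_a)\,f_0=J_{Fa},\quad [1,f_{a,c}]\,f_{[a,b],[a,c]}\,F(L^a_{b,c})=[f_{a,b},1]\,L^{Fa}_{Fb,Fc}\,f_{b,c}.$$ A *closed category* is a skew closed category in which every $I_a$ is invertible and every function $\mathcal V(a,b)\to\mathcal V(i,[a,b])$, $f\mapsto[1,f]J_a$, is bijective. **Non-skew notions.** A *multicategory* has multimaps of all arities $n\geq 0$, identities and unital, associative substitutions, substitutions in different variables commuting. A *short multicategory* is a category $\mathcal C$ with functors $\mathbb C_n\colon(\mathcal C^n)^{op}\times\mathcal C\to\mathbf{Set}$ for $n=0,2,3,4$ and natural and dinatural substitutions: binary in binary and ternary, ternary in binary, and nullary in binary and ternary maps. Its axioms are the associativity and commutation equations listed for short skew multicategories, with composition in $\mathcal C$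 and the functorial actions used for substitutions that involve unary maps. Morphisms are defined analogously. These are regarded as (short) skew multicategories in which all multimaps of positive arity are both tight and loose, with $j$ the identity, and the nullary ones are loose. They are *closed* if for all $b,c$ there is $e_{b,c}\colon[b,c],b\to c$ such that $e_{b,c}\circ_1-$ is bijective on $n$-ary multimaps to $[b,c]$, for all $n\ge 0$ (respectively $0\leq n\leq 3$), and they have *units* if there is a nullary $u$ with codomain some $i$ such that $e_{i,x}\circ_2u\colon[i,x]\to x$ is invertible for every $x$ (then $u$ is a nullary map classifier). **The functors.** Let $\mathbf{ShortSkMult}_{cl}$ be the category of closed short skew multicategories with a nullary map classifier and all their morphisms, $\mathbf{SkMult}_{cl}$ the category of closed skew multicategories with units, $\mathbf{SkCl}$ the category of skew closed categories and closed functors, and $\mathbf{ShortMult}_{cl}$, $\mathbf{Mult}_{cl}$, $\mathbf{Cl}$ the categories of closed short multicategories with units, of closed multicategories with units, and of closed categories with closed functors. The functor $K^s_{cl}\colon\mathbf{ShortSkMult}_{cl}\to\mathbf{SkCl}$ takes $\mathbb C$ (with chosen $e_{b,c}$ and $u$) to its underlying category with the internal homs $[b,c]$ and the object $i$, where $[p,h]$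 is determined by $e\circ_1[p,h]=h\circ e\circ_2p$, and where $$I_a=e_{i,a}\circ_2u,\qquad e_{a,a}\circ_1(J_a\circ_1u)=j(1_a),\qquad (e_{[a,b],[a,c]}\circ_1L^a_{b,c})\ \text{ satisfies }\ e_{a,c}\circ_1(e_{[a,b],[a,c]}\circ_1L^a_{b,c})=e_{b,c}\circ_2e_{a,b}.$$ It takes a morphism $F$ to its underlying functor with $f_0$, $f_{a,b}$ determined by $f_0\circ_1u=F(u)$ and $e_{Fa,Fb}\circ_1f_{a,b}=F(e_{a,b})$. The forgetful functor $U^s_{cl}\colon\mathbf{SkMult}_{cl}\to\mathbf{ShortSkMult}_{cl}$ keeps the tight multimaps of arities $1,\dots,4$ and the loose ones of arities $0,1,2$, and $U_{cl}\colon\mathbf{Mult}_{cl}\to\mathbf{ShortMult}_{cl}$ keeps the multimaps of arities $0,\dots,4$. **Theorem.** $K^s_{cl}\colon\mathbf{ShortSkMult}_{cl}\to\mathbf{SkCl}$ and $U^s_{cl}\colon\mathbf{SkMult}_{cl}\to\mathbf{ShortSkMult}_{cl}$ are equivalences of categories. They restrict to equivalences $K_{cl}\colon\mathbf{ShortMult}_{cl}\to\mathbf{Cl}$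 and $U_{cl}\colon\mathbf{Mult}_{cl}\to\mathbf{ShortMult}_{cl}$; that is, $K_{cl}$ and $U_{cl}$ are equivalences, and they commute with $K^s_{cl}$ and $U^s_{cl}$ up to natural isomorphism along the inclusions of the non-skew structures into the skew ones. -/

import Mathlib

open CategoryTheory

universe v u

namespace SkewMulti

/-! ### Set-valued functors on `(Cⁿ)ᵒᵖ × C` -/

/-- A functor `C ⥤ Set`. -/
structure Fam0 (C : Type u) [Category.{v} C] where
  obj : C → Type v
  map {c c' : C} : (c ⟶ c') → obj c → obj c'
  map_id {c : C} (x : obj c) : map (𝟙 c) x = x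
  map_comp {c c' c'' : C} (h : c ⟶ c') (h' : c' ⟶ c'') (x : obj c) :
    map h' (map h x) = map (h ≫ h') x

/-- A functor `Cᵒᵖ × C ⥤ Set`. -/
structure Fam1 (C : Type u) [Category.{v} C] where
  obj : C → C → Type v
  map {a a' c c' : C} : (a' ⟶ a) → (c ⟶ c') → obj a c → obj a' c'
  map_id {a c : C} (x : obj a c) : map (𝟙 a) (𝟙 c) x = x
  map_comp {a a' a'' c c' c'' : C} (p : a' ⟶ a) (p' : a'' ⟶ a')
    (h : c ⟶ c') (h' : c' ⟶ c'') (x : obj a c) :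
    map p' h' (map p h x) = map (p' ≫ p) (h ≫ h') x

/-- A functor `(C²)ᵒᵖ × C ⥤ Set`. -/
structure Fam2 (C : Type u) [Category.{v} C] where
  obj : C → C → C → Type v
  map {a a' b b' c c' : C} : (a' ⟶ a) → (b' ⟶ b) → (c ⟶ c') → obj a b c → obj a' b' c'
  map_id {a b c : C} (x : obj a b c) : map (𝟙 a) (𝟙 b) (𝟙 c) x = x
  map_comp {a a' a'' b b' b'' c c' c'' : C} (p : a' ⟶ a) (p' : a'' ⟶ a')
    (q : b' ⟶ b) (q' : b'' ⟶ b') (h : c ⟶ c') (h' : c' ⟶ c'') (x : obj a b c) :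
    map p' q' h' (map p q h x) = map (p' ≫ p) (q' ≫ q) (h ≫ h') x

/-- A functor `(C³)ᵒᵖ × C ⥤ Set`. -/
structure Fam3 (C : Type u) [Category.{v} C] where
  obj : C → C → C → C → Type v
  map {a₁ a₁' a₂ a₂' a₃ a₃' c c' : C} : (a₁' ⟶ a₁) → (a₂' ⟶ a₂) → (a₃' ⟶ a₃) → (c ⟶ c') →
    obj a₁ a₂ a₃ c → obj a₁' a₂' a₃' c'
  map_id {a₁ a₂ a₃ c : C} (x : obj a₁ a₂ a₃ c) : map (𝟙 a₁) (𝟙 a₂) (𝟙 a₃) (𝟙 c) x = x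
  map_comp {a₁ a₁' a₁'' a₂ a₂' a₂'' a₃ a₃' a₃'' c c' c'' : C}
    (p₁ : a₁' ⟶ a₁) (p₁' : a₁'' ⟶ a₁') (p₂ : a₂' ⟶ a₂) (p₂' : a₂'' ⟶ a₂')
    (p₃ : a₃' ⟶ a₃) (p₃' : a₃'' ⟶ a₃') (h : c ⟶ c') (h' : c' ⟶ c'') (x : obj a₁ a₂ a₃ c) :
    map p₁' p₂' p₃' h' (map p₁ p₂ p₃ h x) = map (p₁' ≫ p₁) (p₂' ≫ p₂) (p₃' ≫ p₃) (h ≫ h') x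

/-- A functor `(C⁴)ᵒᵖ × C ⥤ Set`. -/
structure Fam4 (C : Type u) [Category.{v} C] where
  obj : C → C → C → C → C → Type v
  map {a₁ a₁' a₂ a₂' a₃ a₃' a₄ a₄' c c' : C} :
    (a₁' ⟶ a₁) → (a₂' ⟶ a₂) → (a₃' ⟶ a₃) → (a₄' ⟶ a₄) → (c ⟶ c') →
    obj a₁ a₂ a₃ a₄ c → obj a₁' a₂' a₃' a₄' c'
  map_id {a₁ a₂ a₃ a₄ c : C} (x : obj a₁ a₂ a₃ a₄ c) :
    map (𝟙 a₁) (𝟙 a₂) (𝟙 a₃) (𝟙 a₄) (𝟙 c) x = x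
  map_comp {a₁ a₁' a₁'' a₂ a₂' a₂'' a₃ a₃' a₃'' a₄ a₄' a₄'' c c' c'' : C}
    (p₁ : a₁' ⟶ a₁) (p₁' : a₁'' ⟶ a₁') (p₂ : a₂' ⟶ a₂) (p₂' : a₂'' ⟶ a₂')
    (p₃ : a₃' ⟶ a₃) (p₃' : a₃'' ⟶ a₃') (p₄ : a₄' ⟶ a₄) (p₄' : a₄'' ⟶ a₄')
    (h : c ⟶ c') (h' : c' ⟶ c'') (x : obj a₁ a₂ a₃ a₄ c) :
    map p₁' p₂' p₃' p₄' h' (map p₁ p₂ p₃ p₄ h x) =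
      map (p₁' ≫ p₁) (p₂' ≫ p₂) (p₃' ≫ p₃) (p₄' ≫ p₄) (h ≫ h') x

/-! ### Short skew multicategories -/

/-- A short skew multicategory. `T n` are the tight `n`-ary multimaps (tight unary maps are the
morphisms of `Ob`), `L n` the loose ones. `subₓᵢ` is substitution `- ∘ᵢ -`: `sub22_i` puts a tight
binary map into a tight binary one, `sub32_i` a tight binary into a tight ternary one, `sub23_i` a
tight ternary into a tight binary one, `sub20_i` / `sub30_i` a nullary map into a tight binary /
ternary one, `subL1_0` a nullary map into a loose unary one, `sub2_L1_i` a loose unary map into a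
tight binary one and `subL1_2` a tight binary map into a loose unary one. Every substitution has an
axiom `nat_…` (naturality) and an axiom `din_…` (dinaturality in the object substituted at). -/
structure ShortSkewMulticategory where
  Ob : Type u
  [cat : Category.{v} Ob]
  T2 : Fam2.{v} Ob
  T3 : Fam3.{v} Ob
  T4 : Fam4.{v} Ob
  L0 : Fam0.{v} Ob
  L1 : Fam1.{v} Ob
  L2 : Fam2.{v} Ob
  j1 {a c : Ob} : (a ⟶ c) → L1.obj a c
  j2 {a b c : Ob} : T2.obj a b c → L2.obj a b c
  nat_j1 {a a' c c' : Ob} (p : a' ⟶ a) (h : c ⟶ c') (f : a ⟶ c) :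
    j1 (p ≫ f ≫ h) = L1.map p h (j1 f)
  nat_j2 {a a' b b' c c' : Ob} (p : a' ⟶ a) (q : b' ⟶ b) (h : c ⟶ c') (f : T2.obj a b c) :
    j2 (T2.map p q h f) = L2.map p q h (j2 f)
  -- substitution of a tight binary map into a tight binary map
  sub22_1 {b₁ b₂ c a₁ a₂ : Ob} : T2.obj b₁ b₂ c → T2.obj a₁ a₂ b₁ → T3.obj a₁ a₂ b₂ c
  sub22_2 {b₁ b₂ c a₁ a₂ : Ob} : T2.obj b₁ b₂ c → T2.obj a₁ a₂ b₂ → T3.obj b₁ a₁ a₂ c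
  nat_22_1 {b₁ b₂ b₂' c c' a₁ a₁' a₂ a₂' : Ob} (p₁ : a₁' ⟶ a₁) (p₂ : a₂' ⟶ a₂) (q₂ : b₂' ⟶ b₂)
    (h : c ⟶ c') (f : T2.obj b₁ b₂ c) (g : T2.obj a₁ a₂ b₁) :
    sub22_1 (T2.map (𝟙 _) q₂ h f) (T2.map p₁ p₂ (𝟙 _) g) = T3.map p₁ p₂ q₂ h (sub22_1 f g)
  din_22_1 {b₁ b₁' b₂ c a₁ a₂ : Ob} (k : b₁ ⟶ b₁') (f : T2.obj b₁' b₂ c) (g : T2.obj a₁ a₂ b₁) :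
    sub22_1 (T2.map k (𝟙 _) (𝟙 _) f) g = sub22_1 f (T2.map (𝟙 _) (𝟙 _) k g)
  nat_22_2 {b₁ b₁' b₂ c c' a₁ a₁' a₂ a₂' : Ob} (p₁ : a₁' ⟶ a₁) (p₂ : a₂' ⟶ a₂) (q₁ : b₁' ⟶ b₁)
    (h : c ⟶ c') (f : T2.obj b₁ b₂ c) (g : T2.obj a₁ a₂ b₂) :
    sub22_2 (T2.map q₁ (𝟙 _) h f) (T2.map p₁ p₂ (𝟙 _) g) = T3.map q₁ p₁ p₂ h (sub22_2 f g)
  din_22_2 {b₁ b₂ b₂' c a₁ a₂ : Ob} (k : b₂ ⟶ b₂') (f : T2.obj b₁ b₂' c) (g : T2.obj a₁ a₂ b₂) :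
    sub22_2 (T2.map (𝟙 _) k (𝟙 _) f) g = sub22_2 f (T2.map (𝟙 _) (𝟙 _) k g)
  -- substitution of a tight binary map into a tight ternary map
  sub32_1 {b₁ b₂ b₃ c a₁ a₂ : Ob} :
    T3.obj b₁ b₂ b₃ c → T2.obj a₁ a₂ b₁ → T4.obj a₁ a₂ b₂ b₃ c
  sub32_2 {b₁ b₂ b₃ c a₁ a₂ : Ob} :
    T3.obj b₁ b₂ b₃ c → T2.obj a₁ a₂ b₂ → T4.obj b₁ a₁ a₂ b₃ c
  sub32_3 {b₁ b₂ b₃ c a₁ a₂ : Ob} :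
    T3.obj b₁ b₂ b₃ c → T2.obj a₁ a₂ b₃ → T4.obj b₁ b₂ a₁ a₂ c
  nat_32_1 {b₁ b₂ b₂' b₃ b₃' c c' a₁ a₁' a₂ a₂' : Ob} (p₁ : a₁' ⟶ a₁) (p₂ : a₂' ⟶ a₂)
    (q₂ : b₂' ⟶ b₂) (q₃ : b₃' ⟶ b₃) (h : c ⟶ c') (f : T3.obj b₁ b₂ b₃ c) (g : T2.obj a₁ a₂ b₁) :
    sub32_1 (T3.map (𝟙 _) q₂ q₃ h f) (T2.map p₁ p₂ (𝟙 _) g) =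
      T4.map p₁ p₂ q₂ q₃ h (sub32_1 f g)
  din_32_1 {b₁ b₁' b₂ b₃ c a₁ a₂ : Ob} (k : b₁ ⟶ b₁') (f : T3.obj b₁' b₂ b₃ c)
    (g : T2.obj a₁ a₂ b₁) :
    sub32_1 (T3.map k (𝟙 _) (𝟙 _) (𝟙 _) f) g = sub32_1 f (T2.map (𝟙 _) (𝟙 _) k g)
  nat_32_2 {b₁ b₁' b₂ b₃ b₃' c c' a₁ a₁' a₂ a₂' : Ob} (p₁ : a₁' ⟶ a₁) (p₂ : a₂' ⟶ a₂)
    (q₁ : b₁' ⟶ b₁) (q₃ : b₃' ⟶ b₃) (h : c ⟶ c') (f : T3.obj b₁ b₂ b₃ c) (g : T2.obj a₁ a₂ b₂) :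
    sub32_2 (T3.map q₁ (𝟙 _) q₃ h f) (T2.map p₁ p₂ (𝟙 _) g) =
      T4.map q₁ p₁ p₂ q₃ h (sub32_2 f g)
  din_32_2 {b₁ b₂ b₂' b₃ c a₁ a₂ : Ob} (k : b₂ ⟶ b₂') (f : T3.obj b₁ b₂' b₃ c)
    (g : T2.obj a₁ a₂ b₂) :
    sub32_2 (T3.map (𝟙 _) k (𝟙 _) (𝟙 _) f) g = sub32_2 f (T2.map (𝟙 _) (𝟙 _) k g)
  nat_32_3 {b₁ b₁' b₂ b₂' b₃ c c' a₁ a₁' a₂ a₂' : Ob} (p₁ : a₁' ⟶ a₁) (p₂ : a₂' ⟶ a₂)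
    (q₁ : b₁' ⟶ b₁) (q₂ : b₂' ⟶ b₂) (h : c ⟶ c') (f : T3.obj b₁ b₂ b₃ c) (g : T2.obj a₁ a₂ b₃) :
    sub32_3 (T3.map q₁ q₂ (𝟙 _) h f) (T2.map p₁ p₂ (𝟙 _) g) =
      T4.map q₁ q₂ p₁ p₂ h (sub32_3 f g)
  din_32_3 {b₁ b₂ b₃ b₃' c a₁ a₂ : Ob} (k : b₃ ⟶ b₃') (f : T3.obj b₁ b₂ b₃' c)
    (g : T2.obj a₁ a₂ b₃) :
    sub32_3 (T3.map (𝟙 _) (𝟙 _) k (𝟙 _) f) g = sub32_3 f (T2.map (𝟙 _) (𝟙 _) k g)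
  -- substitution of a tight ternary map into a tight binary map
  sub23_1 {b₁ b₂ c a₁ a₂ a₃ : Ob} :
    T2.obj b₁ b₂ c → T3.obj a₁ a₂ a₃ b₁ → T4.obj a₁ a₂ a₃ b₂ c
  sub23_2 {b₁ b₂ c a₁ a₂ a₃ : Ob} :
    T2.obj b₁ b₂ c → T3.obj a₁ a₂ a₃ b₂ → T4.obj b₁ a₁ a₂ a₃ c
  nat_23_1 {b₁ b₂ b₂' c c' a₁ a₁' a₂ a₂' a₃ a₃' : Ob} (p₁ : a₁' ⟶ a₁) (p₂ : a₂' ⟶ a₂)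
    (p₃ : a₃' ⟶ a₃) (q₂ : b₂' ⟶ b₂) (h : c ⟶ c') (f : T2.obj b₁ b₂ c)
    (g : T3.obj a₁ a₂ a₃ b₁) :
    sub23_1 (T2.map (𝟙 _) q₂ h f) (T3.map p₁ p₂ p₃ (𝟙 _) g) =
      T4.map p₁ p₂ p₃ q₂ h (sub23_1 f g)
  din_23_1 {b₁ b₁' b₂ c a₁ a₂ a₃ : Ob} (k : b₁ ⟶ b₁') (f : T2.obj b₁' b₂ c)
    (g : T3.obj a₁ a₂ a₃ b₁) :
    sub23_1 (T2.map k (𝟙 _) (𝟙 _) f) g = sub23_1 f (T3.map (𝟙 _) (𝟙 _) (𝟙 _) k g)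
  nat_23_2 {b₁ b₁' b₂ c c' a₁ a₁' a₂ a₂' a₃ a₃' : Ob} (p₁ : a₁' ⟶ a₁) (p₂ : a₂' ⟶ a₂)
    (p₃ : a₃' ⟶ a₃) (q₁ : b₁' ⟶ b₁) (h : c ⟶ c') (f : T2.obj b₁ b₂ c)
    (g : T3.obj a₁ a₂ a₃ b₂) :
    sub23_2 (T2.map q₁ (𝟙 _) h f) (T3.map p₁ p₂ p₃ (𝟙 _) g) =
      T4.map q₁ p₁ p₂ p₃ h (sub23_2 f g)
  din_23_2 {b₁ b₂ b₂' c a₁ a₂ a₃ : Ob} (k : b₂ ⟶ b₂') (f : T2.obj b₁ b₂' c)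
    (g : T3.obj a₁ a₂ a₃ b₂) :
    sub23_2 (T2.map (𝟙 _) k (𝟙 _) f) g = sub23_2 f (T3.map (𝟙 _) (𝟙 _) (𝟙 _) k g)
  -- substitution of a nullary map into a tight binary map
  sub20_1 {b₁ b₂ c : Ob} : T2.obj b₁ b₂ c → L0.obj b₁ → L1.obj b₂ c
  sub20_2 {b₁ b₂ c : Ob} : T2.obj b₁ b₂ c → L0.obj b₂ → (b₁ ⟶ c)
  nat_20_1 {b₁ b₂ b₂' c c' : Ob} (q₂ : b₂' ⟶ b₂) (h : c ⟶ c') (f : T2.obj b₁ b₂ c)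
    (v : L0.obj b₁) : sub20_1 (T2.map (𝟙 _) q₂ h f) v = L1.map q₂ h (sub20_1 f v)
  din_20_1 {b₁ b₁' b₂ c : Ob} (k : b₁ ⟶ b₁') (f : T2.obj b₁' b₂ c) (v : L0.obj b₁) :
    sub20_1 (T2.map k (𝟙 _) (𝟙 _) f) v = sub20_1 f (L0.map k v)
  nat_20_2 {b₁ b₁' b₂ c c' : Ob} (q₁ : b₁' ⟶ b₁) (h : c ⟶ c') (f : T2.obj b₁ b₂ c)
    (v : L0.obj b₂) : sub20_2 (T2.map q₁ (𝟙 _) h f) v = q₁ ≫ sub20_2 f v ≫ h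
  din_20_2 {b₁ b₂ b₂' c : Ob} (k : b₂ ⟶ b₂') (f : T2.obj b₁ b₂' c) (v : L0.obj b₂) :
    sub20_2 (T2.map (𝟙 _) k (𝟙 _) f) v = sub20_2 f (L0.map k v)
  -- substitution of a nullary map into a tight ternary map
  sub30_1 {b₁ b₂ b₃ c : Ob} : T3.obj b₁ b₂ b₃ c → L0.obj b₁ → L2.obj b₂ b₃ c
  sub30_2 {b₁ b₂ b₃ c : Ob} : T3.obj b₁ b₂ b₃ c → L0.obj b₂ → T2.obj b₁ b₃ c
  sub30_3 {b₁ b₂ b₃ c : Ob} : T3.obj b₁ b₂ b₃ c → L0.obj b₃ → T2.obj b₁ b₂ c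
  nat_30_1 {b₁ b₂ b₂' b₃ b₃' c c' : Ob} (q₂ : b₂' ⟶ b₂) (q₃ : b₃' ⟶ b₃) (h : c ⟶ c')
    (f : T3.obj b₁ b₂ b₃ c) (v : L0.obj b₁) :
    sub30_1 (T3.map (𝟙 _) q₂ q₃ h f) v = L2.map q₂ q₃ h (sub30_1 f v)
  din_30_1 {b₁ b₁' b₂ b₃ c : Ob} (k : b₁ ⟶ b₁') (f : T3.obj b₁' b₂ b₃ c) (v : L0.obj b₁) :
    sub30_1 (T3.map k (𝟙 _) (𝟙 _) (𝟙 _) f) v = sub30_1 f (L0.map k v)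
  nat_30_2 {b₁ b₁' b₂ b₃ b₃' c c' : Ob} (q₁ : b₁' ⟶ b₁) (q₃ : b₃' ⟶ b₃) (h : c ⟶ c')
    (f : T3.obj b₁ b₂ b₃ c) (v : L0.obj b₂) :
    sub30_2 (T3.map q₁ (𝟙 _) q₃ h f) v = T2.map q₁ q₃ h (sub30_2 f v)
  din_30_2 {b₁ b₂ b₂' b₃ c : Ob} (k : b₂ ⟶ b₂') (f : T3.obj b₁ b₂' b₃ c) (v : L0.obj b₂) :
    sub30_2 (T3.map (𝟙 _) k (𝟙 _) (𝟙 _) f) v = sub30_2 f (L0.map k v)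
  nat_30_3 {b₁ b₁' b₂ b₂' b₃ c c' : Ob} (q₁ : b₁' ⟶ b₁) (q₂ : b₂' ⟶ b₂) (h : c ⟶ c')
    (f : T3.obj b₁ b₂ b₃ c) (v : L0.obj b₃) :
    sub30_3 (T3.map q₁ q₂ (𝟙 _) h f) v = T2.map q₁ q₂ h (sub30_3 f v)
  din_30_3 {b₁ b₂ b₃ b₃' c : Ob} (k : b₃ ⟶ b₃') (f : T3.obj b₁ b₂ b₃' c) (v : L0.obj b₃) :
    sub30_3 (T3.map (𝟙 _) (𝟙 _) k (𝟙 _) f) v = sub30_3 f (L0.map k v)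
  -- substitution of a nullary map into a loose unary map
  subL1_0 {b c : Ob} : L1.obj b c → L0.obj b → L0.obj c
  nat_L1_0 {b c c' : Ob} (h : c ⟶ c') (f : L1.obj b c) (v : L0.obj b) :
    subL1_0 (L1.map (𝟙 _) h f) v = L0.map h (subL1_0 f v)
  din_L1_0 {b b' c : Ob} (k : b ⟶ b') (f : L1.obj b' c) (v : L0.obj b) :
    subL1_0 (L1.map k (𝟙 _) f) v = subL1_0 f (L0.map k v)
  -- substitution of a loose unary map into a tight binary map
  sub2_L1_1 {b₁ b₂ c a : Ob} : T2.obj b₁ b₂ c → L1.obj a b₁ → L2.obj a b₂ c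
  sub2_L1_2 {b₁ b₂ c a : Ob} : T2.obj b₁ b₂ c → L1.obj a b₂ → T2.obj b₁ a c
  nat_2_L1_1 {b₁ b₂ b₂' c c' a a' : Ob} (p : a' ⟶ a) (q₂ : b₂' ⟶ b₂) (h : c ⟶ c')
    (f : T2.obj b₁ b₂ c) (g : L1.obj a b₁) :
    sub2_L1_1 (T2.map (𝟙 _) q₂ h f) (L1.map p (𝟙 _) g) = L2.map p q₂ h (sub2_L1_1 f g)
  din_2_L1_1 {b₁ b₁' b₂ c a : Ob} (k : b₁ ⟶ b₁') (f : T2.obj b₁' b₂ c) (g : L1.obj a b₁) :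
    sub2_L1_1 (T2.map k (𝟙 _) (𝟙 _) f) g = sub2_L1_1 f (L1.map (𝟙 _) k g)
  nat_2_L1_2 {b₁ b₁' b₂ c c' a a' : Ob} (p : a' ⟶ a) (q₁ : b₁' ⟶ b₁) (h : c ⟶ c')
    (f : T2.obj b₁ b₂ c) (g : L1.obj a b₂) :
    sub2_L1_2 (T2.map q₁ (𝟙 _) h f) (L1.map p (𝟙 _) g) = T2.map q₁ p h (sub2_L1_2 f g)
  din_2_L1_2 {b₁ b₂ b₂' c a : Ob} (k : b₂ ⟶ b₂') (f : T2.obj b₁ b₂' c) (g : L1.obj a b₂) :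
    sub2_L1_2 (T2.map (𝟙 _) k (𝟙 _) f) g = sub2_L1_2 f (L1.map (𝟙 _) k g)
  -- substitution of a tight binary map into a loose unary map
  subL1_2 {b c a₁ a₂ : Ob} : L1.obj b c → T2.obj a₁ a₂ b → L2.obj a₁ a₂ c
  nat_L1_2 {b c c' a₁ a₁' a₂ a₂' : Ob} (p₁ : a₁' ⟶ a₁) (p₂ : a₂' ⟶ a₂) (h : c ⟶ c')
    (f : L1.obj b c) (g : T2.obj a₁ a₂ b) :
    subL1_2 (L1.map (𝟙 _) h f) (T2.map p₁ p₂ (𝟙 _) g) = L2.map p₁ p₂ h (subL1_2 f g)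
  din_L1_2 {b b' c a₁ a₂ : Ob} (k : b ⟶ b') (f : L1.obj b' c) (g : T2.obj a₁ a₂ b) :
    subL1_2 (L1.map k (𝟙 _) f) g = subL1_2 f (T2.map (𝟙 _) (𝟙 _) k g)
  -- `f ∘ᵢ (g ∘ⱼ h) = (f ∘ᵢ g) ∘ᵢ₊ⱼ₋₁ h` for `f`, `g`, `h` binary
  line_a_11 {b₁ b₂ c a₁ a₂ d₁ d₂ : Ob} (f : T2.obj b₁ b₂ c) (g : T2.obj a₁ a₂ b₁)
    (h : T2.obj d₁ d₂ a₁) : sub23_1 f (sub22_1 g h) = sub32_1 (sub22_1 f g) h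
  line_a_12 {b₁ b₂ c a₁ a₂ d₁ d₂ : Ob} (f : T2.obj b₁ b₂ c) (g : T2.obj a₁ a₂ b₁)
    (h : T2.obj d₁ d₂ a₂) : sub23_1 f (sub22_2 g h) = sub32_2 (sub22_1 f g) h
  line_a_21 {b₁ b₂ c a₁ a₂ d₁ d₂ : Ob} (f : T2.obj b₁ b₂ c) (g : T2.obj a₁ a₂ b₂)
    (h : T2.obj d₁ d₂ a₁) : sub23_2 f (sub22_1 g h) = sub32_2 (sub22_2 f g) h
  line_a_22 {b₁ b₂ c a₁ a₂ d₁ d₂ : Ob} (f : T2.obj b₁ b₂ c) (g : T2.obj a₁ a₂ b₂)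
    (h : T2.obj d₁ d₂ a₂) : sub23_2 f (sub22_2 g h) = sub32_3 (sub22_2 f g) h
  -- the same for `f`, `g` binary and `h` nullary
  line_b_11 {b₁ b₂ c a₁ a₂ : Ob} (f : T2.obj b₁ b₂ c) (g : T2.obj a₁ a₂ b₁) (h : L0.obj a₁) :
    sub2_L1_1 f (sub20_1 g h) = sub30_1 (sub22_1 f g) h
  line_b_12 {b₁ b₂ c a₁ a₂ : Ob} (f : T2.obj b₁ b₂ c) (g : T2.obj a₁ a₂ b₁) (h : L0.obj a₂) :
    T2.map (sub20_2 g h) (𝟙 _) (𝟙 _) f = sub30_2 (sub22_1 f g) h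
  line_b_21 {b₁ b₂ c a₁ a₂ : Ob} (f : T2.obj b₁ b₂ c) (g : T2.obj a₁ a₂ b₂) (h : L0.obj a₁) :
    sub2_L1_2 f (sub20_1 g h) = sub30_2 (sub22_2 f g) h
  line_b_22 {b₁ b₂ c a₁ a₂ : Ob} (f : T2.obj b₁ b₂ c) (g : T2.obj a₁ a₂ b₂) (h : L0.obj a₂) :
    T2.map (𝟙 _) (sub20_2 g h) (𝟙 _) f = sub30_3 (sub22_2 f g) h
  -- `(f ∘₁ g) ∘ₙ₊₁ h = (f ∘₂ h) ∘₁ g` for `f` binary and `(g, h)` binary-binary, binary-nullary,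
  -- nullary-binary and nullary-nullary
  comm_a {b₁ b₂ c a₁ a₂ d₁ d₂ : Ob} (f : T2.obj b₁ b₂ c) (g : T2.obj a₁ a₂ b₁)
    (h : T2.obj d₁ d₂ b₂) : sub32_3 (sub22_1 f g) h = sub32_1 (sub22_2 f h) g
  comm_b {b₁ b₂ c a₁ a₂ : Ob} (f : T2.obj b₁ b₂ c) (g : T2.obj a₁ a₂ b₁) (h : L0.obj b₂) :
    sub30_3 (sub22_1 f g) h = T2.map (𝟙 _) (𝟙 _) (sub20_2 f h) g
  comm_c {b₁ b₂ c d₁ d₂ : Ob} (f : T2.obj b₁ b₂ c) (g : L0.obj b₁) (h : T2.obj d₁ d₂ b₂) :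
    subL1_2 (sub20_1 f g) h = sub30_1 (sub22_2 f h) g
  comm_d {b₁ b₂ c : Ob} (f : T2.obj b₁ b₂ c) (g : L0.obj b₁) (h : L0.obj b₂) :
    subL1_0 (sub20_1 f g) h = L0.map (sub20_2 f h) g
  -- compatibility of `j` with the substitutions
  j_2_L1_1 {b₁ b₂ c a : Ob} (g : T2.obj b₁ b₂ c) (p : a ⟶ b₁) :
    sub2_L1_1 g (j1 p) = j2 (T2.map p (𝟙 _) (𝟙 _) g)
  j_2_L1_2 {b₁ b₂ c a : Ob} (g : T2.obj b₁ b₂ c) (p : a ⟶ b₂) :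
    sub2_L1_2 g (j1 p) = T2.map (𝟙 _) p (𝟙 _) g
  j_L1_2 {b c a₁ a₂ : Ob} (p : b ⟶ c) (g : T2.obj a₁ a₂ b) :
    subL1_2 (j1 p) g = j2 (T2.map (𝟙 _) (𝟙 _) p g)
  j_L1_0 {b c : Ob} (p : b ⟶ c) (v : L0.obj b) : subL1_0 (j1 p) v = L0.map p v

attribute [instance] ShortSkewMulticategory.cat

/-- A morphism of short skew multicategories: a functor and natural families commuting with all
substitutions and with `j`. -/
structure ShortSkewMultifunctor (C D : ShortSkewMulticategory.{v, u}) where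
  F : C.Ob ⥤ D.Ob
  T2 {a b c : C.Ob} : C.T2.obj a b c → D.T2.obj (F.obj a) (F.obj b) (F.obj c)
  T3 {a₁ a₂ a₃ c : C.Ob} :
    C.T3.obj a₁ a₂ a₃ c → D.T3.obj (F.obj a₁) (F.obj a₂) (F.obj a₃) (F.obj c)
  T4 {a₁ a₂ a₃ a₄ c : C.Ob} : C.T4.obj a₁ a₂ a₃ a₄ c →
    D.T4.obj (F.obj a₁) (F.obj a₂) (F.obj a₃) (F.obj a₄) (F.obj c)
  L0 {c : C.Ob} : C.L0.obj c → D.L0.obj (F.obj c)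
  L1 {a c : C.Ob} : C.L1.obj a c → D.L1.obj (F.obj a) (F.obj c)
  L2 {a b c : C.Ob} : C.L2.obj a b c → D.L2.obj (F.obj a) (F.obj b) (F.obj c)
  nat_T2 {a a' b b' c c' : C.Ob} (p : a' ⟶ a) (q : b' ⟶ b) (h : c ⟶ c') (f : C.T2.obj a b c) :
    T2 (C.T2.map p q h f) = D.T2.map (F.map p) (F.map q) (F.map h) (T2 f)
  nat_T3 {a₁ a₁' a₂ a₂' a₃ a₃' c c' : C.Ob} (p₁ : a₁' ⟶ a₁) (p₂ : a₂' ⟶ a₂) (p₃ : a₃' ⟶ a₃)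
    (h : c ⟶ c') (f : C.T3.obj a₁ a₂ a₃ c) :
    T3 (C.T3.map p₁ p₂ p₃ h f) = D.T3.map (F.map p₁) (F.map p₂) (F.map p₃) (F.map h) (T3 f)
  nat_T4 {a₁ a₁' a₂ a₂' a₃ a₃' a₄ a₄' c c' : C.Ob} (p₁ : a₁' ⟶ a₁) (p₂ : a₂' ⟶ a₂)
    (p₃ : a₃' ⟶ a₃) (p₄ : a₄' ⟶ a₄) (h : c ⟶ c') (f : C.T4.obj a₁ a₂ a₃ a₄ c) :
    T4 (C.T4.map p₁ p₂ p₃ p₄ h f) =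
      D.T4.map (F.map p₁) (F.map p₂) (F.map p₃) (F.map p₄) (F.map h) (T4 f)
  nat_L0 {c c' : C.Ob} (h : c ⟶ c') (v : C.L0.obj c) : L0 (C.L0.map h v) = D.L0.map (F.map h) (L0 v)
  nat_L1 {a a' c c' : C.Ob} (p : a' ⟶ a) (h : c ⟶ c') (f : C.L1.obj a c) :
    L1 (C.L1.map p h f) = D.L1.map (F.map p) (F.map h) (L1 f)
  nat_L2 {a a' b b' c c' : C.Ob} (p : a' ⟶ a) (q : b' ⟶ b) (h : c ⟶ c') (f : C.L2.obj a b c) :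
    L2 (C.L2.map p q h f) = D.L2.map (F.map p) (F.map q) (F.map h) (L2 f)
  map_j1 {a c : C.Ob} (f : a ⟶ c) : L1 (C.j1 f) = D.j1 (F.map f)
  map_j2 {a b c : C.Ob} (f : C.T2.obj a b c) : L2 (C.j2 f) = D.j2 (T2 f)
  map_22_1 {b₁ b₂ c a₁ a₂ : C.Ob} (f : C.T2.obj b₁ b₂ c) (g : C.T2.obj a₁ a₂ b₁) :
    T3 (C.sub22_1 f g) = D.sub22_1 (T2 f) (T2 g)
  map_22_2 {b₁ b₂ c a₁ a₂ : C.Ob} (f : C.T2.obj b₁ b₂ c) (g : C.T2.obj a₁ a₂ b₂) :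
    T3 (C.sub22_2 f g) = D.sub22_2 (T2 f) (T2 g)
  map_32_1 {b₁ b₂ b₃ c a₁ a₂ : C.Ob} (f : C.T3.obj b₁ b₂ b₃ c) (g : C.T2.obj a₁ a₂ b₁) :
    T4 (C.sub32_1 f g) = D.sub32_1 (T3 f) (T2 g)
  map_32_2 {b₁ b₂ b₃ c a₁ a₂ : C.Ob} (f : C.T3.obj b₁ b₂ b₃ c) (g : C.T2.obj a₁ a₂ b₂) :
    T4 (C.sub32_2 f g) = D.sub32_2 (T3 f) (T2 g)
  map_32_3 {b₁ b₂ b₃ c a₁ a₂ : C.Ob} (f : C.T3.obj b₁ b₂ b₃ c) (g : C.T2.obj a₁ a₂ b₃) :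
    T4 (C.sub32_3 f g) = D.sub32_3 (T3 f) (T2 g)
  map_23_1 {b₁ b₂ c a₁ a₂ a₃ : C.Ob} (f : C.T2.obj b₁ b₂ c) (g : C.T3.obj a₁ a₂ a₃ b₁) :
    T4 (C.sub23_1 f g) = D.sub23_1 (T2 f) (T3 g)
  map_23_2 {b₁ b₂ c a₁ a₂ a₃ : C.Ob} (f : C.T2.obj b₁ b₂ c) (g : C.T3.obj a₁ a₂ a₃ b₂) :
    T4 (C.sub23_2 f g) = D.sub23_2 (T2 f) (T3 g)
  map_20_1 {b₁ b₂ c : C.Ob} (f : C.T2.obj b₁ b₂ c) (v : C.L0.obj b₁) :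
    L1 (C.sub20_1 f v) = D.sub20_1 (T2 f) (L0 v)
  map_20_2 {b₁ b₂ c : C.Ob} (f : C.T2.obj b₁ b₂ c) (v : C.L0.obj b₂) :
    F.map (C.sub20_2 f v) = D.sub20_2 (T2 f) (L0 v)
  map_30_1 {b₁ b₂ b₃ c : C.Ob} (f : C.T3.obj b₁ b₂ b₃ c) (v : C.L0.obj b₁) :
    L2 (C.sub30_1 f v) = D.sub30_1 (T3 f) (L0 v)
  map_30_2 {b₁ b₂ b₃ c : C.Ob} (f : C.T3.obj b₁ b₂ b₃ c) (v : C.L0.obj b₂) :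
    T2 (C.sub30_2 f v) = D.sub30_2 (T3 f) (L0 v)
  map_30_3 {b₁ b₂ b₃ c : C.Ob} (f : C.T3.obj b₁ b₂ b₃ c) (v : C.L0.obj b₃) :
    T2 (C.sub30_3 f v) = D.sub30_3 (T3 f) (L0 v)
  map_L1_0 {b c : C.Ob} (f : C.L1.obj b c) (v : C.L0.obj b) :
    L0 (C.subL1_0 f v) = D.subL1_0 (L1 f) (L0 v)
  map_2_L1_1 {b₁ b₂ c a : C.Ob} (f : C.T2.obj b₁ b₂ c) (g : C.L1.obj a b₁) :
    L2 (C.sub2_L1_1 f g) = D.sub2_L1_1 (T2 f) (L1 g)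
  map_2_L1_2 {b₁ b₂ c a : C.Ob} (f : C.T2.obj b₁ b₂ c) (g : C.L1.obj a b₂) :
    T2 (C.sub2_L1_2 f g) = D.sub2_L1_2 (T2 f) (L1 g)
  map_L1_2 {b c a₁ a₂ : C.Ob} (f : C.L1.obj b c) (g : C.T2.obj a₁ a₂ b) :
    L2 (C.subL1_2 f g) = D.subL1_2 (L1 f) (T2 g)

/-- The category of short skew multicategories. -/
instance : Category ShortSkewMulticategory.{v, u} where
  Hom C D := ShortSkewMultifunctor C D
  id C :=
    { F := 𝟭 _, T2 := fun f => f, T3 := fun f => f, T4 := fun f => f, L0 := fun f => f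
      L1 := fun f => f, L2 := fun f => f
      nat_T2 := fun _ _ _ _ => rfl, nat_T3 := fun _ _ _ _ _ => rfl
      nat_T4 := fun _ _ _ _ _ _ => rfl, nat_L0 := fun _ _ => rfl, nat_L1 := fun _ _ _ => rfl
      nat_L2 := fun _ _ _ _ => rfl, map_j1 := fun _ => rfl, map_j2 := fun _ => rfl
      map_22_1 := fun _ _ => rfl, map_22_2 := fun _ _ => rfl, map_32_1 := fun _ _ => rfl
      map_32_2 := fun _ _ => rfl, map_32_3 := fun _ _ => rfl, map_23_1 := fun _ _ => rfl
      map_23_2 := fun _ _ => rfl, map_20_1 := fun _ _ => rfl, map_20_2 := fun _ _ => rfl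
      map_30_1 := fun _ _ => rfl, map_30_2 := fun _ _ => rfl, map_30_3 := fun _ _ => rfl
      map_L1_0 := fun _ _ => rfl, map_2_L1_1 := fun _ _ => rfl, map_2_L1_2 := fun _ _ => rfl
      map_L1_2 := fun _ _ => rfl }
  comp F G :=
    { F := F.F ⋙ G.F
      T2 := fun f => G.T2 (F.T2 f), T3 := fun f => G.T3 (F.T3 f), T4 := fun f => G.T4 (F.T4 f)
      L0 := fun f => G.L0 (F.L0 f), L1 := fun f => G.L1 (F.L1 f), L2 := fun f => G.L2 (F.L2 f)
      nat_T2 := by intros; simp only [F.nat_T2, G.nat_T2, Functor.comp_map]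
      nat_T3 := by intros; simp only [F.nat_T3, G.nat_T3, Functor.comp_map]
      nat_T4 := by intros; simp only [F.nat_T4, G.nat_T4, Functor.comp_map]
      nat_L0 := by intros; simp only [F.nat_L0, G.nat_L0, Functor.comp_map]
      nat_L1 := by intros; simp only [F.nat_L1, G.nat_L1, Functor.comp_map]
      nat_L2 := by intros; simp only [F.nat_L2, G.nat_L2, Functor.comp_map]
      map_j1 := by intros; simp only [F.map_j1, G.map_j1, Functor.comp_map]
      map_j2 := by intros; simp only [F.map_j2, G.map_j2]
      map_22_1 := by intros; simp only [F.map_22_1, G.map_22_1]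
      map_22_2 := by intros; simp only [F.map_22_2, G.map_22_2]
      map_32_1 := by intros; simp only [F.map_32_1, G.map_32_1]
      map_32_2 := by intros; simp only [F.map_32_2, G.map_32_2]
      map_32_3 := by intros; simp only [F.map_32_3, G.map_32_3]
      map_23_1 := by intros; simp only [F.map_23_1, G.map_23_1]
      map_23_2 := by intros; simp only [F.map_23_2, G.map_23_2]
      map_20_1 := by intros; simp only [F.map_20_1, G.map_20_1]
      map_20_2 := by intros; simp only [F.map_20_2, G.map_20_2, Functor.comp_map]
      map_30_1 := by intros; simp only [F.map_30_1, G.map_30_1]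
      map_30_2 := by intros; simp only [F.map_30_2, G.map_30_2]
      map_30_3 := by intros; simp only [F.map_30_3, G.map_30_3]
      map_L1_0 := by intros; simp only [F.map_L1_0, G.map_L1_0]
      map_2_L1_1 := by intros; simp only [F.map_2_L1_1, G.map_2_L1_1]
      map_2_L1_2 := by intros; simp only [F.map_2_L1_2, G.map_2_L1_2]
      map_L1_2 := by intros; simp only [F.map_L1_2, G.map_L1_2] }
  id_comp _ := rfl
  comp_id _ := rfl
  assoc _ _ _ := rfl

namespace ShortSkewMulticategory

/-- `e : h, b → c` exhibits `h` as an internal hom `[b, c]`: all the functions `e ∘₁ -` are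
bijective. -/
def IsInternalHom (C : ShortSkewMulticategory.{v, u}) {h b c : C.Ob} (e : C.T2.obj h b c) : Prop :=
  (∀ x : C.Ob, Function.Bijective fun f : x ⟶ h => C.T2.map f (𝟙 b) (𝟙 c) e) ∧
  (∀ x y : C.Ob, Function.Bijective fun f : C.T2.obj x y h => C.sub22_1 e f) ∧
  (∀ x y z : C.Ob, Function.Bijective fun f : C.T3.obj x y z h => C.sub23_1 e f) ∧
  (Function.Bijective fun v : C.L0.obj h => C.sub20_1 e v) ∧
  (∀ x : C.Ob, Function.Bijective fun f : C.L1.obj x h => C.sub2_L1_1 e f)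

/-- A short skew multicategory is closed if it has all internal homs `[b, c]`. -/
def IsClosed (C : ShortSkewMulticategory.{v, u}) : Prop :=
  ∀ b c : C.Ob, ∃ (h : C.Ob) (e : C.T2.obj h b c), C.IsInternalHom e

/-- `u` is a nullary map classifier: it represents the functor of nullary maps. -/
def IsNullaryClassifier (C : ShortSkewMulticategory.{v, u}) {i : C.Ob} (u : C.L0.obj i) : Prop :=
  ∀ a : C.Ob, Function.Bijective fun f : i ⟶ a => C.L0.map f u

/-- Closed, with a nullary map classifier. -/
def closedWithUnit : ObjectProperty ShortSkewMulticategory.{v, u} :=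
  fun C => C.IsClosed ∧ ∃ (i : C.Ob) (u : C.L0.obj i), C.IsNullaryClassifier u

end ShortSkewMulticategory

/-- Closed short skew multicategories with a nullary map classifier; a full subcategory of the
category of short skew multicategories. -/
abbrev ClosedShortSkewMulti : Type (max (u + 1) (v + 1)) :=
  ShortSkewMulticategory.closedWithUnit.{v, u}.FullSubcategory

/-! ### Skew closed categories -/

/-- A (left) skew closed category: a functor `hom : Cᵒᵖ × C ⥤ C` and an object `i` with
(extra)natural families `I : [i, a] ⟶ a`, `J : i ⟶ [a, a]`, `L : [b, c] ⟶ [[a, b], [a, c]]`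
satisfying five axioms. -/
structure SkewClosedCategory where
  Ob : Type u
  [cat : Category.{v} Ob]
  hom : Ob → Ob → Ob
  homMap {b b' c c' : Ob} : (b' ⟶ b) → (c ⟶ c') → (hom b c ⟶ hom b' c')
  homMap_id (b c : Ob) : homMap (𝟙 b) (𝟙 c) = 𝟙 (hom b c)
  homMap_comp {b b' b'' c c' c'' : Ob} (p : b' ⟶ b) (p' : b'' ⟶ b') (h : c ⟶ c') (h' : c' ⟶ c'') :
    homMap p h ≫ homMap p' h' = homMap (p' ≫ p) (h ≫ h')
  i : Ob
  I (a : Ob) : hom i a ⟶ a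
  J (a : Ob) : i ⟶ hom a a
  L (a b c : Ob) : hom b c ⟶ hom (hom a b) (hom a c)
  nat_I {a a' : Ob} (f : a ⟶ a') : homMap (𝟙 i) f ≫ I a' = I a ≫ f
  nat_J {a a' : Ob} (f : a ⟶ a') : J a ≫ homMap (𝟙 a) f = J a' ≫ homMap f (𝟙 a')
  nat_L (a : Ob) {b b' c c' : Ob} (p : b' ⟶ b) (h : c ⟶ c') :
    homMap p h ≫ L a b' c' = L a b c ≫ homMap (homMap (𝟙 a) p) (homMap (𝟙 a) h)
  din_L {a a' : Ob} (k : a ⟶ a') (b c : Ob) :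
    L a b c ≫ homMap (homMap k (𝟙 b)) (𝟙 (hom a c)) =
      L a' b c ≫ homMap (𝟙 (hom a' b)) (homMap k (𝟙 c))
  pentagon (a b c d : Ob) :
    L a c d ≫ L (hom a b) (hom a c) (hom a d) ≫ homMap (L a b c) (𝟙 _) =
      L b c d ≫ homMap (𝟙 (hom b c)) (L a b d)
  L_J_I (a c : Ob) : L a a c ≫ homMap (J a) (𝟙 _) ≫ I (hom a c) = 𝟙 (hom a c)
  J_L (a b : Ob) : J b ≫ L a b b = J (hom a b)
  L_I (b c : Ob) : L i b c ≫ homMap (𝟙 _) (I c) = homMap (I b) (𝟙 c)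
  J_I : J i ≫ I i = 𝟙 i

attribute [instance] SkewClosedCategory.cat

/-- A closed functor between skew closed categories. -/
structure ClosedFunctor (V W : SkewClosedCategory.{v, u}) where
  F : V.Ob ⥤ W.Ob
  f0 : W.i ⟶ F.obj V.i
  f2 (a b : V.Ob) : F.obj (V.hom a b) ⟶ W.hom (F.obj a) (F.obj b)
  nat_f2 {a a' b b' : V.Ob} (p : a' ⟶ a) (h : b ⟶ b') :
    F.map (V.homMap p h) ≫ f2 a' b' = f2 a b ≫ W.homMap (F.map p) (F.map h)
  map_I (a : V.Ob) : f2 V.i a ≫ W.homMap f0 (𝟙 _) ≫ W.I (F.obj a) = F.map (V.I a)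
  map_J (a : V.Ob) : f0 ≫ F.map (V.J a) ≫ f2 a a = W.J (F.obj a)
  map_L (a b c : V.Ob) :
    F.map (V.L a b c) ≫ f2 (V.hom a b) (V.hom a c) ≫ W.homMap (𝟙 _) (f2 a c) =
      f2 b c ≫ W.L (F.obj a) (F.obj b) (F.obj c) ≫ W.homMap (f2 a b) (𝟙 _)

theorem ClosedFunctor.ext' {V W : SkewClosedCategory.{v, u}} {G H : ClosedFunctor V W}
    (hF : G.F = H.F) (h0 : G.f0 ≫ eqToHom (by rw [hF]) = H.f0)
    (h2 : ∀ a b, G.f2 a b =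
      eqToHom (by rw [hF]) ≫ H.f2 a b ≫ eqToHom (by rw [hF])) : G = H := by
  cases G with
  | mk F f0 f2 _ _ _ _ =>
    cases H with
    | mk F' f0' f2' _ _ _ _ =>
      dsimp only at hF
      subst hF
      simp only [eqToHom_refl, Category.comp_id, Category.id_comp] at h0 h2
      subst h0
      have : f2 = f2' := by funext a b; exact h2 a b
      subst this
      rfl

/-- The category of skew closed categories and closed functors. -/
instance : Category SkewClosedCategory.{v, u} where
  Hom V W := ClosedFunctor V W
  id V :=
    { F := 𝟭 _, f0 := 𝟙 _, f2 := fun _ _ => 𝟙 _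
      nat_f2 := fun _ _ => by simp
      map_I := fun _ => by simp [V.homMap_id]
      map_J := fun _ => by simp
      map_L := fun _ _ _ => by simp [V.homMap_id] }
  comp {V W X} G H :=
    { F := G.F ⋙ H.F
      f0 := H.f0 ≫ H.F.map G.f0
      f2 := fun a b => H.F.map (G.f2 a b) ≫ H.f2 (G.F.obj a) (G.F.obj b)
      nat_f2 := fun p h => by
        have e := congrArg H.F.map (G.nat_f2 p h)
        simp only [Functor.map_comp] at e
        simp only [Functor.comp_obj, Functor.comp_map, Category.assoc]
        rw [reassoc_of% e, H.nat_f2]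
      map_I := fun a => by
        simp only [Functor.comp_obj, Functor.comp_map, Category.assoc]
        rw [← G.map_I a, Functor.map_comp, Functor.map_comp, ← H.map_I (G.F.obj a)]
        rw [show X.homMap (H.f0 ≫ H.F.map G.f0) (𝟙 (H.F.obj (G.F.obj a))) =
          X.homMap (H.F.map G.f0) (H.F.map (𝟙 _)) ≫ X.homMap H.f0 (𝟙 _) by
            rw [X.homMap_comp]; simp]
        rw [Category.assoc, ← reassoc_of% (H.nat_f2 G.f0 (𝟙 (G.F.obj a)))]
      map_J := fun a => by
        have e := congrArg H.F.map (G.map_J a)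
        simp only [Functor.map_comp] at e
        simp only [Functor.comp_obj, Functor.comp_map, Category.assoc]
        rw [reassoc_of% e, H.map_J]
      map_L := fun a b c => by
        have e := congrArg H.F.map (G.map_L a b c)
        simp only [Functor.map_comp] at e
        simp only [Functor.comp_obj, Functor.comp_map, Category.assoc]
        rw [show X.homMap (𝟙 (H.F.obj (G.F.obj (V.hom a b))))
            (H.F.map (G.f2 a c) ≫ H.f2 (G.F.obj a) (G.F.obj c)) =
            X.homMap (H.F.map (𝟙 _)) (H.F.map (G.f2 a c)) ≫
              X.homMap (𝟙 _) (H.f2 (G.F.obj a) (G.F.obj c)) by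
          rw [X.homMap_comp]; simp]
        rw [← reassoc_of% (H.nat_f2 (𝟙 (G.F.obj (V.hom a b))) (G.f2 a c)), reassoc_of% e]
        rw [reassoc_of% (H.nat_f2 (G.f2 a b) (𝟙 (W.hom (G.F.obj a) (G.F.obj c))))]
        rw [X.homMap_comp]
        have e2 := H.map_L (G.F.obj a) (G.F.obj b) (G.F.obj c)
        rw [show X.homMap (𝟙 (H.F.obj (G.F.obj (V.hom a b))) ≫ H.F.map (G.f2 a b))
            (H.F.map (𝟙 (W.hom (G.F.obj a) (G.F.obj c))) ≫ H.f2 (G.F.obj a) (G.F.obj c)) =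
            X.homMap (𝟙 _) (H.f2 (G.F.obj a) (G.F.obj c)) ≫
              X.homMap (H.F.map (G.f2 a b)) (𝟙 _) by
          rw [X.homMap_comp]; simp]
        rw [reassoc_of% e2, X.homMap_comp]
        simp }
  id_comp G := ClosedFunctor.ext' rfl (by simp) (fun _ _ => by simp)
  comp_id G := ClosedFunctor.ext' rfl (by simp) (fun _ _ => by simp)
  assoc G H K := ClosedFunctor.ext' rfl (by simp) (fun _ _ => by simp)

namespace ShortSkewMulticategory

/-! ### The skew closed category of a closed short skew multicategory with unit -/

/-- A choice of internal homs and of a nullary map classifier. -/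
structure ClosedData (C : ShortSkewMulticategory.{v, u}) where
  hom : C.Ob → C.Ob → C.Ob
  e (b c : C.Ob) : C.T2.obj (hom b c) b c
  he (b c : C.Ob) : C.IsInternalHom (e b c)
  i : C.Ob
  u : C.L0.obj i
  hu : C.IsNullaryClassifier u

namespace ClosedData

variable {C : ShortSkewMulticategory.{v, u}} (d : C.ClosedData)

/-- The tight unary map `x ⟶ [b, c]` corresponding to `f : x, b → c`. -/
noncomputable def curry {x b c : C.Ob} (f : C.T2.obj x b c) : x ⟶ d.hom b c :=
  (((d.he b c).1 x).2 f).choose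

theorem curry_spec {x b c : C.Ob} (f : C.T2.obj x b c) :
    C.T2.map (d.curry f) (𝟙 b) (𝟙 c) (d.e b c) = f :=
  (((d.he b c).1 x).2 f).choose_spec

theorem hom_ext {x b c : C.Ob} {f g : x ⟶ d.hom b c}
    (h : C.T2.map f (𝟙 b) (𝟙 c) (d.e b c) = C.T2.map g (𝟙 b) (𝟙 c) (d.e b c)) : f = g :=
  ((d.he b c).1 x).1 h

theorem T2_ext {x y b c : C.Ob} {f g : C.T2.obj x y (d.hom b c)}
    (h : C.sub22_1 (d.e b c) f = C.sub22_1 (d.e b c) g) : f = g :=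
  ((d.he b c).2.1 x y).1 h

theorem T3_ext {x y z b c : C.Ob} {f g : C.T3.obj x y z (d.hom b c)}
    (h : C.sub23_1 (d.e b c) f = C.sub23_1 (d.e b c) g) : f = g :=
  ((d.he b c).2.2.1 x y z).1 h

theorem L0_ext {b c : C.Ob} {v w : C.L0.obj (d.hom b c)}
    (h : C.sub20_1 (d.e b c) v = C.sub20_1 (d.e b c) w) : v = w :=
  (d.he b c).2.2.2.1.1 h

theorem u_ext {a : C.Ob} {f g : d.i ⟶ a} (h : C.L0.map f d.u = C.L0.map g d.u) : f = g :=
  (d.hu a).1 h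

/-- The tight binary map `x, y → [b, c]` corresponding to `f : x, y, b → c`. -/
noncomputable def curry3 {x y b c : C.Ob} (f : C.T3.obj x y b c) : C.T2.obj x y (d.hom b c) :=
  (((d.he b c).2.1 x y).2 f).choose

theorem curry3_spec {x y b c : C.Ob} (f : C.T3.obj x y b c) :
    C.sub22_1 (d.e b c) (d.curry3 f) = f :=
  (((d.he b c).2.1 x y).2 f).choose_spec

/-- The map `[p, h]`: the unique one with `e ∘₁ [p, h] = (h ∘ e) ∘₂ p`. -/
noncomputable def homMap {b b' c c' : C.Ob} (p : b' ⟶ b) (h : c ⟶ c') : d.hom b c ⟶ d.hom b' c' :=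
  d.curry (C.T2.map (𝟙 _) p h (d.e b c))

theorem homMap_spec {b b' c c' : C.Ob} (p : b' ⟶ b) (h : c ⟶ c') :
    C.T2.map (d.homMap p h) (𝟙 b') (𝟙 c') (d.e b' c') = C.T2.map (𝟙 _) p h (d.e b c) :=
  d.curry_spec _

/-- The right unit `I = e ∘₂ u`. -/
def I (a : C.Ob) : d.hom d.i a ⟶ a := C.sub20_2 (d.e d.i a) d.u

theorem exists_J (a : C.Ob) : ∃ k : d.i ⟶ d.hom a a,
    C.sub20_1 (C.T2.map k (𝟙 a) (𝟙 a) (d.e a a)) d.u = C.j1 (𝟙 a) := by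
  obtain ⟨w, hw⟩ := (d.he a a).2.2.2.1.2 (C.j1 (𝟙 a))
  obtain ⟨k, hk⟩ := (d.hu (d.hom a a)).2 w
  refine ⟨k, ?_⟩
  rw [C.din_20_1]
  exact (congrArg (C.sub20_1 (d.e a a)) hk).trans hw

/-- The left unit `J`: the unique map with `(e ∘₁ J) ∘₁ u = j 1`. -/
noncomputable def J (a : C.Ob) : d.i ⟶ d.hom a a := (d.exists_J a).choose

theorem J_spec (a : C.Ob) :
    C.sub20_1 (C.T2.map (d.J a) (𝟙 a) (𝟙 a) (d.e a a)) d.u = C.j1 (𝟙 a) :=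
  (d.exists_J a).choose_spec

/-- The associator `L`: the unique map with `e ∘₁ (e ∘₁ L) = e ∘₂ e`. -/
noncomputable def L (a b c : C.Ob) : d.hom b c ⟶ d.hom (d.hom a b) (d.hom a c) :=
  d.curry (d.curry3 (C.sub22_2 (d.e b c) (d.e a b)))

theorem L_spec (a b c : C.Ob) :
    C.sub22_1 (d.e a c) (C.T2.map (d.L a b c) (𝟙 _) (𝟙 _) (d.e (d.hom a b) (d.hom a c))) =
      C.sub22_2 (d.e b c) (d.e a b) := by
  rw [L, curry_spec, curry3_spec]

-- general forms of the naturality equations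

theorem n22_1 {b₁ b₁' b₂ b₂' c c' a₁ a₁' a₂ a₂' : C.Ob} (p₁ : a₁' ⟶ a₁) (p₂ : a₂' ⟶ a₂)
    (k : b₁ ⟶ b₁') (q : b₂' ⟶ b₂) (h : c ⟶ c') (f : C.T2.obj b₁' b₂ c) (g : C.T2.obj a₁ a₂ b₁) :
    C.sub22_1 (C.T2.map (𝟙 _) q h f) (C.T2.map p₁ p₂ k g) =
      C.T3.map p₁ p₂ q h (C.sub22_1 (C.T2.map k (𝟙 _) (𝟙 _) f) g) := by
  rw [C.din_22_1, ← C.nat_22_1, C.T2.map_comp]; simp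

theorem T2_comp1 {x y b b' c c' z : C.Ob} (f : x ⟶ y) (g : y ⟶ z) (p : b' ⟶ b) (h : c ⟶ c')
    (m : C.T2.obj z b c) :
    C.T2.map (f ≫ g) p h m = C.T2.map f p h (C.T2.map g (𝟙 _) (𝟙 _) m) := by
  rw [C.T2.map_comp]; simp

theorem T2_comp1' {x y b b' c c' z : C.Ob} (f : x ⟶ y) (g : y ⟶ z) (p : b' ⟶ b) (h : c ⟶ c')
    (m : C.T2.obj z b c) :
    C.T2.map (f ≫ g) p h m = C.T2.map f (𝟙 _) (𝟙 _) (C.T2.map g p h m) := by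
  rw [C.T2.map_comp]; simp

theorem e_comp {x y b c : C.Ob} (f : x ⟶ y) (g : y ⟶ d.hom b c) :
    C.T2.map (f ≫ g) (𝟙 _) (𝟙 _) (d.e b c) =
      C.T2.map f (𝟙 _) (𝟙 _) (C.T2.map g (𝟙 _) (𝟙 _) (d.e b c)) := T2_comp1 ..

theorem e_homMap {x b b' c c' : C.Ob} (f : x ⟶ d.hom b c) (p : b' ⟶ b) (h : c ⟶ c') :
    C.T2.map (f ≫ d.homMap p h) (𝟙 _) (𝟙 _) (d.e b' c') = C.T2.map f p h (d.e b c) := by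
  rw [e_comp, homMap_spec, C.T2.map_comp]; simp

theorem homMap_id (b c : C.Ob) : d.homMap (𝟙 b) (𝟙 c) = 𝟙 (d.hom b c) :=
  d.hom_ext (d.homMap_spec _ _)

theorem homMap_comp {b b' b'' c c' c'' : C.Ob} (p : b' ⟶ b) (p' : b'' ⟶ b') (h : c ⟶ c')
    (h' : c' ⟶ c'') : d.homMap p h ≫ d.homMap p' h' = d.homMap (p' ≫ p) (h ≫ h') := by
  apply d.hom_ext
  rw [e_homMap, homMap_spec]
  have := congrArg (C.T2.map (𝟙 _) p' h') (d.homMap_spec p h)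
  simp only [C.T2.map_comp, Category.id_comp, Category.comp_id] at this
  exact this

/-- Substituting `u` in the second variable. -/
theorem comp_I {x a : C.Ob} (f : x ⟶ d.hom d.i a) :
    f ≫ d.I a = C.sub20_2 (C.T2.map f (𝟙 _) (𝟙 _) (d.e d.i a)) d.u := by
  rw [C.nat_20_2, Category.comp_id, I]

theorem nat_I {a a' : C.Ob} (f : a ⟶ a') : d.homMap (𝟙 d.i) f ≫ d.I a' = d.I a ≫ f := by
  rw [comp_I, homMap_spec, C.nat_20_2, Category.id_comp, I]

/-- Two maps `i ⟶ [b, c]` agree if the loose unary maps `(e ∘₁ f) ∘₁ u` do. -/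
theorem i_ext {b c : C.Ob} {f g : d.i ⟶ d.hom b c}
    (h : C.sub20_1 (C.T2.map f (𝟙 _) (𝟙 _) (d.e b c)) d.u =
      C.sub20_1 (C.T2.map g (𝟙 _) (𝟙 _) (d.e b c)) d.u) : f = g := by
  rw [C.din_20_1, C.din_20_1] at h
  exact d.u_ext (d.L0_ext h)

/-- `(e ∘₁ (f ∘ J)) ∘₁ u`. -/
theorem J_homMap {a b c : C.Ob} (p : b ⟶ a) (h : a ⟶ c) :
    C.sub20_1 (C.T2.map (d.J a ≫ d.homMap p h) (𝟙 _) (𝟙 _) (d.e b c)) d.u = C.j1 (p ≫ h) := by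
  rw [e_homMap]
  have e1 : C.T2.map (d.J a) p h (d.e a a) =
      C.T2.map (𝟙 _) p h (C.T2.map (d.J a) (𝟙 _) (𝟙 _) (d.e a a)) := by
    rw [C.T2.map_comp]; simp
  rw [e1, C.nat_20_1, J_spec, ← C.nat_j1]; simp

theorem nat_J {a a' : C.Ob} (f : a ⟶ a') :
    d.J a ≫ d.homMap (𝟙 a) f = d.J a' ≫ d.homMap f (𝟙 a') := by
  apply d.i_ext
  rw [J_homMap, J_homMap]; simp

/-- Two maps `x ⟶ [y, [b, c]]` agree if the ternary maps `e ∘₁ (e ∘₁ f)` do. -/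
theorem hom_ext2 {x y b c : C.Ob} {f g : x ⟶ d.hom y (d.hom b c)}
    (h : C.sub22_1 (d.e b c) (C.T2.map f (𝟙 _) (𝟙 _) (d.e y (d.hom b c))) =
      C.sub22_1 (d.e b c) (C.T2.map g (𝟙 _) (𝟙 _) (d.e y (d.hom b c)))) : f = g :=
  d.hom_ext (d.T2_ext h)

/-- The basic computation with `L`: `e ∘₁ (e ∘₁ (f ≫ L ≫ [p, [q, h]]))`. -/
theorem L_eq {x y a a' b c c' : C.Ob} (f : x ⟶ d.hom b c) (p : y ⟶ d.hom a b)
    (q : a' ⟶ a) (h : c ⟶ c') :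
    C.sub22_1 (d.e a' c') (C.T2.map (f ≫ d.L a b c) p (d.homMap q h)
      (d.e (d.hom a b) (d.hom a c))) =
      C.T3.map f p q h (C.sub22_2 (d.e b c) (d.e a b)) := by
  rw [← L_spec]
  have e1 : C.T2.map (f ≫ d.L a b c) p (d.homMap q h) (d.e (d.hom a b) (d.hom a c)) =
      C.T2.map f p (d.homMap q h) (C.T2.map (d.L a b c) (𝟙 _) (𝟙 _)
        (d.e (d.hom a b) (d.hom a c))) := T2_comp1 ..
  have e2 := n22_1 f p (d.homMap q h) (𝟙 a') (𝟙 c') (d.e a' c')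
    (C.T2.map (d.L a b c) (𝟙 _) (𝟙 _) (d.e (d.hom a b) (d.hom a c)))
  rw [C.T2.map_id] at e2
  rw [e1, e2, homMap_spec]
  have e3 := C.nat_22_1 (𝟙 _) (𝟙 _) q h (d.e a c)
    (C.T2.map (d.L a b c) (𝟙 _) (𝟙 _) (d.e (d.hom a b) (d.hom a c)))
  rw [C.T2.map_id] at e3
  rw [e3, C.T3.map_comp]
  simp

theorem nat_L (a : C.Ob) {b b' c c' : C.Ob} (p : b' ⟶ b) (h : c ⟶ c') :
    d.homMap p h ≫ d.L a b' c' =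
      d.L a b c ≫ d.homMap (d.homMap (𝟙 a) p) (d.homMap (𝟙 a) h) := by
  apply d.hom_ext2
  rw [e_homMap]
  have e1 := d.L_eq (d.homMap p h) (𝟙 (d.hom a b')) (𝟙 a) (𝟙 c')
  rw [homMap_id] at e1
  have e2 := d.L_eq (𝟙 (d.hom b c)) (d.homMap (𝟙 a) p) (𝟙 a) h
  rw [Category.id_comp] at e2
  rw [e1, e2]
  have e3 := C.nat_22_2 (𝟙 _) (𝟙 _) (d.homMap p h) (𝟙 _) (d.e b' c') (d.e a b')
  rw [C.T2.map_id] at e3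
  have e4 := C.nat_22_2 (d.homMap (𝟙 a) p) (𝟙 _) (𝟙 _) h (d.e b c) (d.e a b)
  rw [← e3, ← e4, homMap_spec]
  have e5 : C.T2.map (𝟙 _) p h (d.e b c) =
      C.T2.map (𝟙 _) p (𝟙 _) (C.T2.map (𝟙 _) (𝟙 _) h (d.e b c)) := by
    rw [C.T2.map_comp]; simp
  rw [e5, C.din_22_2]
  congr 1
  rw [← homMap_spec]

theorem din_L {a a' : C.Ob} (k : a ⟶ a') (b c : C.Ob) :
    d.L a b c ≫ d.homMap (d.homMap k (𝟙 b)) (𝟙 (d.hom a c)) =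
      d.L a' b c ≫ d.homMap (𝟙 (d.hom a' b)) (d.homMap k (𝟙 c)) := by
  apply d.hom_ext2
  rw [e_homMap, e_homMap]
  have e1 := d.L_eq (𝟙 (d.hom b c)) (d.homMap k (𝟙 b)) (𝟙 a) (𝟙 c)
  rw [homMap_id, Category.id_comp] at e1
  have e2 := d.L_eq (𝟙 (d.hom b c)) (𝟙 (d.hom a' b)) k (𝟙 c)
  rw [Category.id_comp] at e2
  rw [e1, e2, ← C.nat_22_2, ← C.nat_22_2, C.T2.map_id]
  congr 1
  rw [homMap_spec]

/-- `e ∘₁ (e ∘₁ (e ∘₁ f))` determines `f : x ⟶ [y, [z, [b, c]]]`. -/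
theorem hom_ext3 {x y z b c : C.Ob} {f g : x ⟶ d.hom y (d.hom z (d.hom b c))}
    (h : C.sub23_1 (d.e b c) (C.sub22_1 (d.e z (d.hom b c))
        (C.T2.map f (𝟙 _) (𝟙 _) (d.e y (d.hom z (d.hom b c))))) =
      C.sub23_1 (d.e b c) (C.sub22_1 (d.e z (d.hom b c))
        (C.T2.map g (𝟙 _) (𝟙 _) (d.e y (d.hom z (d.hom b c)))))) : f = g :=
  d.hom_ext2 (d.T3_ext h)

theorem L_eq' {x y a b c : C.Ob} (f : x ⟶ d.hom b c) (p : y ⟶ d.hom a b) :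
    C.sub22_1 (d.e a c) (C.T2.map (f ≫ d.L a b c) p (𝟙 _) (d.e (d.hom a b) (d.hom a c))) =
      C.sub22_2 (C.T2.map f (𝟙 _) (𝟙 _) (d.e b c)) (C.T2.map p (𝟙 _) (𝟙 _) (d.e a b)) := by
  have e1 := d.L_eq f p (𝟙 a) (𝟙 c)
  rw [homMap_id] at e1
  rw [e1, C.nat_22_2]

theorem pentagon (a b c t : C.Ob) :
    d.L a c t ≫ d.L (d.hom a b) (d.hom a c) (d.hom a t) ≫ d.homMap (d.L a b c) (𝟙 _) =
      d.L b c t ≫ d.homMap (𝟙 (d.hom b c)) (d.L a b t) := by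
  apply d.hom_ext3
  rw [← Category.assoc, e_homMap, e_homMap, L_eq', C.line_a_12, L_spec, ← C.line_a_21, L_spec]
  have e1 : C.T2.map (d.L b c t) (𝟙 _) (d.L a b t) (d.e (d.hom b c) (d.hom b t)) =
      C.T2.map (𝟙 _) (𝟙 _) (d.L a b t)
        (C.T2.map (d.L b c t) (𝟙 _) (𝟙 _) (d.e (d.hom b c) (d.hom b t))) := by
    rw [C.T2.map_comp]; simp
  rw [e1, ← C.din_22_1, C.line_a_11, L_spec, ← C.comm_a, L_spec, ← C.line_a_22]

theorem L_J_I (a c : C.Ob) :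
    d.L a a c ≫ d.homMap (d.J a) (𝟙 _) ≫ d.I (d.hom a c) = 𝟙 (d.hom a c) := by
  apply d.hom_ext
  rw [← Category.assoc, comp_I, e_homMap, C.T2.map_id, C.line_b_12]
  have e1 := d.L_eq' (𝟙 (d.hom a c)) (d.J a)
  rw [Category.id_comp, C.T2.map_id] at e1
  rw [e1, ← C.line_b_21, J_spec, C.j_2_L1_2, C.T2.map_id]

theorem J_L (a b : C.Ob) : d.J b ≫ d.L a b b = d.J (d.hom a b) := by
  apply d.i_ext
  rw [J_spec]
  apply ((d.he a b).2.2.2.2 _).1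
  have e1 := d.L_eq' (d.J b) (𝟙 (d.hom a b))
  rw [C.T2.map_id] at e1
  change C.sub2_L1_1 _ _ = C.sub2_L1_1 _ _
  rw [C.line_b_11, e1, ← C.comm_c, J_spec, C.j_L1_2, C.j_2_L1_1]

theorem L_I (b c : C.Ob) : d.L d.i b c ≫ d.homMap (𝟙 _) (d.I c) = d.homMap (d.I b) (𝟙 c) := by
  apply d.hom_ext
  rw [e_homMap, homMap_spec]
  have e1 : C.T2.map (d.L d.i b c) (𝟙 _) (d.I c) (d.e (d.hom d.i b) (d.hom d.i c)) =
      C.T2.map (𝟙 _) (𝟙 _) (d.I c)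
        (C.T2.map (d.L d.i b c) (𝟙 _) (𝟙 _) (d.e (d.hom d.i b) (d.hom d.i c))) := by
    rw [C.T2.map_comp]; simp
  rw [e1, I, ← C.comm_b, L_spec, ← C.line_b_22, I]

theorem J_I : d.J d.i ≫ d.I d.i = 𝟙 d.i := by
  apply d.u_ext
  rw [comp_I, ← C.comm_d, J_spec, C.j_L1_0]

/-- The skew closed category of a closed short skew multicategory with unit. -/
noncomputable def toSkewClosed : SkewClosedCategory.{v, u} where
  Ob := C.Ob
  hom := d.hom
  homMap := d.homMap
  homMap_id := d.homMap_id
  homMap_comp := d.homMap_comp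
  i := d.i
  I := d.I
  J := d.J
  L := d.L
  nat_I := d.nat_I
  nat_J := d.nat_J
  nat_L := d.nat_L
  din_L := d.din_L
  pentagon := d.pentagon
  L_J_I := d.L_J_I
  J_L := d.J_L
  L_I := d.L_I
  J_I := d.J_I

section Map

variable {D : ShortSkewMulticategory.{v, u}} (d' : D.ClosedData) (G : ShortSkewMultifunctor C D)

theorem exists_f0 : ∃ k : d'.i ⟶ G.F.obj d.i, D.L0.map k d'.u = G.L0 d.u :=
  (d'.hu (G.F.obj d.i)).2 (G.L0 d.u)

/-- The unique map `f₀ : i ⟶ F i` with `f₀ ∘ u = F u`. -/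
noncomputable def f0 : d'.i ⟶ G.F.obj d.i := (d.exists_f0 d' G).choose

theorem f0_spec : D.L0.map (d.f0 d' G) d'.u = G.L0 d.u := (d.exists_f0 d' G).choose_spec

/-- The unique map `f_{a,b} : F [a, b] ⟶ [F a, F b]` with `e ∘₁ f_{a,b} = F e`. -/
noncomputable def f2 (a b : C.Ob) : G.F.obj (d.hom a b) ⟶ d'.hom (G.F.obj a) (G.F.obj b) :=
  d'.curry (G.T2 (d.e a b))

theorem f2_spec (a b : C.Ob) :
    D.T2.map (d.f2 d' G a b) (𝟙 _) (𝟙 _) (d'.e (G.F.obj a) (G.F.obj b)) = G.T2 (d.e a b) :=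
  d'.curry_spec _

theorem e_f2 {a b : C.Ob} {x : D.Ob} (k : x ⟶ G.F.obj (d.hom a b)) :
    D.T2.map (k ≫ d.f2 d' G a b) (𝟙 _) (𝟙 _) (d'.e (G.F.obj a) (G.F.obj b)) =
      D.T2.map k (𝟙 _) (𝟙 _) (G.T2 (d.e a b)) := by
  rw [e_comp, f2_spec]

theorem nat_f2 {a a' b b' : C.Ob} (p : a' ⟶ a) (h : b ⟶ b') :
    G.F.map (d.homMap p h) ≫ d.f2 d' G a' b' =
      d.f2 d' G a b ≫ d'.homMap (G.F.map p) (G.F.map h) := by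
  apply d'.hom_ext
  have e1 := G.nat_T2 (d.homMap p h) (𝟙 _) (𝟙 _) (d.e a' b')
  rw [homMap_spec, G.nat_T2] at e1
  rw [G.F.map_id, G.F.map_id, G.F.map_id] at e1
  rw [e_f2, e_homMap, ← e1, ← f2_spec d d' G a b, D.T2.map_comp]
  simp

theorem map_I (a : C.Ob) :
    d.f2 d' G d.i a ≫ d'.homMap (d.f0 d' G) (𝟙 _) ≫ d'.I (G.F.obj a) = G.F.map (d.I a) := by
  rw [← Category.assoc, comp_I, e_homMap]
  have e1 : D.T2.map (d.f2 d' G d.i a) (d.f0 d' G) (𝟙 _) (d'.e (G.F.obj d.i) (G.F.obj a)) =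
      D.T2.map (𝟙 _) (d.f0 d' G) (𝟙 _) (D.T2.map (d.f2 d' G d.i a) (𝟙 _) (𝟙 _)
        (d'.e (G.F.obj d.i) (G.F.obj a))) := by
    rw [D.T2.map_comp]; simp
  rw [e1, f2_spec, D.din_20_2, f0_spec, ← G.map_20_2, I]

theorem map_J (a : C.Ob) :
    d.f0 d' G ≫ G.F.map (d.J a) ≫ d.f2 d' G a a = d'.J (G.F.obj a) := by
  apply d'.i_ext
  have e1 := G.nat_T2 (d.J a) (𝟙 _) (𝟙 _) (d.e a a)
  rw [G.F.map_id] at e1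
  rw [J_spec, e_comp, D.din_20_1, f0_spec, e_f2, ← e1, ← G.map_20_1, J_spec, G.map_j1,
    G.F.map_id]

theorem map_L (a b c : C.Ob) :
    G.F.map (d.L a b c) ≫ d.f2 d' G (d.hom a b) (d.hom a c) ≫
        d'.homMap (𝟙 _) (d.f2 d' G a c) =
      d.f2 d' G b c ≫ d'.L (G.F.obj a) (G.F.obj b) (G.F.obj c) ≫
        d'.homMap (d.f2 d' G a b) (𝟙 _) := by
  apply d'.hom_ext2
  rw [← Category.assoc, e_homMap, ← Category.assoc, e_homMap, L_eq', f2_spec, f2_spec,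
    ← G.map_22_2, ← L_spec, G.map_22_1, G.nat_T2]
  have e1 : D.T2.map (G.F.map (d.L a b c) ≫ d.f2 d' G (d.hom a b) (d.hom a c)) (𝟙 _)
      (d.f2 d' G a c) (d'.e (G.F.obj (d.hom a b)) (G.F.obj (d.hom a c))) =
      D.T2.map (𝟙 _) (𝟙 _) (d.f2 d' G a c) (D.T2.map (G.F.map (d.L a b c) ≫
        d.f2 d' G (d.hom a b) (d.hom a c)) (𝟙 _) (𝟙 _)
        (d'.e (G.F.obj (d.hom a b)) (G.F.obj (d.hom a c)))) := by
    rw [D.T2.map_comp]; simp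
  rw [e1, ← D.din_22_1, f2_spec, e_f2]
  simp

/-- The closed functor induced by a morphism of short skew multicategories. -/
noncomputable def toClosedFunctor : ClosedFunctor d.toSkewClosed d'.toSkewClosed where
  F := G.F
  f0 := d.f0 d' G
  f2 := d.f2 d' G
  nat_f2 := d.nat_f2 d' G
  map_I := d.map_I d' G
  map_J := d.map_J d' G
  map_L := d.map_L d' G

theorem toClosedFunctor_id : d.toClosedFunctor d (𝟙 C) = 𝟙 d.toSkewClosed := by
  have h0 : d.f0 d (𝟙 C) = 𝟙 d.i :=
    d.u_ext ((d.f0_spec d (𝟙 C)).trans (C.L0.map_id _).symm)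
  have h2 : ∀ a b, d.f2 d (𝟙 C) a b = 𝟙 (d.hom a b) := fun a b =>
    d.hom_ext ((d.f2_spec d (𝟙 C) a b).trans (C.T2.map_id _).symm)
  exact ClosedFunctor.ext' rfl ((Category.comp_id _).trans h0) fun a b =>
    (h2 a b).trans ((Category.id_comp _).trans (Category.comp_id _)).symm

theorem toClosedFunctor_comp {E : ShortSkewMulticategory.{v, u}} (d'' : E.ClosedData) (G : C ⟶ D)
    (H : D ⟶ E) : d.toClosedFunctor d'' (G ≫ H) =
      (show d.toSkewClosed ⟶ d'.toSkewClosed from d.toClosedFunctor d' G) ≫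
        (show d'.toSkewClosed ⟶ d''.toSkewClosed from d'.toClosedFunctor d'' H) := by
  have h0 : d.f0 d'' (G ≫ H) = d'.f0 d'' H ≫ H.F.map (d.f0 d' G) := by
    apply d''.u_ext
    rw [← E.L0.map_comp, f0_spec, f0_spec, ← H.nat_L0, f0_spec]
    rfl
  have h2 : ∀ a b, d.f2 d'' (G ≫ H) a b =
      H.F.map (d.f2 d' G a b) ≫ d'.f2 d'' H (G.F.obj a) (G.F.obj b) := fun a b => by
    apply d''.hom_ext
    refine (d.f2_spec d'' (G ≫ H) a b).trans ((d'.e_f2 d'' H _).trans ?_).symm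
    have e1 := H.nat_T2 (d.f2 d' G a b) (𝟙 _) (𝟙 _) (d'.e (G.F.obj a) (G.F.obj b))
    rw [f2_spec, H.F.map_id, H.F.map_id] at e1
    exact e1.symm
  exact ClosedFunctor.ext' rfl ((Category.comp_id _).trans h0) fun a b =>
    (h2 a b).trans ((Category.id_comp _).trans (Category.comp_id _)).symm

end Map

end ClosedData

/-- A choice of closed structure and nullary map classifier. -/
noncomputable def closedData (C : ClosedShortSkewMulti.{v, u}) : C.obj.ClosedData where
  hom b c := (C.property.1 b c).choose
  e b c := (C.property.1 b c).choose_spec.choose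
  he b c := (C.property.1 b c).choose_spec.choose_spec
  i := C.property.2.choose
  u := C.property.2.choose_spec.choose
  hu := C.property.2.choose_spec.choose_spec

end ShortSkewMulticategory

open ShortSkewMulticategory in
/-- The functor from closed short skew multicategories with a nullary map classifier to skew closed
categories. -/
noncomputable def skewK : ClosedShortSkewMulti.{v, u} ⥤ SkewClosedCategory.{v, u} where
  obj C := (closedData C).toSkewClosed
  map {C D} G := (closedData C).toClosedFunctor (closedData D) G.hom
  map_id C := (closedData C).toClosedFunctor_id
  map_comp {C D E} G H :=
    (closedData C).toClosedFunctor_comp (closedData D) (closedData E) G.hom H.hom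

/-! ### Skew multicategories -/

/-- `t`ight or `l`oose. -/
inductive Tightness
  | t
  | l

/-- The tightness `x ∘ᵢ y` of the result of substituting a `y`-map in the `i`-th variable of an
`x`-map. -/
def Tightness.comp : Tightness → Tightness → ℕ → Tightness
  | .t, .t, _ => .t
  | .t, .l, i => if i = 1 then .l else .t
  | .l, _, _ => .l

/-- A skew multicategory. `Hom x Γ b` is the set of tight (`x = t`) or loose (`x = l`) multimaps
from the list `Γ` to `b`; there are no tight nullary maps. `sub l r _ _ _ f g` is the substitution
`f ∘ᵢ g` of `g : Δ → b` in `f : l, b, r → c`, where `i = |l| + 1`; its result has domain `l, Δ, r`.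
The domains `Γ`, `Θ` and the tightness `z` of the result are variables constrained by equations, so
that the axioms can be stated without transport along equalities of lists. -/
structure SkewMulticategory where
  Ob : Type u
  Hom : Tightness → List Ob → Ob → Type v
  tight_nil (b : Ob) : IsEmpty (Hom .t [] b)
  id (a : Ob) : Hom .t [a] a
  sub {x y z : Tightness} {Γ Δ Θ : List Ob} {b c : Ob} (l r : List Ob)
    (hΓ : Γ = l ++ b :: r) (hΘ : Θ = l ++ Δ ++ r) (hz : z = x.comp y (l.length + 1)) :
    Hom x Γ c → Hom y Δ b → Hom z Θ c
  j {Γ : List Ob} {b : Ob} : Hom .t Γ b → Hom .l Γ b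
  id_sub {x : Tightness} {Γ : List Ob} {b : Ob} (f : Hom x Γ b) (hΓ : Γ = [] ++ Γ ++ [])
    (hx : x = Tightness.comp .t x 1) : sub [] [] rfl hΓ hx (id b) f = f
  sub_id {x : Tightness} {Γ : List Ob} {b c : Ob} (l r : List Ob) (hΓ : Γ = l ++ b :: r)
    (hΓ' : Γ = l ++ [b] ++ r) (hx : x = x.comp .t (l.length + 1)) (f : Hom x Γ c) :
    sub l r hΓ hΓ' hx f (id b) = f
  -- `f ∘ᵢ (g ∘ⱼ h) = (f ∘ᵢ g) ∘ᵢ₊ⱼ₋₁ h`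
  assoc {x y z xy yz w : Tightness} {Γ Δ Λ ΓΔ ΔΛ Θ : List Ob} {b c d : Ob} {l r l' r' : List Ob}
    {f : Hom x Γ d} {g : Hom y Δ c} {h : Hom z Λ b}
    {h₁ : Γ = l ++ c :: r} {h₂ : Δ = l' ++ b :: r'} {h₃ : ΔΛ = l' ++ Λ ++ r'}
    {h₄ : Θ = l ++ ΔΛ ++ r} {h₅ : ΓΔ = l ++ Δ ++ r} {h₆ : ΓΔ = (l ++ l') ++ b :: (r' ++ r)}
    {h₇ : Θ = (l ++ l') ++ Λ ++ (r' ++ r)}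
    {t₁ : yz = y.comp z (l'.length + 1)} {t₂ : w = x.comp yz (l.length + 1)}
    {t₃ : xy = x.comp y (l.length + 1)} {t₄ : w = xy.comp z ((l ++ l').length + 1)} :
    sub l r h₁ h₄ t₂ f (sub l' r' h₂ h₃ t₁ g h) =
      sub (l ++ l') (r' ++ r) h₆ h₇ t₄ (sub l r h₁ h₅ t₃ f g) h
  -- `(f ∘ᵢ g) ∘ₙ₊ⱼ₋₁ h = (f ∘ⱼ h) ∘ᵢ g` for `i < j` and `g` of arity `n`
  comm {x y z xy xz w : Tightness} {Γ Δ Λ ΓΔ ΓΛ Θ : List Ob} {b c d : Ob} {l m r : List Ob}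
    {f : Hom x Γ d} {g : Hom y Δ b} {h : Hom z Λ c}
    {h₁ : Γ = l ++ b :: (m ++ c :: r)} {h₂ : ΓΔ = l ++ Δ ++ (m ++ c :: r)}
    {h₃ : ΓΔ = (l ++ Δ ++ m) ++ c :: r} {h₄ : Θ = (l ++ Δ ++ m) ++ Λ ++ r}
    {h₅ : Γ = (l ++ b :: m) ++ c :: r} {h₆ : ΓΛ = (l ++ b :: m) ++ Λ ++ r}
    {h₇ : ΓΛ = l ++ b :: (m ++ Λ ++ r)} {h₈ : Θ = l ++ Δ ++ (m ++ Λ ++ r)}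
    {t₁ : xy = x.comp y (l.length + 1)} {t₂ : w = xy.comp z ((l ++ Δ ++ m).length + 1)}
    {t₃ : xz = x.comp z ((l ++ b :: m).length + 1)} {t₄ : w = xz.comp y (l.length + 1)} :
    sub (l ++ Δ ++ m) r h₃ h₄ t₂ (sub l (m ++ c :: r) h₁ h₂ t₁ f g) h =
      sub l (m ++ Λ ++ r) h₇ h₈ t₄ (sub (l ++ b :: m) r h₅ h₆ t₃ f h) g
  -- substitution commutes with viewing tight maps as loose, in both arguments
  j_sub_left {y : Tightness} {Γ Δ Θ : List Ob} {b c : Ob} {l r : List Ob} {f : Hom .t Γ c}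
    {g : Hom y Δ b} {h₁ : Γ = l ++ b :: r} {h₂ : Θ = l ++ Δ ++ r}
    {t₁ : .t = Tightness.comp .t y (l.length + 1)} {t₂ : .l = Tightness.comp .l y (l.length + 1)} :
    j (sub l r h₁ h₂ t₁ f g) = sub l r h₁ h₂ t₂ (j f) g
  sub_left {y : Tightness} {Γ Δ Θ : List Ob} {b c : Ob} {l r : List Ob} {f : Hom .t Γ c}
    {g : Hom y Δ b} {h₁ : Γ = l ++ b :: r} {h₂ : Θ = l ++ Δ ++ r}
    {t₁ : .l = Tightness.comp .t y (l.length + 1)} {t₂ : .l = Tightness.comp .l y (l.length + 1)} :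
    sub l r h₁ h₂ t₁ f g = sub l r h₁ h₂ t₂ (j f) g
  j_sub_right {x : Tightness} {Γ Δ Θ : List Ob} {b c : Ob} {l r : List Ob} {f : Hom x Γ c}
    {g : Hom .t Δ b} {h₁ : Γ = l ++ b :: r} {h₂ : Θ = l ++ Δ ++ r}
    {t₁ : .t = Tightness.comp x .t (l.length + 1)} {t₂ : .l = Tightness.comp x .l (l.length + 1)} :
    j (sub l r h₁ h₂ t₁ f g) = sub l r h₁ h₂ t₂ f (j g)
  sub_right {x z : Tightness} {Γ Δ Θ : List Ob} {b c : Ob} {l r : List Ob} {f : Hom x Γ c}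
    {g : Hom .t Δ b} {h₁ : Γ = l ++ b :: r} {h₂ : Θ = l ++ Δ ++ r}
    {t₁ : z = Tightness.comp x .t (l.length + 1)} {t₂ : z = Tightness.comp x .l (l.length + 1)} :
    sub l r h₁ h₂ t₁ f g = sub l r h₁ h₂ t₂ f (j g)

/-- A skew multifunctor: a map on objects and maps `Hom x Γ b → Hom x (F Γ) (F b)` preserving
identities, substitution and `j`; again the domain `F Γ` is a variable constrained by an
equation. -/
structure SkewMultifunctor (M N : SkewMulticategory.{v, u}) where
  obj : M.Ob → N.Ob
  map {x : Tightness} {Γ : List M.Ob} {Γ' : List N.Ob} {b : M.Ob} (h : Γ' = Γ.map obj) :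
    M.Hom x Γ b → N.Hom x Γ' (obj b)
  map_id (a : M.Ob) : map rfl (M.id a) = N.id (obj a)
  map_sub {x y z : Tightness} {Γ Δ Θ : List M.Ob} {Γ' Δ' Θ' : List N.Ob} {b c : M.Ob}
    {l r : List M.Ob} {f : M.Hom x Γ c} {g : M.Hom y Δ b}
    {hΓ : Γ = l ++ b :: r} {hΘ : Θ = l ++ Δ ++ r} {hz : z = x.comp y (l.length + 1)}
    {h₁ : Γ' = Γ.map obj} {h₂ : Δ' = Δ.map obj} {h₃ : Θ' = Θ.map obj}
    {h₄ : Γ' = l.map obj ++ obj b :: r.map obj} {h₅ : Θ' = l.map obj ++ Δ' ++ r.map obj}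
    {h₆ : z = x.comp y ((l.map obj).length + 1)} :
    map h₃ (M.sub l r hΓ hΘ hz f g) =
      N.sub (l.map obj) (r.map obj) h₄ h₅ h₆ (map h₁ f) (map h₂ g)
  map_j {Γ : List M.Ob} {Γ' : List N.Ob} {b : M.Ob} (h : Γ' = Γ.map obj) (f : M.Hom .t Γ b) :
    map h (M.j f) = N.j (map h f)

theorem SkewMultifunctor.ext' {M N : SkewMulticategory.{v, u}} {F G : SkewMultifunctor M N}
    (h₀ : F.obj = G.obj)
    (h₁ : ∀ {x : Tightness} {Γ : List M.Ob} {Γ' : List N.Ob} {b : M.Ob} (h : Γ' = Γ.map F.obj)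
      (h' : Γ' = Γ.map G.obj) (f : M.Hom x Γ b),
      cast (congrArg (fun o => N.Hom x Γ' (o b)) h₀) (F.map h f) = G.map h' f) : F = G := by
  cases F with
  | mk Fo Fm _ _ _ =>
    cases G with
    | mk Go Gm _ _ _ =>
      dsimp only at h₀
      subst h₀
      have : @Fm = @Gm := by
        funext x Γ Γ' b h f
        exact h₁ h h f
      cases this
      rfl

theorem SkewMultifunctor.map_cast {M N : SkewMulticategory.{v, u}} (F : SkewMultifunctor M N)
    {x : Tightness} {Γ Γ₁ : List M.Ob} {Γ' : List N.Ob} {b : M.Ob} (e : Γ = Γ₁)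
    (h : Γ' = Γ₁.map F.obj) (h' : Γ' = Γ.map F.obj) (f : M.Hom x Γ b) :
    F.map h (cast (congrArg (M.Hom x · b) e) f) = F.map h' f := by
  subst e
  rfl

theorem SkewMultifunctor.map_map_congr {M N P : SkewMulticategory.{v, u}}
    (F : SkewMultifunctor M N) (G : SkewMultifunctor N P)
    {x : Tightness} {Γ : List M.Ob} {Δ₁ Δ₂ : List N.Ob} {Θ : List P.Ob} {b : M.Ob}
    (h₁ : Δ₁ = Γ.map F.obj) (h₂ : Δ₂ = Γ.map F.obj) (k₁ : Θ = Δ₁.map G.obj)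
    (k₂ : Θ = Δ₂.map G.obj) (f : M.Hom x Γ b) :
    G.map k₁ (F.map h₁ f) = G.map k₂ (F.map h₂ f) := by
  subst h₁ h₂
  rfl

/-- The category of skew multicategories. -/
instance : Category SkewMulticategory.{v, u} where
  Hom M N := SkewMultifunctor M N
  id M :=
    { obj := fun a => a
      map := fun {x _ _ b} h f => cast (congrArg (M.Hom x · b) (h.trans (List.map_id' _)).symm) f
      map_id := fun _ => rfl
      map_sub := by
        intro x y z Γ Δ Θ Γ' Δ' Θ' b c l r f g hΓ hΘ hz h₁ h₂ h₃ h₄ h₅ h₆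
        have e₁ := h₁.trans (List.map_id' _)
        have e₂ := h₂.trans (List.map_id' _)
        have e₃ := h₃.trans (List.map_id' _)
        subst e₁ e₂ e₃
        simp only [cast_eq]
        congr 1 <;> simp
      map_j := by
        intro Γ Γ' b h f
        have e := h.trans (List.map_id' _)
        subst e
        rfl }
  comp {M N P} F G :=
    { obj := fun a => G.obj (F.obj a)
      map := fun {_ _ _ _} h f =>
        G.map (h.trans (List.map_map (f := F.obj) (g := G.obj)).symm) (F.map rfl f)
      map_id := fun a => by rw [F.map_id]; exact G.map_id _
      map_sub := by
        intro x y z Γ Δ Θ Γ' Δ' Θ' b c l r f g hΓ hΘ hz h₁ h₂ h₃ h₄ h₅ h₆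
        have e₁ : (l.map F.obj).map G.obj = l.map fun a => G.obj (F.obj a) := List.map_map
        have e₂ : (r.map F.obj).map G.obj = r.map fun a => G.obj (F.obj a) := List.map_map
        rw [F.map_sub (h₁ := rfl) (h₂ := rfl) (h₄ := by simp [hΓ]) (h₅ := by simp [hΘ])
            (h₆ := by simpa using hz),
          G.map_sub (h₁ := h₁.trans List.map_map.symm) (h₂ := h₂.trans List.map_map.symm)
            (h₄ := by rw [e₁, e₂]; exact h₄) (h₅ := by rw [e₁, e₂]; exact h₅)
            (h₆ := by rw [e₁]; exact h₆)]
        congr 1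
      map_j := fun h f => by rw [F.map_j, G.map_j] }
  id_comp F := by
    refine SkewMultifunctor.ext' rfl ?_
    intro x Γ Γ' b h h' f
    exact F.map_cast (List.map_id' Γ).symm _ h' f
  comp_id F := by
    refine SkewMultifunctor.ext' rfl ?_
    intro x Γ Γ' b h h' f
    subst h'
    rfl
  assoc F G H := by
    refine SkewMultifunctor.ext' rfl ?_
    intro x Γ Γ' b h h' f
    exact SkewMultifunctor.map_map_congr G H _ rfl _ _ (F.map rfl f)

namespace SkewMulticategory

theorem comp_t (x : Tightness) (n : ℕ) : x = x.comp .t n := by cases x <;> rfl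

theorem t_comp (x : Tightness) : x = Tightness.comp .t x 1 := by cases x <;> rfl

section

variable (M : SkewMulticategory.{v, u})

/-- Precomposition with a tight unary map. -/
def pre {x : Tightness} {Γ Γ' : List M.Ob} {a a' c : M.Ob} (l r : List M.Ob)
    (hΓ : Γ = l ++ a :: r) (hΓ' : Γ' = l ++ a' :: r) (p : M.Hom .t [a'] a) (f : M.Hom x Γ c) :
    M.Hom x Γ' c :=
  M.sub l r hΓ (by simp [hΓ']) (comp_t x _) f p

/-- Postcomposition with a tight unary map. -/
def post {x : Tightness} {Γ : List M.Ob} {c c' : M.Ob} (h : M.Hom .t [c] c') (f : M.Hom x Γ c) :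
    M.Hom x Γ c' :=
  M.sub [] [] rfl (by simp) (t_comp x) h f

variable {M}

theorem pre_id {x : Tightness} {Γ : List M.Ob} {a c : M.Ob} (l r : List M.Ob)
    (hΓ : Γ = l ++ a :: r) (f : M.Hom x Γ c) : M.pre l r hΓ hΓ (M.id a) f = f :=
  M.sub_id ..

theorem post_id {x : Tightness} {Γ : List M.Ob} {c : M.Ob} (f : M.Hom x Γ c) :
    M.post (M.id c) f = f :=
  M.id_sub ..

theorem post_post {x : Tightness} {Γ : List M.Ob} {c c' c'' : M.Ob} (h : M.Hom .t [c] c')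
    (h' : M.Hom .t [c'] c'') (f : M.Hom x Γ c) :
    M.post h' (M.post h f) = M.post (M.post h' h) f :=
  M.assoc (l := []) (r := []) (l' := []) (r' := [])

theorem pre_pre {x : Tightness} {Γ Γ' Γ'' : List M.Ob} {a a' a'' c : M.Ob} {l r : List M.Ob}
    {h₁ : Γ = l ++ a :: r} {h₂ : Γ' = l ++ a' :: r} {h₃ : Γ' = l ++ a' :: r}
    {h₄ : Γ'' = l ++ a'' :: r} {p : M.Hom .t [a'] a} {p' : M.Hom .t [a''] a'} {f : M.Hom x Γ c} :
    M.pre l r h₃ h₄ p' (M.pre l r h₁ h₂ p f) = M.pre l r h₁ h₄ (M.post p p') f := by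
  have e := M.assoc (l := l) (r := r) (l' := []) (r' := []) (f := f) (g := p) (h := p')
    (Θ := Γ'') (ΓΔ := Γ') (ΔΛ := [a''])
    (h₁ := h₁) (h₂ := rfl) (h₃ := rfl) (h₄ := by simp [h₄]) (h₅ := by simp [h₂])
    (h₆ := by simp [h₂]) (h₇ := by simpa using h₄) (t₁ := rfl) (t₂ := comp_t x _)
    (t₃ := comp_t x _) (t₄ := comp_t x _)
  simp only [List.append_nil, List.nil_append] at e
  exact e.symm

theorem post_pre {x : Tightness} {Γ Γ' : List M.Ob} {a a' c c' : M.Ob} {l r : List M.Ob}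
    {h₁ : Γ = l ++ a :: r} {h₂ : Γ' = l ++ a' :: r} {p : M.Hom .t [a'] a} {h : M.Hom .t [c] c'}
    {f : M.Hom x Γ c} :
    M.post h (M.pre l r h₁ h₂ p f) = M.pre l r h₁ h₂ p (M.post h f) := by
  have e := M.assoc (l := []) (r := []) (l' := l) (r' := r) (f := h) (g := f) (h := p)
    (Θ := Γ') (ΓΔ := Γ) (ΔΛ := Γ')
    (h₁ := rfl) (h₂ := h₁) (h₃ := by simpa using h₂) (h₄ := by simp) (h₅ := by simp)
    (h₆ := by simp [h₁]) (h₇ := by simpa using h₂) (t₁ := comp_t x _) (t₂ := t_comp x)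
    (t₃ := t_comp x) (t₄ := comp_t x _)
  simp only [List.append_nil, List.nil_append] at e
  exact e

/-- Precompositions in different variables commute. -/
theorem pre_comm {x : Tightness} {Γ Γ₁ Γ₂ Γ' : List M.Ob} {a a' b b' c : M.Ob} {l m r : List M.Ob}
    {p : M.Hom .t [a'] a} {q : M.Hom .t [b'] b} {f : M.Hom x Γ c}
    {h₁ : Γ = (l ++ a :: m) ++ b :: r} {h₂ : Γ₁ = (l ++ a :: m) ++ b' :: r}
    {h₃ : Γ₁ = l ++ a :: (m ++ b' :: r)} {h₄ : Γ' = l ++ a' :: (m ++ b' :: r)}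
    {h₅ : Γ = l ++ a :: (m ++ b :: r)} {h₆ : Γ₂ = l ++ a' :: (m ++ b :: r)}
    {h₇ : Γ₂ = (l ++ a' :: m) ++ b :: r} {h₈ : Γ' = (l ++ a' :: m) ++ b' :: r} :
    M.pre l (m ++ b' :: r) h₃ h₄ p (M.pre (l ++ a :: m) r h₁ h₂ q f) =
      M.pre (l ++ a' :: m) r h₇ h₈ q (M.pre l (m ++ b :: r) h₅ h₆ p f) := by
  have e := M.comm (l := l) (m := m) (r := r) (f := f) (g := p) (h := q)
    (ΓΔ := Γ₂) (ΓΛ := Γ₁) (Θ := Γ')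
    (h₁ := h₅) (h₂ := by simpa using h₆) (h₃ := by simp [h₆]) (h₄ := by simp [h₄])
    (h₅ := h₁) (h₆ := by simp [h₂]) (h₇ := by simpa using h₃) (h₈ := by simpa using h₄)
    (t₁ := comp_t x _) (t₂ := comp_t x _) (t₃ := comp_t x _) (t₄ := comp_t x _)
  unfold pre
  simp only [List.append_assoc, List.cons_append, List.nil_append] at e ⊢
  exact e.symm

section sub

variable {x y z : Tightness} {Γ Δ Θ : List M.Ob} {b d : M.Ob} {L R : List M.Ob}

theorem sub_post {c : M.Ob} {f : M.Hom x Γ c} {g : M.Hom y Δ b} {k : M.Hom .t [c] d}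
    {h₁ : Γ = L ++ b :: R} {h₂ : Θ = L ++ Δ ++ R} {t₁ : z = x.comp y (L.length + 1)} :
    M.sub L R h₁ h₂ t₁ (M.post k f) g = M.post k (M.sub L R h₁ h₂ t₁ f g) := by
  have e := M.assoc (l := []) (r := []) (l' := L) (r' := R) (f := k) (g := f) (h := g)
    (ΔΛ := Θ) (ΓΔ := Γ) (Θ := Θ)
    (h₁ := rfl) (h₂ := h₁) (h₃ := h₂) (h₄ := by simp) (h₅ := by simp)
    (h₆ := by simp [h₁]) (h₇ := by simpa using h₂) (t₁ := t₁) (t₂ := t_comp z)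
    (t₃ := t_comp x) (t₄ := t₁)
  simp only [List.append_nil, List.nil_append] at e
  exact e.symm

theorem sub_din {Γ₁ : List M.Ob} {b₁ : M.Ob} {f : M.Hom x Γ d} {g : M.Hom y Δ b₁}
    {k : M.Hom .t [b₁] b} {h₁ : Γ = L ++ b :: R} {h₂ : Γ₁ = L ++ b₁ :: R}
    {h₃ : Γ₁ = L ++ b₁ :: R} {h₄ : Θ = L ++ Δ ++ R} {t₁ : z = x.comp y (L.length + 1)} :
    M.sub L R h₃ h₄ t₁ (M.pre L R h₁ h₂ k f) g = M.sub L R h₁ h₄ t₁ f (M.post k g) := by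
  have e := M.assoc (l := L) (r := R) (l' := []) (r' := []) (f := f) (g := k) (h := g)
    (ΓΔ := Γ₁) (ΔΛ := Δ) (Θ := Θ)
    (h₁ := h₁) (h₂ := rfl) (h₃ := by simp) (h₄ := h₄) (h₅ := by simp [h₂])
    (h₆ := by simp [h₂]) (h₇ := by simpa using h₄) (t₁ := t_comp y) (t₂ := t₁)
    (t₃ := comp_t x _) (t₄ := by simpa using t₁)
  simp only [List.append_nil, List.nil_append] at e
  exact e.symm

theorem sub_pre_inner {Δ₁ L₁ R₁ : List M.Ob} {a a' : M.Ob} {f : M.Hom x Γ d} {g : M.Hom y Δ b}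
    {p : M.Hom .t [a'] a} {h₁ : Γ = L ++ b :: R} {h₂ : Θ = L ++ Δ₁ ++ R}
    {t₁ : z = x.comp y (L.length + 1)} {h₃ : Δ = L₁ ++ a :: R₁} {h₄ : Δ₁ = L₁ ++ a' :: R₁} :
    M.sub L R h₁ h₂ t₁ f (M.pre L₁ R₁ h₃ h₄ p g) =
      M.pre (L ++ L₁) (R₁ ++ R) (by rw [h₃]; simp) (by rw [h₂, h₄]; simp) p
        (M.sub L R h₁ (rfl : L ++ Δ ++ R = _) t₁ f g) :=
  M.assoc (l := L) (r := R) (l' := L₁) (r' := R₁) (f := f) (g := g) (h := p)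

theorem sub_pre_right {Γ₁ L₁ R₁ : List M.Ob} {a a' : M.Ob} (m : List M.Ob) {f : M.Hom x Γ d}
    {g : M.Hom y Δ b} {p : M.Hom .t [a'] a} {h₁ : Γ = L₁ ++ a :: R₁} {h₂ : Γ₁ = L₁ ++ a' :: R₁}
    {h₃ : Γ₁ = L ++ b :: R} {h₄ : Θ = L ++ Δ ++ R} {t₁ : z = x.comp y (L.length + 1)}
    (e₁ : L₁ = L ++ b :: m) (e₂ : R = m ++ a' :: R₁) :
    M.sub L R h₃ h₄ t₁ (M.pre L₁ R₁ h₁ h₂ p f) g =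
      M.pre (L ++ Δ ++ m) R₁ (by simp) (by rw [h₄, e₂]; simp) p
        (M.sub L (m ++ a :: R₁) (by rw [h₁, e₁]; simp) (rfl : L ++ Δ ++ (m ++ a :: R₁) = _) t₁
          f g) := by
  subst e₁ e₂
  have e := M.comm (l := L) (m := m) (r := R₁) (f := f) (g := g) (h := p)
    (ΓΛ := Γ₁) (Θ := Θ)
    (h₁ := by rw [h₁]; simp) (h₂ := rfl) (h₃ := by simp) (h₄ := by rw [h₄]; simp)
    (h₅ := h₁) (h₆ := by rw [h₂]; simp) (h₇ := by rw [h₂]; simp) (h₈ := by rw [h₄]; simp)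
    (t₁ := t₁) (t₂ := comp_t z _) (t₃ := comp_t x _) (t₄ := t₁)
  unfold pre
  rw [e]
  simp only [List.append_assoc, List.cons_append, List.nil_append]

theorem sub_pre_left {Γ₁ L₁ R₁ : List M.Ob} {a a' : M.Ob} (m : List M.Ob) {f : M.Hom x Γ d}
    {g : M.Hom y Δ b} {p : M.Hom .t [a'] a} {h₁ : Γ = L₁ ++ a :: R₁} {h₂ : Γ₁ = L₁ ++ a' :: R₁}
    {h₃ : Γ₁ = L ++ b :: R} {h₄ : Θ = L ++ Δ ++ R} {t₁ : z = x.comp y (L.length + 1)}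
    (e₁ : L = L₁ ++ a' :: m) (e₂ : R₁ = m ++ b :: R) :
    M.sub L R h₃ h₄ t₁ (M.pre L₁ R₁ h₁ h₂ p f) g =
      M.pre L₁ (m ++ Δ ++ R) (by simp) (by rw [h₄, e₁]; simp) p
        (M.sub (L₁ ++ a :: m) R (by rw [h₁, e₂]; simp) (rfl : (L₁ ++ a :: m) ++ Δ ++ R = _)
          (by rw [t₁, e₁]; simp) f g) := by
  subst e₁ e₂
  have e := M.comm (l := L₁) (m := m) (r := R) (f := f) (g := p) (h := g)
    (ΓΔ := Γ₁) (Θ := Θ)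
    (h₁ := h₁) (h₂ := by rw [h₂]; simp) (h₃ := by rw [h₂]; simp) (h₄ := by rw [h₄]; simp)
    (h₅ := by rw [h₁]; simp) (h₆ := rfl) (h₇ := by simp) (h₈ := by rw [h₄]; simp)
    (t₁ := comp_t x _) (t₂ := by rw [t₁]; simp) (t₃ := by rw [t₁]; simp) (t₄ := comp_t z _)
  unfold pre
  rw [← e]
  simp only [List.append_assoc, List.cons_append, List.nil_append]

end sub

end

/-- The underlying category: morphisms are the tight unary maps. -/
instance (M : SkewMulticategory.{v, u}) : Category.{v} M.Ob where
  Hom a b := M.Hom .t [a] b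
  id a := M.id a
  comp f g := M.post g f
  id_comp f := pre_id [] [] rfl f
  comp_id f := post_id f
  assoc f g h := post_post g h f

variable (M : SkewMulticategory.{v, u}) (x : Tightness)

/-- The functor of (tight or loose) nullary maps. -/
abbrev fam0 : Fam0.{v} M.Ob where
  obj c := M.Hom x [] c
  map h f := M.post h f
  map_id f := post_id f
  map_comp h h' f := post_post h h' f

/-- The functor of (tight or loose) unary maps. -/
abbrev fam1 : Fam1.{v} M.Ob where
  obj a c := M.Hom x [a] c
  map p h f := M.pre [] [] rfl rfl p (M.post h f)
  map_id f := (pre_id [] [] rfl _).trans (post_id f)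
  map_comp p p' h h' f := by
    rw [post_pre, post_post, pre_pre]; rfl

/-- The functor of (tight or loose) binary maps. -/
abbrev fam2 : Fam2.{v} M.Ob where
  obj a b c := M.Hom x [a, b] c
  map {a a' b b' _ _} p q h f :=
    M.pre [a'] [] rfl rfl q (M.pre [] [b] rfl rfl p (M.post h f))
  map_id f := (pre_id _ _ rfl _).trans ((pre_id _ _ rfl _).trans (post_id f))
  map_comp {a a' a'' b b' b'' c c' c''} p p' q q' h h' f := by
    rw [post_pre, post_pre, post_post]
    have e {g : M.Hom x [a', b] c''} : M.pre [] [b'] rfl rfl p' (M.pre [a'] [] rfl rfl q g) =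
      M.pre [a''] [] rfl rfl q (M.pre [] [b] rfl rfl p' g) := M.pre_comm (l := []) (m := [])
    rw [e, pre_pre, pre_pre]; rfl

/-- The functor of (tight or loose) ternary maps. -/
abbrev fam3 : Fam3.{v} M.Ob where
  obj a b c d := M.Hom x [a, b, c] d
  map {a₁ a₁' a₂ a₂' a₃ a₃' _ _} p₁ p₂ p₃ h f :=
    M.pre [a₁', a₂'] [] rfl rfl p₃ (M.pre [a₁'] [a₃] rfl rfl p₂
      (M.pre [] [a₂, a₃] rfl rfl p₁ (M.post h f)))
  map_id f := (pre_id _ _ rfl _).trans ((pre_id _ _ rfl _).trans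
    ((pre_id _ _ rfl _).trans (post_id f)))
  map_comp {a₁ a₁' a₁'' a₂ a₂' a₂'' a₃ a₃' a₃'' c c' c''} p₁ p₁' p₂ p₂' p₃ p₃' h h' f := by
    rw [post_pre, post_pre, post_pre, post_post]
    have e₁ {g : M.Hom x [a₁', a₂', a₃] c''} :
      M.pre [] [a₂', a₃'] rfl rfl p₁' (M.pre [a₁', a₂'] [] rfl rfl p₃ g) =
      M.pre [a₁'', a₂'] [] rfl rfl p₃ (M.pre [] [a₂', a₃] rfl rfl p₁' g) :=
        M.pre_comm (l := []) (m := [a₂']) (r := [])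
    have e₂ {g : M.Hom x [a₁', a₂, a₃] c''} :
      M.pre [] [a₂', a₃] rfl rfl p₁' (M.pre [a₁'] [a₃] rfl rfl p₂ g) =
      M.pre [a₁''] [a₃] rfl rfl p₂ (M.pre [] [a₂, a₃] rfl rfl p₁' g) :=
        M.pre_comm (l := []) (m := []) (r := [a₃])
    have e₃ {g : M.Hom x [a₁'', a₂', a₃] c''} :
      M.pre [a₁''] [a₃'] rfl rfl p₂' (M.pre [a₁'', a₂'] [] rfl rfl p₃ g) =
      M.pre [a₁'', a₂''] [] rfl rfl p₃ (M.pre [a₁''] [a₃] rfl rfl p₂' g) :=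
        M.pre_comm (l := [a₁'']) (m := []) (r := [])
    rw [e₁, e₂, pre_pre, e₃, pre_pre, pre_pre]; rfl

/-- The functor of (tight or loose) quaternary maps. -/
abbrev fam4 : Fam4.{v} M.Ob where
  obj a b c d e := M.Hom x [a, b, c, d] e
  map {a₁ a₁' a₂ a₂' a₃ a₃' a₄ a₄' _ _} p₁ p₂ p₃ p₄ h f :=
    M.pre [a₁', a₂', a₃'] [] rfl rfl p₄ (M.pre [a₁', a₂'] [a₄] rfl rfl p₃
      (M.pre [a₁'] [a₃, a₄] rfl rfl p₂ (M.pre [] [a₂, a₃, a₄] rfl rfl p₁ (M.post h f))))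
  map_id f := (pre_id _ _ rfl _).trans ((pre_id _ _ rfl _).trans
    ((pre_id _ _ rfl _).trans ((pre_id _ _ rfl _).trans (post_id f))))
  map_comp {a₁ a₁' a₁'' a₂ a₂' a₂'' a₃ a₃' a₃'' a₄ a₄' a₄'' c c' c''}
      p₁ p₁' p₂ p₂' p₃ p₃' p₄ p₄' h h' f := by
    rw [post_pre, post_pre, post_pre, post_pre, post_post]
    have e₁ {g : M.Hom x [a₁', a₂', a₃', a₄] c''} :
      M.pre [] [a₂', a₃', a₄'] rfl rfl p₁' (M.pre [a₁', a₂', a₃'] [] rfl rfl p₄ g) =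
      M.pre [a₁'', a₂', a₃'] [] rfl rfl p₄ (M.pre [] [a₂', a₃', a₄] rfl rfl p₁' g) :=
        M.pre_comm (l := []) (m := [a₂', a₃']) (r := [])
    have e₂ {g : M.Hom x [a₁', a₂', a₃, a₄] c''} :
      M.pre [] [a₂', a₃', a₄] rfl rfl p₁' (M.pre [a₁', a₂'] [a₄] rfl rfl p₃ g) =
      M.pre [a₁'', a₂'] [a₄] rfl rfl p₃ (M.pre [] [a₂', a₃, a₄] rfl rfl p₁' g) :=
        M.pre_comm (l := []) (m := [a₂']) (r := [a₄])
    have e₃ {g : M.Hom x [a₁', a₂, a₃, a₄] c''} :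
      M.pre [] [a₂', a₃, a₄] rfl rfl p₁' (M.pre [a₁'] [a₃, a₄] rfl rfl p₂ g) =
      M.pre [a₁''] [a₃, a₄] rfl rfl p₂ (M.pre [] [a₂, a₃, a₄] rfl rfl p₁' g) :=
        M.pre_comm (l := []) (m := []) (r := [a₃, a₄])
    have e₄ {g : M.Hom x [a₁'', a₂', a₃', a₄] c''} :
      M.pre [a₁''] [a₃', a₄'] rfl rfl p₂' (M.pre [a₁'', a₂', a₃'] [] rfl rfl p₄ g) =
      M.pre [a₁'', a₂'', a₃'] [] rfl rfl p₄ (M.pre [a₁''] [a₃', a₄] rfl rfl p₂' g) :=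
        M.pre_comm (l := [a₁'']) (m := [a₃']) (r := [])
    have e₅ {g : M.Hom x [a₁'', a₂', a₃, a₄] c''} :
      M.pre [a₁''] [a₃', a₄] rfl rfl p₂' (M.pre [a₁'', a₂'] [a₄] rfl rfl p₃ g) =
      M.pre [a₁'', a₂''] [a₄] rfl rfl p₃ (M.pre [a₁''] [a₃, a₄] rfl rfl p₂' g) :=
        M.pre_comm (l := [a₁'']) (m := []) (r := [a₄])
    have e₆ {g : M.Hom x [a₁'', a₂'', a₃', a₄] c''} :
      M.pre [a₁'', a₂''] [a₄'] rfl rfl p₃' (M.pre [a₁'', a₂'', a₃'] [] rfl rfl p₄ g) =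
      M.pre [a₁'', a₂'', a₃''] [] rfl rfl p₄ (M.pre [a₁'', a₂''] [a₄] rfl rfl p₃' g) :=
        M.pre_comm (l := [a₁'', a₂'']) (m := []) (r := [])
    rw [e₁, e₂, e₃, pre_pre, e₄, e₅, pre_pre, e₆, pre_pre, pre_pre]; rfl

end SkewMulticategory

namespace SkewMulticategory

theorem id_eq (M : SkewMulticategory.{v, u}) (a : M.Ob) : 𝟙 a = M.id a := rfl

theorem trans_pre {M : SkewMulticategory.{v, u}} {x : Tightness} {Γ Γ' : List M.Ob} {a a' c : M.Ob}
    {l r : List M.Ob} {hΓ : Γ = l ++ a :: r} {hΓ' : Γ' = l ++ a' :: r} {p : M.Hom .t [a'] a}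
    {f f' : M.Hom x Γ c} {g : M.Hom x Γ' c} (e : g = M.pre l r hΓ hΓ' p f) (e' : f = f') :
    g = M.pre l r hΓ hΓ' p f' :=
  e.trans (congrArg _ e')

theorem j_post {M : SkewMulticategory.{v, u}} {Γ : List M.Ob} {c c' : M.Ob} {h : M.Hom .t [c] c'}
    {f : M.Hom .t Γ c} : M.j (M.post h f) = M.post h (M.j f) :=
  M.j_sub_right

theorem j_pre {M : SkewMulticategory.{v, u}} {Γ Γ' : List M.Ob} {a a' c : M.Ob} {l r : List M.Ob}
    {hΓ : Γ = l ++ a :: r} {hΓ' : Γ' = l ++ a' :: r} {p : M.Hom .t [a'] a} {f : M.Hom .t Γ c} :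
    M.j (M.pre l r hΓ hΓ' p f) = M.pre l r hΓ hΓ' p (M.j f) :=
  M.j_sub_left

/-- The short skew multicategory consisting of the multimaps of low arity. -/
def toShort (M : SkewMulticategory.{v, u}) : ShortSkewMulticategory.{v, u} where
  Ob := M.Ob
  T2 := M.fam2 .t
  T3 := M.fam3 .t
  T4 := M.fam4 .t
  L0 := M.fam0 .l
  L1 := M.fam1 .l
  L2 := M.fam2 .l
  j1 f := M.j f
  j2 f := M.j f
  nat_j1 _ _ _ := trans_pre (j_pre (l := []) (r := []) (hΓ' := rfl)) j_post
  nat_j2 _ _ _ _ := trans_pre (j_pre (hΓ' := rfl)) (trans_pre (j_pre (hΓ' := rfl)) j_post)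
  sub22_1 {_ b₂ _ _ _} f g := M.sub [] [b₂] rfl rfl rfl f g
  nat_22_1 := fun {b₁ b₂ b₂' c c' a₁ a₁' a₂ a₂'} p₁ p₂ q₂ h f g => by
    simp only [id_eq, pre_id, post_id]
    refine trans_pre (sub_pre_right [] (by rfl) (by rfl)) ?_
    refine trans_pre sub_pre_inner ?_
    refine trans_pre sub_pre_inner ?_
    exact sub_post
  din_22_1 _ _ _ := by
    simp only [id_eq, pre_id, post_id]
    exact sub_din
  sub22_2 {b₁ _ _ _ _} f g := M.sub [b₁] [] rfl rfl rfl f g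
  nat_22_2 := fun {b₁ b₁' b₂ c c' a₁ a₁' a₂ a₂'} p₁ p₂ q₁ h f g => by
    simp only [id_eq, pre_id, post_id]
    refine trans_pre sub_pre_inner ?_
    refine trans_pre sub_pre_inner ?_
    refine trans_pre (sub_pre_left [] (by rfl) (by rfl)) ?_
    exact sub_post
  din_22_2 _ _ _ := by
    simp only [id_eq, pre_id, post_id]
    exact sub_din
  sub32_1 {_ b₂ b₃ _ _ _} f g := M.sub [] [b₂, b₃] rfl rfl rfl f g
  nat_32_1 := fun {b₁ b₂ b₂' b₃ b₃' c c' a₁ a₁' a₂ a₂'} p₁ p₂ q₂ q₃ h f g => by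
    simp only [id_eq, pre_id, post_id]
    refine trans_pre (sub_pre_right [b₂'] (by rfl) (by rfl)) ?_
    refine trans_pre (sub_pre_right [] (by rfl) (by rfl)) ?_
    refine trans_pre sub_pre_inner ?_
    refine trans_pre sub_pre_inner ?_
    exact sub_post
  din_32_1 _ _ _ := by
    simp only [id_eq, pre_id, post_id]
    exact sub_din
  sub32_2 {b₁ _ b₃ _ _ _} f g := M.sub [b₁] [b₃] rfl rfl rfl f g
  nat_32_2 := fun {b₁ b₁' b₂ b₃ b₃' c c' a₁ a₁' a₂ a₂'} p₁ p₂ q₁ q₃ h f g => by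
    simp only [id_eq, pre_id, post_id]
    refine trans_pre (sub_pre_right [] (by rfl) (by rfl)) ?_
    refine trans_pre sub_pre_inner ?_
    refine trans_pre sub_pre_inner ?_
    refine trans_pre (sub_pre_left [] (by rfl) (by rfl)) ?_
    exact sub_post
  din_32_2 _ _ _ := by
    simp only [id_eq, pre_id, post_id]
    exact sub_din
  sub32_3 {b₁ b₂ _ _ _ _} f g := M.sub [b₁, b₂] [] rfl rfl rfl f g
  nat_32_3 := fun {b₁ b₁' b₂ b₂' b₃ c c' a₁ a₁' a₂ a₂'} p₁ p₂ q₁ q₂ h f g => by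
    simp only [id_eq, pre_id, post_id]
    refine trans_pre sub_pre_inner ?_
    refine trans_pre sub_pre_inner ?_
    refine trans_pre (sub_pre_left [] (by rfl) (by rfl)) ?_
    refine trans_pre (sub_pre_left [b₂] (by rfl) (by rfl)) ?_
    exact sub_post
  din_32_3 _ _ _ := by
    simp only [id_eq, pre_id, post_id]
    exact sub_din
  sub23_1 {_ b₂ _ _ _ _} f g := M.sub [] [b₂] rfl rfl rfl f g
  nat_23_1 := fun {b₁ b₂ b₂' c c' a₁ a₁' a₂ a₂' a₃ a₃'} p₁ p₂ p₃ q₂ h f g => by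
    simp only [id_eq, pre_id, post_id]
    refine trans_pre (sub_pre_right [] (by rfl) (by rfl)) ?_
    refine trans_pre sub_pre_inner ?_
    refine trans_pre sub_pre_inner ?_
    refine trans_pre sub_pre_inner ?_
    exact sub_post
  din_23_1 _ _ _ := by
    simp only [id_eq, pre_id, post_id]
    exact sub_din
  sub23_2 {b₁ _ _ _ _ _} f g := M.sub [b₁] [] rfl rfl rfl f g
  nat_23_2 := fun {b₁ b₁' b₂ c c' a₁ a₁' a₂ a₂' a₃ a₃'} p₁ p₂ p₃ q₁ h f g => by
    simp only [id_eq, pre_id, post_id]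
    refine trans_pre sub_pre_inner ?_
    refine trans_pre sub_pre_inner ?_
    refine trans_pre sub_pre_inner ?_
    refine trans_pre (sub_pre_left [] (by rfl) (by rfl)) ?_
    exact sub_post
  din_23_2 _ _ _ := by
    simp only [id_eq, pre_id, post_id]
    exact sub_din
  sub20_1 {_ b₂ _} f g := M.sub [] [b₂] rfl rfl rfl f g
  nat_20_1 := fun {b₁ b₂ b₂' c c'} q₂ h f g => by
    simp only [id_eq, pre_id, post_id]
    refine trans_pre (sub_pre_right [] (by rfl) (by rfl)) ?_
    exact sub_post
  din_20_1 _ _ _ := by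
    simp only [id_eq, pre_id, post_id]
    exact sub_din
  sub20_2 {b₁ _ _} f g := M.sub [b₁] [] rfl rfl rfl f g
  nat_20_2 := fun {b₁ b₁' b₂ c c'} q₁ h f g => by
    simp only [id_eq, pre_id, post_id]
    refine trans_pre (sub_pre_left [] (by rfl) (by rfl)) ?_
    exact sub_post
  din_20_2 _ _ _ := by
    simp only [id_eq, pre_id, post_id]
    exact sub_din
  sub30_1 {_ b₂ b₃ _} f g := M.sub [] [b₂, b₃] rfl rfl rfl f g
  nat_30_1 := fun {b₁ b₂ b₂' b₃ b₃' c c'} q₂ q₃ h f g => by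
    simp only [id_eq, pre_id, post_id]
    refine trans_pre (sub_pre_right [b₂'] (by rfl) (by rfl)) ?_
    refine trans_pre (sub_pre_right [] (by rfl) (by rfl)) ?_
    exact sub_post
  din_30_1 _ _ _ := by
    simp only [id_eq, pre_id, post_id]
    exact sub_din
  sub30_2 {b₁ _ b₃ _} f g := M.sub [b₁] [b₃] rfl rfl rfl f g
  nat_30_2 := fun {b₁ b₁' b₂ b₃ b₃' c c'} q₁ q₃ h f g => by
    simp only [id_eq, pre_id, post_id]
    refine trans_pre (sub_pre_right [] (by rfl) (by rfl)) ?_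
    refine trans_pre (sub_pre_left [] (by rfl) (by rfl)) ?_
    exact sub_post
  din_30_2 _ _ _ := by
    simp only [id_eq, pre_id, post_id]
    exact sub_din
  sub30_3 {b₁ b₂ _ _} f g := M.sub [b₁, b₂] [] rfl rfl rfl f g
  nat_30_3 := fun {b₁ b₁' b₂ b₂' b₃ c c'} q₁ q₂ h f g => by
    simp only [id_eq, pre_id, post_id]
    refine trans_pre (sub_pre_left [] (by rfl) (by rfl)) ?_
    refine trans_pre (sub_pre_left [b₂] (by rfl) (by rfl)) ?_
    exact sub_post
  din_30_3 _ _ _ := by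
    simp only [id_eq, pre_id, post_id]
    exact sub_din
  subL1_0 {_ _} f g := M.sub [] [] rfl rfl rfl f g
  nat_L1_0 := fun {b c c'} h f g => by
    simp only [id_eq, pre_id, post_id]
    exact sub_post
  din_L1_0 _ _ _ := by
    simp only [id_eq, pre_id, post_id]
    exact sub_din
  sub2_L1_1 {_ b₂ _ _} f g := M.sub [] [b₂] rfl rfl rfl f g
  nat_2_L1_1 := fun {b₁ b₂ b₂' c c' a a'} p q₂ h f g => by
    simp only [id_eq, pre_id, post_id]
    refine trans_pre (sub_pre_right [] (by rfl) (by rfl)) ?_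
    refine trans_pre sub_pre_inner ?_
    exact sub_post
  din_2_L1_1 _ _ _ := by
    simp only [id_eq, pre_id, post_id]
    exact sub_din
  sub2_L1_2 {b₁ _ _ _} f g := M.sub [b₁] [] rfl rfl rfl f g
  nat_2_L1_2 := fun {b₁ b₁' b₂ c c' a a'} p q₁ h f g => by
    simp only [id_eq, pre_id, post_id]
    refine trans_pre sub_pre_inner ?_
    refine trans_pre (sub_pre_left [] (by rfl) (by rfl)) ?_
    exact sub_post
  din_2_L1_2 _ _ _ := by
    simp only [id_eq, pre_id, post_id]
    exact sub_din
  subL1_2 {_ _ _ _} f g := M.sub [] [] rfl rfl rfl f g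
  nat_L1_2 := fun {b c c' a₁ a₁' a₂ a₂'} p₁ p₂ h f g => by
    simp only [id_eq, pre_id, post_id]
    refine trans_pre sub_pre_inner ?_
    refine trans_pre sub_pre_inner ?_
    exact sub_post
  din_L1_2 _ _ _ := by
    simp only [id_eq, pre_id, post_id]
    exact sub_din
  line_a_11 _ _ _ := M.assoc
  line_a_12 _ _ _ := M.assoc
  line_a_21 _ _ _ := M.assoc
  line_a_22 _ _ _ := M.assoc
  line_b_11 _ _ _ := M.assoc
  line_b_12 f g h := by
    simp only [id_eq, pre_id, post_id]
    exact M.assoc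
  line_b_21 _ _ _ := M.assoc
  line_b_22 f g h := by
    simp only [id_eq, pre_id, post_id]
    exact M.assoc
  comm_a f g h := M.comm (l := []) (m := []) (r := []) (f := f) (g := g) (h := h)
    (ΓΛ := [_, _, _]) (h₆ := rfl) (h₈ := rfl)
  comm_b f g h := by
    simp only [id_eq, pre_id]
    exact M.comm (l := []) (m := []) (r := []) (f := f) (g := g) (h := h)
      (ΓΛ := [_]) (h₆ := rfl) (h₈ := rfl)
  comm_c f g h := M.comm (l := []) (m := []) (r := []) (f := f) (g := g) (h := h)
    (ΓΛ := [_, _, _]) (h₆ := rfl) (h₈ := rfl)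
  comm_d f g h := M.comm (l := []) (m := []) (r := []) (f := f) (g := g) (h := h) (ΓΛ := [_])
    (h₆ := rfl) (h₈ := rfl)
  j_2_L1_1 g p := by
    simp only [id_eq, pre_id, post_id]
    exact M.j_sub_right.symm
  j_2_L1_2 g p := by
    simp only [id_eq, pre_id, post_id]
    exact M.sub_right.symm
  j_L1_2 p g := by
    simp only [id_eq, pre_id, post_id]
    exact M.j_sub_left.symm
  j_L1_0 p v := M.sub_left.symm

theorem map_post {M N : SkewMulticategory.{v, u}} (F : M ⟶ N) {x : Tightness} {Γ : List M.Ob}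
    {Γ' : List N.Ob} {c c' : M.Ob} {k : M.Hom .t [c] c'} {f : M.Hom x Γ c} {h : Γ' = Γ.map F.obj} :
    F.map h (M.post k f) = N.post (F.map rfl k) (F.map h f) :=
  F.map_sub

theorem map_pre {M N : SkewMulticategory.{v, u}} (F : M ⟶ N) {x : Tightness} {Γ Γ₁ : List M.Ob}
    {Γ' Γ₁' : List N.Ob} {a a' c : M.Ob} (l r : List M.Ob) (h₁ : Γ = l ++ a :: r)
    (h₂ : Γ₁ = l ++ a' :: r) {p : M.Hom .t [a'] a} {f : M.Hom x Γ c} {h : Γ' = Γ.map F.obj}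
    {h' : Γ₁' = Γ₁.map F.obj} :
    F.map h' (M.pre l r h₁ h₂ p f) = N.pre (l.map F.obj) (r.map F.obj)
      (by rw [h, h₁]; simp) (by rw [h', h₂]; simp) (F.map rfl p) (F.map h f) :=
  F.map_sub

/-- The action of `toShort` on morphisms. -/
def toShortMap {M N : SkewMulticategory.{v, u}} (F : M ⟶ N) : M.toShort ⟶ N.toShort where
  F :=
    { obj := F.obj
      map := fun f => F.map rfl f
      map_id := fun a => F.map_id a
      map_comp := fun _ _ => map_post F }
  T2 f := F.map rfl f
  T3 f := F.map rfl f
  T4 f := F.map rfl f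
  L0 f := F.map rfl f
  L1 f := F.map rfl f
  L2 f := F.map rfl f
  nat_T2 _ _ _ _ := trans_pre (map_pre F [_] [] rfl rfl (h := rfl))
    (trans_pre (map_pre F [] [_] rfl rfl (h := rfl))
    (map_post F))
  nat_T3 _ _ _ _ _ := trans_pre (map_pre F [_, _] [] rfl rfl (h := rfl))
    (trans_pre (map_pre F [_] [_] rfl rfl (h := rfl))
    (trans_pre (map_pre F [] [_, _] rfl rfl (h := rfl))
    (map_post F)))
  nat_T4 _ _ _ _ _ _ := trans_pre (map_pre F [_, _, _] [] rfl rfl (h := rfl))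
    (trans_pre (map_pre F [_, _] [_] rfl rfl (h := rfl))
    (trans_pre (map_pre F [_] [_, _] rfl rfl (h := rfl))
    (trans_pre (map_pre F [] [_, _, _] rfl rfl (h := rfl))
    (map_post F))))
  nat_L0 _ _ := map_post F
  nat_L1 _ _ _ := trans_pre (map_pre F [] [] rfl rfl (h := rfl))
    (map_post F)
  nat_L2 _ _ _ _ := trans_pre (map_pre F [_] [] rfl rfl (h := rfl))
    (trans_pre (map_pre F [] [_] rfl rfl (h := rfl))
    (map_post F))
  map_j1 _ := F.map_j rfl _
  map_j2 _ := F.map_j rfl _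
  map_22_1 _ _ := F.map_sub
  map_22_2 _ _ := F.map_sub
  map_32_1 _ _ := F.map_sub
  map_32_2 _ _ := F.map_sub
  map_32_3 _ _ := F.map_sub
  map_23_1 _ _ := F.map_sub
  map_23_2 _ _ := F.map_sub
  map_20_1 _ _ := F.map_sub
  map_20_2 _ _ := F.map_sub
  map_30_1 _ _ := F.map_sub
  map_30_2 _ _ := F.map_sub
  map_30_3 _ _ := F.map_sub
  map_L1_0 _ _ := F.map_sub
  map_2_L1_1 _ _ := F.map_sub
  map_2_L1_2 _ _ := F.map_sub
  map_L1_2 _ _ := F.map_sub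

end SkewMulticategory

/-- The forgetful functor from skew multicategories to short skew multicategories. -/
def SkewMulticategory.forgetShort : SkewMulticategory.{v, u} ⥤ ShortSkewMulticategory.{v, u} where
  obj M := M.toShort
  map F := SkewMulticategory.toShortMap F
  map_id _ := rfl
  map_comp _ _ := rfl

namespace SkewMulticategory

variable (M : SkewMulticategory.{v, u})

/-- `e : h, b → c` exhibits `h` as an internal hom `[b, c]`: `e ∘₁ -` is bijective on tight maps of
positive arity and on loose maps of every arity. -/
def IsInternalHom {h b c : M.Ob} (e : M.Hom .t [h, b] c) : Prop :=
  ∀ (x : Tightness) (Γ : List M.Ob), (x = .t → Γ ≠ []) →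
    Function.Bijective fun f : M.Hom x Γ h => M.sub [] [b] rfl rfl (t_comp x) e f

/-- A skew multicategory is closed if it has all internal homs `[b, c]`. -/
def IsClosed : Prop :=
  ∀ b c : M.Ob, ∃ (h : M.Ob) (e : M.Hom .t [h, b] c), M.IsInternalHom e

/-- `u` is a nullary map classifier: it represents the functor of (loose) nullary maps. -/
def IsNullaryClassifier {i : M.Ob} (u : M.Hom .l [] i) : Prop :=
  ∀ a : M.Ob, Function.Bijective fun f : M.Hom .t [i] a => M.post f u

/-- Closed, with a nullary map classifier. -/
def closedWithUnit : ObjectProperty SkewMulticategory.{v, u} :=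
  fun M => M.IsClosed ∧ ∃ (i : M.Ob) (u : M.Hom .l [] i), M.IsNullaryClassifier u

variable {M}

theorem IsInternalHom.toShort {h b c : M.Ob} {e : M.Hom .t [h, b] c} (he : M.IsInternalHom e) :
    M.toShort.IsInternalHom (h := h) (b := b) (c := c) e := by
  refine ⟨fun x => ?_, fun x y => he .t [x, y] (by simp), fun x y z => he .t [x, y, z] (by simp),
    he .l [] (by simp), fun x => he .l [x] (by simp)⟩
  have e₁ : (fun f : M.Hom .t [x] h => (M.fam2 .t).map f (M.id b) (M.id c) e) =
      fun f => M.sub [] [b] rfl rfl rfl e f := by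
    funext f
    simp only [pre_id, post_id]
    rfl
  exact e₁ ▸ he .t [x] (by simp)

end SkewMulticategory

/-- Closed skew multicategories with units; a full subcategory of the category of skew
multicategories. -/
abbrev ClosedSkewMulti : Type (max (u + 1) (v + 1)) :=
  SkewMulticategory.closedWithUnit.{v, u}.FullSubcategory

/-- The forgetful functor from closed skew multicategories with units to closed short skew
multicategories with a nullary map classifier. -/
def skewU : ClosedSkewMulti.{v, u} ⥤ ClosedShortSkewMulti.{v, u} :=
  ShortSkewMulticategory.closedWithUnit.lift
    (SkewMulticategory.closedWithUnit.ι ⋙ SkewMulticategory.forgetShort) fun M =>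
    ⟨fun b c => (M.property.1 b c).imp fun _ h => h.imp fun _ he => he.toShort, M.property.2⟩

/-! ### Short multicategories -/

/-- A short multicategory: `M n` are the `n`-ary multimaps (unary maps are the morphisms of `Ob`)
and `subₙₘ_i` is the substitution `- ∘ᵢ -` of an `m`-ary map into an `n`-ary one. -/
structure ShortMulticategory where
  Ob : Type u
  [cat : Category.{v} Ob]
  M2 : Fam2.{v} Ob
  M3 : Fam3.{v} Ob
  M4 : Fam4.{v} Ob
  M0 : Fam0.{v} Ob
  -- substitution of a binary map into a binary map
  sub22_1 {b₁ b₂ c a₁ a₂ : Ob} : M2.obj b₁ b₂ c → M2.obj a₁ a₂ b₁ → M3.obj a₁ a₂ b₂ c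
  sub22_2 {b₁ b₂ c a₁ a₂ : Ob} : M2.obj b₁ b₂ c → M2.obj a₁ a₂ b₂ → M3.obj b₁ a₁ a₂ c
  nat_22_1 {b₁ b₂ b₂' c c' a₁ a₁' a₂ a₂' : Ob} (p₁ : a₁' ⟶ a₁) (p₂ : a₂' ⟶ a₂) (q₂ : b₂' ⟶ b₂)
    (h : c ⟶ c') (f : M2.obj b₁ b₂ c) (g : M2.obj a₁ a₂ b₁) :
    sub22_1 (M2.map (𝟙 _) q₂ h f) (M2.map p₁ p₂ (𝟙 _) g) = M3.map p₁ p₂ q₂ h (sub22_1 f g)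
  din_22_1 {b₁ b₁' b₂ c a₁ a₂ : Ob} (k : b₁ ⟶ b₁') (f : M2.obj b₁' b₂ c) (g : M2.obj a₁ a₂ b₁) :
    sub22_1 (M2.map k (𝟙 _) (𝟙 _) f) g = sub22_1 f (M2.map (𝟙 _) (𝟙 _) k g)
  nat_22_2 {b₁ b₁' b₂ c c' a₁ a₁' a₂ a₂' : Ob} (p₁ : a₁' ⟶ a₁) (p₂ : a₂' ⟶ a₂) (q₁ : b₁' ⟶ b₁)
    (h : c ⟶ c') (f : M2.obj b₁ b₂ c) (g : M2.obj a₁ a₂ b₂) :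
    sub22_2 (M2.map q₁ (𝟙 _) h f) (M2.map p₁ p₂ (𝟙 _) g) = M3.map q₁ p₁ p₂ h (sub22_2 f g)
  din_22_2 {b₁ b₂ b₂' c a₁ a₂ : Ob} (k : b₂ ⟶ b₂') (f : M2.obj b₁ b₂' c) (g : M2.obj a₁ a₂ b₂) :
    sub22_2 (M2.map (𝟙 _) k (𝟙 _) f) g = sub22_2 f (M2.map (𝟙 _) (𝟙 _) k g)
  -- substitution of a binary map into a ternary map
  sub32_1 {b₁ b₂ b₃ c a₁ a₂ : Ob} :
    M3.obj b₁ b₂ b₃ c → M2.obj a₁ a₂ b₁ → M4.obj a₁ a₂ b₂ b₃ c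
  sub32_2 {b₁ b₂ b₃ c a₁ a₂ : Ob} :
    M3.obj b₁ b₂ b₃ c → M2.obj a₁ a₂ b₂ → M4.obj b₁ a₁ a₂ b₃ c
  sub32_3 {b₁ b₂ b₃ c a₁ a₂ : Ob} :
    M3.obj b₁ b₂ b₃ c → M2.obj a₁ a₂ b₃ → M4.obj b₁ b₂ a₁ a₂ c
  nat_32_1 {b₁ b₂ b₂' b₃ b₃' c c' a₁ a₁' a₂ a₂' : Ob} (p₁ : a₁' ⟶ a₁) (p₂ : a₂' ⟶ a₂)
    (q₂ : b₂' ⟶ b₂) (q₃ : b₃' ⟶ b₃) (h : c ⟶ c') (f : M3.obj b₁ b₂ b₃ c) (g : M2.obj a₁ a₂ b₁) :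
    sub32_1 (M3.map (𝟙 _) q₂ q₃ h f) (M2.map p₁ p₂ (𝟙 _) g) =
      M4.map p₁ p₂ q₂ q₃ h (sub32_1 f g)
  din_32_1 {b₁ b₁' b₂ b₃ c a₁ a₂ : Ob} (k : b₁ ⟶ b₁') (f : M3.obj b₁' b₂ b₃ c)
    (g : M2.obj a₁ a₂ b₁) :
    sub32_1 (M3.map k (𝟙 _) (𝟙 _) (𝟙 _) f) g = sub32_1 f (M2.map (𝟙 _) (𝟙 _) k g)
  nat_32_2 {b₁ b₁' b₂ b₃ b₃' c c' a₁ a₁' a₂ a₂' : Ob} (p₁ : a₁' ⟶ a₁) (p₂ : a₂' ⟶ a₂)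
    (q₁ : b₁' ⟶ b₁) (q₃ : b₃' ⟶ b₃) (h : c ⟶ c') (f : M3.obj b₁ b₂ b₃ c) (g : M2.obj a₁ a₂ b₂) :
    sub32_2 (M3.map q₁ (𝟙 _) q₃ h f) (M2.map p₁ p₂ (𝟙 _) g) =
      M4.map q₁ p₁ p₂ q₃ h (sub32_2 f g)
  din_32_2 {b₁ b₂ b₂' b₃ c a₁ a₂ : Ob} (k : b₂ ⟶ b₂') (f : M3.obj b₁ b₂' b₃ c)
    (g : M2.obj a₁ a₂ b₂) :
    sub32_2 (M3.map (𝟙 _) k (𝟙 _) (𝟙 _) f) g = sub32_2 f (M2.map (𝟙 _) (𝟙 _) k g)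
  nat_32_3 {b₁ b₁' b₂ b₂' b₃ c c' a₁ a₁' a₂ a₂' : Ob} (p₁ : a₁' ⟶ a₁) (p₂ : a₂' ⟶ a₂)
    (q₁ : b₁' ⟶ b₁) (q₂ : b₂' ⟶ b₂) (h : c ⟶ c') (f : M3.obj b₁ b₂ b₃ c) (g : M2.obj a₁ a₂ b₃) :
    sub32_3 (M3.map q₁ q₂ (𝟙 _) h f) (M2.map p₁ p₂ (𝟙 _) g) =
      M4.map q₁ q₂ p₁ p₂ h (sub32_3 f g)
  din_32_3 {b₁ b₂ b₃ b₃' c a₁ a₂ : Ob} (k : b₃ ⟶ b₃') (f : M3.obj b₁ b₂ b₃' c)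
    (g : M2.obj a₁ a₂ b₃) :
    sub32_3 (M3.map (𝟙 _) (𝟙 _) k (𝟙 _) f) g = sub32_3 f (M2.map (𝟙 _) (𝟙 _) k g)
  -- substitution of a ternary map into a binary map
  sub23_1 {b₁ b₂ c a₁ a₂ a₃ : Ob} :
    M2.obj b₁ b₂ c → M3.obj a₁ a₂ a₃ b₁ → M4.obj a₁ a₂ a₃ b₂ c
  sub23_2 {b₁ b₂ c a₁ a₂ a₃ : Ob} :
    M2.obj b₁ b₂ c → M3.obj a₁ a₂ a₃ b₂ → M4.obj b₁ a₁ a₂ a₃ c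
  nat_23_1 {b₁ b₂ b₂' c c' a₁ a₁' a₂ a₂' a₃ a₃' : Ob} (p₁ : a₁' ⟶ a₁) (p₂ : a₂' ⟶ a₂)
    (p₃ : a₃' ⟶ a₃) (q₂ : b₂' ⟶ b₂) (h : c ⟶ c') (f : M2.obj b₁ b₂ c)
    (g : M3.obj a₁ a₂ a₃ b₁) :
    sub23_1 (M2.map (𝟙 _) q₂ h f) (M3.map p₁ p₂ p₃ (𝟙 _) g) =
      M4.map p₁ p₂ p₃ q₂ h (sub23_1 f g)
  din_23_1 {b₁ b₁' b₂ c a₁ a₂ a₃ : Ob} (k : b₁ ⟶ b₁') (f : M2.obj b₁' b₂ c)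
    (g : M3.obj a₁ a₂ a₃ b₁) :
    sub23_1 (M2.map k (𝟙 _) (𝟙 _) f) g = sub23_1 f (M3.map (𝟙 _) (𝟙 _) (𝟙 _) k g)
  nat_23_2 {b₁ b₁' b₂ c c' a₁ a₁' a₂ a₂' a₃ a₃' : Ob} (p₁ : a₁' ⟶ a₁) (p₂ : a₂' ⟶ a₂)
    (p₃ : a₃' ⟶ a₃) (q₁ : b₁' ⟶ b₁) (h : c ⟶ c') (f : M2.obj b₁ b₂ c)
    (g : M3.obj a₁ a₂ a₃ b₂) :
    sub23_2 (M2.map q₁ (𝟙 _) h f) (M3.map p₁ p₂ p₃ (𝟙 _) g) =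
      M4.map q₁ p₁ p₂ p₃ h (sub23_2 f g)
  din_23_2 {b₁ b₂ b₂' c a₁ a₂ a₃ : Ob} (k : b₂ ⟶ b₂') (f : M2.obj b₁ b₂' c)
    (g : M3.obj a₁ a₂ a₃ b₂) :
    sub23_2 (M2.map (𝟙 _) k (𝟙 _) f) g = sub23_2 f (M3.map (𝟙 _) (𝟙 _) (𝟙 _) k g)
  -- substitution of a nullary map into a binary map
  sub20_1 {b₁ b₂ c : Ob} : M2.obj b₁ b₂ c → M0.obj b₁ → (b₂ ⟶ c)
  sub20_2 {b₁ b₂ c : Ob} : M2.obj b₁ b₂ c → M0.obj b₂ → (b₁ ⟶ c)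
  nat_20_1 {b₁ b₂ b₂' c c' : Ob} (q₂ : b₂' ⟶ b₂) (h : c ⟶ c') (f : M2.obj b₁ b₂ c)
    (v : M0.obj b₁) : sub20_1 (M2.map (𝟙 _) q₂ h f) v = q₂ ≫ sub20_1 f v ≫ h
  din_20_1 {b₁ b₁' b₂ c : Ob} (k : b₁ ⟶ b₁') (f : M2.obj b₁' b₂ c) (v : M0.obj b₁) :
    sub20_1 (M2.map k (𝟙 _) (𝟙 _) f) v = sub20_1 f (M0.map k v)
  nat_20_2 {b₁ b₁' b₂ c c' : Ob} (q₁ : b₁' ⟶ b₁) (h : c ⟶ c') (f : M2.obj b₁ b₂ c)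
    (v : M0.obj b₂) : sub20_2 (M2.map q₁ (𝟙 _) h f) v = q₁ ≫ sub20_2 f v ≫ h
  din_20_2 {b₁ b₂ b₂' c : Ob} (k : b₂ ⟶ b₂') (f : M2.obj b₁ b₂' c) (v : M0.obj b₂) :
    sub20_2 (M2.map (𝟙 _) k (𝟙 _) f) v = sub20_2 f (M0.map k v)
  -- substitution of a nullary map into a ternary map
  sub30_1 {b₁ b₂ b₃ c : Ob} : M3.obj b₁ b₂ b₃ c → M0.obj b₁ → M2.obj b₂ b₃ c
  sub30_2 {b₁ b₂ b₃ c : Ob} : M3.obj b₁ b₂ b₃ c → M0.obj b₂ → M2.obj b₁ b₃ c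
  sub30_3 {b₁ b₂ b₃ c : Ob} : M3.obj b₁ b₂ b₃ c → M0.obj b₃ → M2.obj b₁ b₂ c
  nat_30_1 {b₁ b₂ b₂' b₃ b₃' c c' : Ob} (q₂ : b₂' ⟶ b₂) (q₃ : b₃' ⟶ b₃) (h : c ⟶ c')
    (f : M3.obj b₁ b₂ b₃ c) (v : M0.obj b₁) :
    sub30_1 (M3.map (𝟙 _) q₂ q₃ h f) v = M2.map q₂ q₃ h (sub30_1 f v)
  din_30_1 {b₁ b₁' b₂ b₃ c : Ob} (k : b₁ ⟶ b₁') (f : M3.obj b₁' b₂ b₃ c) (v : M0.obj b₁) :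
    sub30_1 (M3.map k (𝟙 _) (𝟙 _) (𝟙 _) f) v = sub30_1 f (M0.map k v)
  nat_30_2 {b₁ b₁' b₂ b₃ b₃' c c' : Ob} (q₁ : b₁' ⟶ b₁) (q₃ : b₃' ⟶ b₃) (h : c ⟶ c')
    (f : M3.obj b₁ b₂ b₃ c) (v : M0.obj b₂) :
    sub30_2 (M3.map q₁ (𝟙 _) q₃ h f) v = M2.map q₁ q₃ h (sub30_2 f v)
  din_30_2 {b₁ b₂ b₂' b₃ c : Ob} (k : b₂ ⟶ b₂') (f : M3.obj b₁ b₂' b₃ c) (v : M0.obj b₂) :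
    sub30_2 (M3.map (𝟙 _) k (𝟙 _) (𝟙 _) f) v = sub30_2 f (M0.map k v)
  nat_30_3 {b₁ b₁' b₂ b₂' b₃ c c' : Ob} (q₁ : b₁' ⟶ b₁) (q₂ : b₂' ⟶ b₂) (h : c ⟶ c')
    (f : M3.obj b₁ b₂ b₃ c) (v : M0.obj b₃) :
    sub30_3 (M3.map q₁ q₂ (𝟙 _) h f) v = M2.map q₁ q₂ h (sub30_3 f v)
  din_30_3 {b₁ b₂ b₃ b₃' c : Ob} (k : b₃ ⟶ b₃') (f : M3.obj b₁ b₂ b₃' c) (v : M0.obj b₃) :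
    sub30_3 (M3.map (𝟙 _) (𝟙 _) k (𝟙 _) f) v = sub30_3 f (M0.map k v)
  -- `f ∘ᵢ (g ∘ⱼ h) = (f ∘ᵢ g) ∘ᵢ₊ⱼ₋₁ h` for `f`, `g`, `h` binary
  line_a_11 {b₁ b₂ c a₁ a₂ d₁ d₂ : Ob} (f : M2.obj b₁ b₂ c) (g : M2.obj a₁ a₂ b₁)
    (h : M2.obj d₁ d₂ a₁) : sub23_1 f (sub22_1 g h) = sub32_1 (sub22_1 f g) h
  line_a_12 {b₁ b₂ c a₁ a₂ d₁ d₂ : Ob} (f : M2.obj b₁ b₂ c) (g : M2.obj a₁ a₂ b₁)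
    (h : M2.obj d₁ d₂ a₂) : sub23_1 f (sub22_2 g h) = sub32_2 (sub22_1 f g) h
  line_a_21 {b₁ b₂ c a₁ a₂ d₁ d₂ : Ob} (f : M2.obj b₁ b₂ c) (g : M2.obj a₁ a₂ b₂)
    (h : M2.obj d₁ d₂ a₁) : sub23_2 f (sub22_1 g h) = sub32_2 (sub22_2 f g) h
  line_a_22 {b₁ b₂ c a₁ a₂ d₁ d₂ : Ob} (f : M2.obj b₁ b₂ c) (g : M2.obj a₁ a₂ b₂)
    (h : M2.obj d₁ d₂ a₂) : sub23_2 f (sub22_2 g h) = sub32_3 (sub22_2 f g) h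
  -- the same for `f`, `g` binary and `h` nullary
  line_b_11 {b₁ b₂ c a₁ a₂ : Ob} (f : M2.obj b₁ b₂ c) (g : M2.obj a₁ a₂ b₁) (h : M0.obj a₁) :
    M2.map (sub20_1 g h) (𝟙 _) (𝟙 _) f = sub30_1 (sub22_1 f g) h
  line_b_12 {b₁ b₂ c a₁ a₂ : Ob} (f : M2.obj b₁ b₂ c) (g : M2.obj a₁ a₂ b₁) (h : M0.obj a₂) :
    M2.map (sub20_2 g h) (𝟙 _) (𝟙 _) f = sub30_2 (sub22_1 f g) h
  line_b_21 {b₁ b₂ c a₁ a₂ : Ob} (f : M2.obj b₁ b₂ c) (g : M2.obj a₁ a₂ b₂) (h : M0.obj a₁) :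
    M2.map (𝟙 _) (sub20_1 g h) (𝟙 _) f = sub30_2 (sub22_2 f g) h
  line_b_22 {b₁ b₂ c a₁ a₂ : Ob} (f : M2.obj b₁ b₂ c) (g : M2.obj a₁ a₂ b₂) (h : M0.obj a₂) :
    M2.map (𝟙 _) (sub20_2 g h) (𝟙 _) f = sub30_3 (sub22_2 f g) h
  -- `(f ∘₁ g) ∘ₙ₊₁ h = (f ∘₂ h) ∘₁ g` for `f` binary and `(g, h)` binary-binary, binary-nullary,
  -- nullary-binary and nullary-nullary
  comm_a {b₁ b₂ c a₁ a₂ d₁ d₂ : Ob} (f : M2.obj b₁ b₂ c) (g : M2.obj a₁ a₂ b₁)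
    (h : M2.obj d₁ d₂ b₂) : sub32_3 (sub22_1 f g) h = sub32_1 (sub22_2 f h) g
  comm_b {b₁ b₂ c a₁ a₂ : Ob} (f : M2.obj b₁ b₂ c) (g : M2.obj a₁ a₂ b₁) (h : M0.obj b₂) :
    sub30_3 (sub22_1 f g) h = M2.map (𝟙 _) (𝟙 _) (sub20_2 f h) g
  comm_c {b₁ b₂ c d₁ d₂ : Ob} (f : M2.obj b₁ b₂ c) (g : M0.obj b₁) (h : M2.obj d₁ d₂ b₂) :
    M2.map (𝟙 _) (𝟙 _) (sub20_1 f g) h = sub30_1 (sub22_2 f h) g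
  comm_d {b₁ b₂ c : Ob} (f : M2.obj b₁ b₂ c) (g : M0.obj b₁) (h : M0.obj b₂) :
    M0.map (sub20_1 f g) h = M0.map (sub20_2 f h) g

attribute [instance] ShortMulticategory.cat

/-- A morphism of short multicategories. -/
structure ShortMultifunctor (C D : ShortMulticategory.{v, u}) where
  F : C.Ob ⥤ D.Ob
  M2 {a b c : C.Ob} : C.M2.obj a b c → D.M2.obj (F.obj a) (F.obj b) (F.obj c)
  M3 {a₁ a₂ a₃ c : C.Ob} :
    C.M3.obj a₁ a₂ a₃ c → D.M3.obj (F.obj a₁) (F.obj a₂) (F.obj a₃) (F.obj c)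
  M4 {a₁ a₂ a₃ a₄ c : C.Ob} : C.M4.obj a₁ a₂ a₃ a₄ c →
    D.M4.obj (F.obj a₁) (F.obj a₂) (F.obj a₃) (F.obj a₄) (F.obj c)
  M0 {c : C.Ob} : C.M0.obj c → D.M0.obj (F.obj c)
  nat_M2 {a a' b b' c c' : C.Ob} (p : a' ⟶ a) (q : b' ⟶ b) (h : c ⟶ c') (f : C.M2.obj a b c) :
    M2 (C.M2.map p q h f) = D.M2.map (F.map p) (F.map q) (F.map h) (M2 f)
  nat_M3 {a₁ a₁' a₂ a₂' a₃ a₃' c c' : C.Ob} (p₁ : a₁' ⟶ a₁) (p₂ : a₂' ⟶ a₂) (p₃ : a₃' ⟶ a₃)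
    (h : c ⟶ c') (f : C.M3.obj a₁ a₂ a₃ c) :
    M3 (C.M3.map p₁ p₂ p₃ h f) = D.M3.map (F.map p₁) (F.map p₂) (F.map p₃) (F.map h) (M3 f)
  nat_M4 {a₁ a₁' a₂ a₂' a₃ a₃' a₄ a₄' c c' : C.Ob} (p₁ : a₁' ⟶ a₁) (p₂ : a₂' ⟶ a₂)
    (p₃ : a₃' ⟶ a₃) (p₄ : a₄' ⟶ a₄) (h : c ⟶ c') (f : C.M4.obj a₁ a₂ a₃ a₄ c) :
    M4 (C.M4.map p₁ p₂ p₃ p₄ h f) =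
      D.M4.map (F.map p₁) (F.map p₂) (F.map p₃) (F.map p₄) (F.map h) (M4 f)
  nat_M0 {c c' : C.Ob} (h : c ⟶ c') (v : C.M0.obj c) : M0 (C.M0.map h v) = D.M0.map (F.map h) (M0 v)
  map_22_1 {b₁ b₂ c a₁ a₂ : C.Ob} (f : C.M2.obj b₁ b₂ c) (g : C.M2.obj a₁ a₂ b₁) :
    M3 (C.sub22_1 f g) = D.sub22_1 (M2 f) (M2 g)
  map_22_2 {b₁ b₂ c a₁ a₂ : C.Ob} (f : C.M2.obj b₁ b₂ c) (g : C.M2.obj a₁ a₂ b₂) :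
    M3 (C.sub22_2 f g) = D.sub22_2 (M2 f) (M2 g)
  map_32_1 {b₁ b₂ b₃ c a₁ a₂ : C.Ob} (f : C.M3.obj b₁ b₂ b₃ c) (g : C.M2.obj a₁ a₂ b₁) :
    M4 (C.sub32_1 f g) = D.sub32_1 (M3 f) (M2 g)
  map_32_2 {b₁ b₂ b₃ c a₁ a₂ : C.Ob} (f : C.M3.obj b₁ b₂ b₃ c) (g : C.M2.obj a₁ a₂ b₂) :
    M4 (C.sub32_2 f g) = D.sub32_2 (M3 f) (M2 g)
  map_32_3 {b₁ b₂ b₃ c a₁ a₂ : C.Ob} (f : C.M3.obj b₁ b₂ b₃ c) (g : C.M2.obj a₁ a₂ b₃) :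
    M4 (C.sub32_3 f g) = D.sub32_3 (M3 f) (M2 g)
  map_23_1 {b₁ b₂ c a₁ a₂ a₃ : C.Ob} (f : C.M2.obj b₁ b₂ c) (g : C.M3.obj a₁ a₂ a₃ b₁) :
    M4 (C.sub23_1 f g) = D.sub23_1 (M2 f) (M3 g)
  map_23_2 {b₁ b₂ c a₁ a₂ a₃ : C.Ob} (f : C.M2.obj b₁ b₂ c) (g : C.M3.obj a₁ a₂ a₃ b₂) :
    M4 (C.sub23_2 f g) = D.sub23_2 (M2 f) (M3 g)
  map_20_1 {b₁ b₂ c : C.Ob} (f : C.M2.obj b₁ b₂ c) (v : C.M0.obj b₁) :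
    F.map (C.sub20_1 f v) = D.sub20_1 (M2 f) (M0 v)
  map_20_2 {b₁ b₂ c : C.Ob} (f : C.M2.obj b₁ b₂ c) (v : C.M0.obj b₂) :
    F.map (C.sub20_2 f v) = D.sub20_2 (M2 f) (M0 v)
  map_30_1 {b₁ b₂ b₃ c : C.Ob} (f : C.M3.obj b₁ b₂ b₃ c) (v : C.M0.obj b₁) :
    M2 (C.sub30_1 f v) = D.sub30_1 (M3 f) (M0 v)
  map_30_2 {b₁ b₂ b₃ c : C.Ob} (f : C.M3.obj b₁ b₂ b₃ c) (v : C.M0.obj b₂) :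
    M2 (C.sub30_2 f v) = D.sub30_2 (M3 f) (M0 v)
  map_30_3 {b₁ b₂ b₃ c : C.Ob} (f : C.M3.obj b₁ b₂ b₃ c) (v : C.M0.obj b₃) :
    M2 (C.sub30_3 f v) = D.sub30_3 (M3 f) (M0 v)

/-- The category of short multicategories. -/
instance : Category ShortMulticategory.{v, u} where
  Hom C D := ShortMultifunctor C D
  id C :=
    { F := 𝟭 _, M0 := fun f => f, M2 := fun f => f, M3 := fun f => f, M4 := fun f => f
      nat_M2 := fun _ _ _ _ => rfl
      nat_M3 := fun _ _ _ _ _ => rfl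
      nat_M4 := fun _ _ _ _ _ _ => rfl
      nat_M0 := fun _ _ => rfl
      map_22_1 := fun _ _ => rfl
      map_22_2 := fun _ _ => rfl
      map_32_1 := fun _ _ => rfl
      map_32_2 := fun _ _ => rfl
      map_32_3 := fun _ _ => rfl
      map_23_1 := fun _ _ => rfl
      map_23_2 := fun _ _ => rfl
      map_20_1 := fun _ _ => rfl
      map_20_2 := fun _ _ => rfl
      map_30_1 := fun _ _ => rfl
      map_30_2 := fun _ _ => rfl
      map_30_3 := fun _ _ => rfl }
  comp F G :=
    { F := F.F ⋙ G.F
      M0 := fun f => G.M0 (F.M0 f), M2 := fun f => G.M2 (F.M2 f)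
      M3 := fun f => G.M3 (F.M3 f), M4 := fun f => G.M4 (F.M4 f)
      nat_M2 := by intros; simp only [F.nat_M2, G.nat_M2, Functor.comp_map]
      nat_M3 := by intros; simp only [F.nat_M3, G.nat_M3, Functor.comp_map]
      nat_M4 := by intros; simp only [F.nat_M4, G.nat_M4, Functor.comp_map]
      nat_M0 := by intros; simp only [F.nat_M0, G.nat_M0, Functor.comp_map]
      map_22_1 := by intros; simp only [F.map_22_1, G.map_22_1]
      map_22_2 := by intros; simp only [F.map_22_2, G.map_22_2]
      map_32_1 := by intros; simp only [F.map_32_1, G.map_32_1]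
      map_32_2 := by intros; simp only [F.map_32_2, G.map_32_2]
      map_32_3 := by intros; simp only [F.map_32_3, G.map_32_3]
      map_23_1 := by intros; simp only [F.map_23_1, G.map_23_1]
      map_23_2 := by intros; simp only [F.map_23_2, G.map_23_2]
      map_20_1 := by intros; simp only [F.map_20_1, G.map_20_1, Functor.comp_map]
      map_20_2 := by intros; simp only [F.map_20_2, G.map_20_2, Functor.comp_map]
      map_30_1 := by intros; simp only [F.map_30_1, G.map_30_1]
      map_30_2 := by intros; simp only [F.map_30_2, G.map_30_2]
      map_30_3 := by intros; simp only [F.map_30_3, G.map_30_3] }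
  id_comp _ := rfl
  comp_id _ := rfl
  assoc _ _ _ := rfl

namespace ShortMulticategory

/-- The hom functor of a category. -/
abbrev homFam (C : Type u) [Category.{v} C] : Fam1.{v} C where
  obj a c := a ⟶ c
  map p h f := p ≫ f ≫ h
  map_id := by simp
  map_comp := by simp

/-- A short multicategory as a short skew multicategory in which all multimaps of positive arity are
both tight and loose. -/
def toSkew (C : ShortMulticategory.{v, u}) : ShortSkewMulticategory.{v, u} where
  Ob := C.Ob
  T2 := C.M2
  T3 := C.M3
  T4 := C.M4
  L0 := C.M0
  L1 := homFam C.Ob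
  L2 := C.M2
  j1 f := f
  j2 f := f
  nat_j1 _ _ _ := rfl
  nat_j2 _ _ _ _ := rfl
  sub22_1 := C.sub22_1
  nat_22_1 := C.nat_22_1
  din_22_1 := C.din_22_1
  sub22_2 := C.sub22_2
  nat_22_2 := C.nat_22_2
  din_22_2 := C.din_22_2
  sub32_1 := C.sub32_1
  nat_32_1 := C.nat_32_1
  din_32_1 := C.din_32_1
  sub32_2 := C.sub32_2
  nat_32_2 := C.nat_32_2
  din_32_2 := C.din_32_2
  sub32_3 := C.sub32_3
  nat_32_3 := C.nat_32_3
  din_32_3 := C.din_32_3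
  sub23_1 := C.sub23_1
  nat_23_1 := C.nat_23_1
  din_23_1 := C.din_23_1
  sub23_2 := C.sub23_2
  nat_23_2 := C.nat_23_2
  din_23_2 := C.din_23_2
  sub20_1 := C.sub20_1
  nat_20_1 := C.nat_20_1
  din_20_1 := C.din_20_1
  sub20_2 := C.sub20_2
  nat_20_2 := C.nat_20_2
  din_20_2 := C.din_20_2
  sub30_1 := C.sub30_1
  nat_30_1 := C.nat_30_1
  din_30_1 := C.din_30_1
  sub30_2 := C.sub30_2
  nat_30_2 := C.nat_30_2
  din_30_2 := C.din_30_2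
  sub30_3 := C.sub30_3
  nat_30_3 := C.nat_30_3
  din_30_3 := C.din_30_3
  subL1_0 f v := C.M0.map f v
  nat_L1_0 h f v := by simp [C.M0.map_comp]
  din_L1_0 k f v := by simp [C.M0.map_comp]
  sub2_L1_1 f g := C.M2.map g (𝟙 _) (𝟙 _) f
  sub2_L1_2 f g := C.M2.map (𝟙 _) g (𝟙 _) f
  nat_2_L1_1 p q h f g := by simp [C.M2.map_comp]
  din_2_L1_1 k f g := by simp [C.M2.map_comp]
  nat_2_L1_2 p q h f g := by simp [C.M2.map_comp]
  din_2_L1_2 k f g := by simp [C.M2.map_comp]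
  subL1_2 f g := C.M2.map (𝟙 _) (𝟙 _) f g
  nat_L1_2 p₁ p₂ h f g := by simp [C.M2.map_comp]
  din_L1_2 k f g := by simp [C.M2.map_comp]
  line_a_11 := C.line_a_11
  line_a_12 := C.line_a_12
  line_a_21 := C.line_a_21
  line_a_22 := C.line_a_22
  line_b_11 := C.line_b_11
  line_b_12 := C.line_b_12
  line_b_21 := C.line_b_21
  line_b_22 := C.line_b_22
  comm_a := C.comm_a
  comm_b := C.comm_b
  comm_c := C.comm_c
  comm_d := C.comm_d
  j_2_L1_1 _ _ := rfl
  j_2_L1_2 _ _ := rfl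
  j_L1_2 _ _ := rfl
  j_L1_0 _ _ := rfl

section

variable {C D : ShortMulticategory.{v, u}} (G : ShortMultifunctor C D)

theorem map_comp3 {a a' c c' : C.Ob} (p : a' ⟶ a) (h : c ⟶ c') (f : a ⟶ c) :
    G.F.map (p ≫ f ≫ h) = G.F.map p ≫ G.F.map f ≫ G.F.map h := by
  rw [G.F.map_comp, G.F.map_comp]

theorem map_pre1 {a a' b c : C.Ob} (f : C.M2.obj a b c) (g : a' ⟶ a) :
    G.M2 (C.M2.map g (𝟙 _) (𝟙 _) f) = D.M2.map (G.F.map g) (𝟙 _) (𝟙 _) (G.M2 f) := by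
  rw [G.nat_M2, G.F.map_id, G.F.map_id]

theorem map_pre2 {a b b' c : C.Ob} (f : C.M2.obj a b c) (g : b' ⟶ b) :
    G.M2 (C.M2.map (𝟙 _) g (𝟙 _) f) = D.M2.map (𝟙 _) (G.F.map g) (𝟙 _) (G.M2 f) := by
  rw [G.nat_M2, G.F.map_id, G.F.map_id]

theorem map_post {a b c c' : C.Ob} (g : c ⟶ c') (f : C.M2.obj a b c) :
    G.M2 (C.M2.map (𝟙 _) (𝟙 _) g f) = D.M2.map (𝟙 _) (𝟙 _) (G.F.map g) (G.M2 f) := by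
  rw [G.nat_M2, G.F.map_id, G.F.map_id]

end

/-- The inclusion of short multicategories into short skew multicategories. -/
def inclusion : ShortMulticategory.{v, u} ⥤ ShortSkewMulticategory.{v, u} where
  obj C := C.toSkew
  map {C D} G :=
    { F := G.F, T2 := G.M2, T3 := G.M3, T4 := G.M4, L0 := G.M0, L1 := fun f => G.F.map f, L2 := G.M2
      nat_T2 := G.nat_M2, nat_T3 := G.nat_M3, nat_T4 := G.nat_M4, nat_L0 := G.nat_M0
      nat_L1 := map_comp3 G
      nat_L2 := G.nat_M2
      map_j1 := fun _ => rfl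
      map_j2 := fun _ => rfl
      map_22_1 := G.map_22_1
      map_22_2 := G.map_22_2
      map_32_1 := G.map_32_1
      map_32_2 := G.map_32_2
      map_32_3 := G.map_32_3
      map_23_1 := G.map_23_1
      map_23_2 := G.map_23_2
      map_20_1 := G.map_20_1
      map_20_2 := G.map_20_2
      map_30_1 := G.map_30_1
      map_30_2 := G.map_30_2
      map_30_3 := G.map_30_3
      map_L1_0 := fun f v => G.nat_M0 f v
      map_2_L1_1 := map_pre1 G
      map_2_L1_2 := map_pre2 G
      map_L1_2 := map_post G }
  map_id _ := rfl
  map_comp _ _ := rfl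

end ShortMulticategory

/-! ### Multicategories -/

/-- A multicategory; `sub l r _ _ f g` is the substitution `f ∘ᵢ g` of `g : Δ → b` in
`f : l, b, r → c`, where `i = |l| + 1`. As for skew multicategories, domains are variables constrained
by equations. -/
structure Multicategory where
  Ob : Type u
  Hom : List Ob → Ob → Type v
  id (a : Ob) : Hom [a] a
  sub {Γ Δ Θ : List Ob} {b c : Ob} (l r : List Ob) (hΓ : Γ = l ++ b :: r)
    (hΘ : Θ = l ++ Δ ++ r) : Hom Γ c → Hom Δ b → Hom Θ c
  id_sub {Γ : List Ob} {b : Ob} (f : Hom Γ b) (hΓ : Γ = [] ++ Γ ++ []) :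
    sub [] [] rfl hΓ (id b) f = f
  sub_id {Γ : List Ob} {b c : Ob} (l r : List Ob) (hΓ : Γ = l ++ b :: r)
    (hΓ' : Γ = l ++ [b] ++ r) (f : Hom Γ c) : sub l r hΓ hΓ' f (id b) = f
  -- `f ∘ᵢ (g ∘ⱼ h) = (f ∘ᵢ g) ∘ᵢ₊ⱼ₋₁ h`
  assoc {Γ Δ Λ ΓΔ ΔΛ Θ : List Ob} {b c d : Ob} {l r l' r' : List Ob}
    {f : Hom Γ d} {g : Hom Δ c} {h : Hom Λ b}
    {h₁ : Γ = l ++ c :: r} {h₂ : Δ = l' ++ b :: r'} {h₃ : ΔΛ = l' ++ Λ ++ r'}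
    {h₄ : Θ = l ++ ΔΛ ++ r} {h₅ : ΓΔ = l ++ Δ ++ r} {h₆ : ΓΔ = (l ++ l') ++ b :: (r' ++ r)}
    {h₇ : Θ = (l ++ l') ++ Λ ++ (r' ++ r)} :
    sub l r h₁ h₄ f (sub l' r' h₂ h₃ g h) =
      sub (l ++ l') (r' ++ r) h₆ h₇ (sub l r h₁ h₅ f g) h
  -- `(f ∘ᵢ g) ∘ₙ₊ⱼ₋₁ h = (f ∘ⱼ h) ∘ᵢ g` for `i < j` and `g` of arity `n`
  comm {Γ Δ Λ ΓΔ ΓΛ Θ : List Ob} {b c d : Ob} {l m r : List Ob}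
    {f : Hom Γ d} {g : Hom Δ b} {h : Hom Λ c}
    {h₁ : Γ = l ++ b :: (m ++ c :: r)} {h₂ : ΓΔ = l ++ Δ ++ (m ++ c :: r)}
    {h₃ : ΓΔ = (l ++ Δ ++ m) ++ c :: r} {h₄ : Θ = (l ++ Δ ++ m) ++ Λ ++ r}
    {h₅ : Γ = (l ++ b :: m) ++ c :: r} {h₆ : ΓΛ = (l ++ b :: m) ++ Λ ++ r}
    {h₇ : ΓΛ = l ++ b :: (m ++ Λ ++ r)} {h₈ : Θ = l ++ Δ ++ (m ++ Λ ++ r)} :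
    sub (l ++ Δ ++ m) r h₃ h₄ (sub l (m ++ c :: r) h₁ h₂ f g) h =
      sub l (m ++ Λ ++ r) h₇ h₈ (sub (l ++ b :: m) r h₅ h₆ f h) g

/-- A multifunctor. -/
structure Multifunctor (M N : Multicategory.{v, u}) where
  obj : M.Ob → N.Ob
  map {Γ : List M.Ob} {Γ' : List N.Ob} {b : M.Ob} (h : Γ' = Γ.map obj) :
    M.Hom Γ b → N.Hom Γ' (obj b)
  map_id (a : M.Ob) : map rfl (M.id a) = N.id (obj a)
  map_sub {Γ Δ Θ : List M.Ob} {Γ' Δ' Θ' : List N.Ob} {b c : M.Ob}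
    {l r : List M.Ob} {f : M.Hom Γ c} {g : M.Hom Δ b}
    {hΓ : Γ = l ++ b :: r} {hΘ : Θ = l ++ Δ ++ r}
    {h₁ : Γ' = Γ.map obj} {h₂ : Δ' = Δ.map obj} {h₃ : Θ' = Θ.map obj}
    {h₄ : Γ' = l.map obj ++ obj b :: r.map obj} {h₅ : Θ' = l.map obj ++ Δ' ++ r.map obj} :
    map h₃ (M.sub l r hΓ hΘ f g) = N.sub (l.map obj) (r.map obj) h₄ h₅ (map h₁ f) (map h₂ g)

theorem Multifunctor.ext' {M N : Multicategory.{v, u}} {F G : Multifunctor M N}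
    (h₀ : F.obj = G.obj)
    (h₁ : ∀ {Γ : List M.Ob} {Γ' : List N.Ob} {b : M.Ob} (h : Γ' = Γ.map F.obj)
      (h' : Γ' = Γ.map G.obj) (f : M.Hom Γ b),
      cast (congrArg (fun o => N.Hom Γ' (o b)) h₀) (F.map h f) = G.map h' f) : F = G := by
  cases F with
  | mk Fo Fm _ _ =>
    cases G with
    | mk Go Gm _ _ =>
      dsimp only at h₀
      subst h₀
      have : @Fm = @Gm := by
        funext Γ Γ' b h f
        exact h₁ h h f
      cases this
      rfl

theorem Multifunctor.map_cast {M N : Multicategory.{v, u}} (F : Multifunctor M N)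
    {Γ Γ₁ : List M.Ob} {Γ' : List N.Ob} {b : M.Ob} (e : Γ = Γ₁)
    (h : Γ' = Γ₁.map F.obj) (h' : Γ' = Γ.map F.obj) (f : M.Hom Γ b) :
    F.map h (cast (congrArg (M.Hom · b) e) f) = F.map h' f := by
  subst e
  rfl

theorem Multifunctor.map_map_congr {M N P : Multicategory.{v, u}}
    (F : Multifunctor M N) (G : Multifunctor N P)
    {Γ : List M.Ob} {Δ₁ Δ₂ : List N.Ob} {Θ : List P.Ob} {b : M.Ob}
    (h₁ : Δ₁ = Γ.map F.obj) (h₂ : Δ₂ = Γ.map F.obj) (k₁ : Θ = Δ₁.map G.obj)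
    (k₂ : Θ = Δ₂.map G.obj) (f : M.Hom Γ b) :
    G.map k₁ (F.map h₁ f) = G.map k₂ (F.map h₂ f) := by
  subst h₁ h₂
  rfl

/-- The category of multicategories. -/
instance : Category Multicategory.{v, u} where
  Hom M N := Multifunctor M N
  id M :=
    { obj := fun a => a
      map := fun {_ _ b} h f => cast (congrArg (M.Hom · b) (h.trans (List.map_id' _)).symm) f
      map_id := fun _ => rfl
      map_sub := by
        intro Γ Δ Θ Γ' Δ' Θ' b c l r f g hΓ hΘ h₁ h₂ h₃ h₄ h₅
        have e₁ := h₁.trans (List.map_id' _)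
        have e₂ := h₂.trans (List.map_id' _)
        have e₃ := h₃.trans (List.map_id' _)
        subst e₁ e₂ e₃
        simp only [cast_eq]
        congr 1 <;> simp }
  comp {M N P} F G :=
    { obj := fun a => G.obj (F.obj a)
      map := fun {_ _ _} h f =>
        G.map (h.trans (List.map_map (f := F.obj) (g := G.obj)).symm) (F.map rfl f)
      map_id := fun a => by rw [F.map_id]; exact G.map_id _
      map_sub := by
        intro Γ Δ Θ Γ' Δ' Θ' b c l r f g hΓ hΘ h₁ h₂ h₃ h₄ h₅
        have e₁ : (l.map F.obj).map G.obj = l.map fun a => G.obj (F.obj a) := List.map_map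
        have e₂ : (r.map F.obj).map G.obj = r.map fun a => G.obj (F.obj a) := List.map_map
        rw [F.map_sub (h₁ := rfl) (h₂ := rfl) (h₄ := by simp [hΓ]) (h₅ := by simp [hΘ]),
          G.map_sub (h₁ := h₁.trans List.map_map.symm) (h₂ := h₂.trans List.map_map.symm)
            (h₄ := by rw [e₁, e₂]; exact h₄) (h₅ := by rw [e₁, e₂]; exact h₅)]
        congr 1 }
  id_comp F := by
    refine Multifunctor.ext' rfl ?_
    intro Γ Γ' b h h' f
    exact F.map_cast (List.map_id' Γ).symm _ h' f
  comp_id F := by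
    refine Multifunctor.ext' rfl ?_
    intro Γ Γ' b h h' f
    subst h'
    rfl
  assoc F G H := by
    refine Multifunctor.ext' rfl ?_
    intro Γ Γ' b h h' f
    exact Multifunctor.map_map_congr G H _ rfl _ _ (F.map rfl f)

namespace Multicategory

variable (M : Multicategory.{v, u})

/-- All multimaps are loose, and those of positive arity are also tight. -/
def SkewHom : Tightness → List M.Ob → M.Ob → Type v
  | .t, [], _ => PEmpty
  | .t, a :: as, b => M.Hom (a :: as) b
  | .l, Γ, b => M.Hom Γ b

variable {M}

/-- The multimap underlying a tight or loose map. -/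
def SkewHom.toHom : {x : Tightness} → {Γ : List M.Ob} → {b : M.Ob} → M.SkewHom x Γ b → M.Hom Γ b
  | .t, [], _, f => nomatch (show PEmpty from f)
  | .t, _ :: _, _, f => f
  | .l, _, _, f => f

/-- A multimap as a tight or loose map. -/
def SkewHom.ofHom : (x : Tightness) → {Γ : List M.Ob} → {b : M.Ob} → (x = .t → Γ ≠ []) →
    M.Hom Γ b → M.SkewHom x Γ b
  | .t, [], _, h, _ => (h rfl rfl).elim
  | .t, _ :: _, _, _, f => f
  | .l, _, _, _, f => f

theorem SkewHom.ne_nil {x : Tightness} {Γ : List M.Ob} {b : M.Ob} (f : M.SkewHom x Γ b)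
    (hx : x = .t) : Γ ≠ [] := by
  subst hx
  rintro rfl
  exact (show PEmpty from f).elim

@[simp]
theorem SkewHom.toHom_ofHom {x : Tightness} {Γ : List M.Ob} {b : M.Ob} (h : x = .t → Γ ≠ [])
    (f : M.Hom Γ b) : (SkewHom.ofHom x h f).toHom = f := by
  cases x with
  | t => cases Γ with
    | nil => exact (h rfl rfl).elim
    | cons => rfl
  | l => rfl

@[simp]
theorem SkewHom.ofHom_toHom {x : Tightness} {Γ : List M.Ob} {b : M.Ob} (h : x = .t → Γ ≠ [])
    (f : M.SkewHom x Γ b) : SkewHom.ofHom x h f.toHom = f := by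
  cases x with
  | t => cases Γ with
    | nil => exact (h rfl rfl).elim
    | cons => rfl
  | l => rfl

theorem SkewHom.sub_ne_nil {x y z : Tightness} {Γ Δ Θ : List M.Ob} {b c : M.Ob} {l r : List M.Ob}
    (hΘ : Θ = l ++ Δ ++ r) (hz : z = x.comp y (l.length + 1)) (f : M.SkewHom x Γ c)
    (g : M.SkewHom y Δ b) (h : z = .t) : Θ ≠ [] := by
  subst hΘ h
  cases l with
  | cons => simp
  | nil =>
    cases x with
    | l => cases hz
    | t => cases y with
      | l => cases hz
      | t => simp [g.ne_nil rfl]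

/-- A multicategory as a skew multicategory in which all multimaps of positive arity are both tight
and loose. -/
def toSkew (M : Multicategory.{v, u}) : SkewMulticategory.{v, u} where
  Ob := M.Ob
  Hom := M.SkewHom
  tight_nil _ := inferInstanceAs (IsEmpty PEmpty)
  id a := M.id a
  sub {_ _ z _ _ _ _ _} l r hΓ hΘ hz f g :=
    SkewHom.ofHom z (SkewHom.sub_ne_nil hΘ hz f g) (M.sub l r hΓ hΘ f.toHom g.toHom)
  j f := SkewHom.ofHom .l (by simp) f.toHom
  id_sub f hΓ hx := by
    rw [← SkewHom.ofHom_toHom f.ne_nil f]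
    congr 1
    rw [SkewHom.toHom_ofHom]
    exact M.id_sub _ _
  sub_id l r hΓ hΓ' hx f := by
    rw [← SkewHom.ofHom_toHom f.ne_nil f]
    congr 1
    rw [SkewHom.toHom_ofHom]
    exact M.sub_id l r _ _ _
  assoc := by
    intros
    simp only [SkewHom.toHom_ofHom]
    congr 1
    exact M.assoc
  comm := by
    intros
    simp only [SkewHom.toHom_ofHom]
    congr 1
    exact M.comm
  j_sub_left := by
    intros
    simp only [SkewHom.toHom_ofHom]
  sub_left := by
    intros
    simp only [SkewHom.toHom_ofHom]
  j_sub_right := by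
    intros
    simp only [SkewHom.toHom_ofHom]
  sub_right := by
    intros
    simp only [SkewHom.toHom_ofHom]

theorem map_ne_nil {M N : Multicategory.{v, u}} {obj : M.Ob → N.Ob} {x : Tightness}
    {Γ : List M.Ob} {Γ' : List N.Ob} {b : M.Ob} (h : Γ' = Γ.map obj) (f : M.SkewHom x Γ b)
    (hx : x = .t) : Γ' ≠ [] := by
  have := f.ne_nil hx
  simp [h, this]

/-- The inclusion of multicategories into skew multicategories. -/
def inclusion : Multicategory.{v, u} ⥤ SkewMulticategory.{v, u} where
  obj M := M.toSkew
  map {M N} F :=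
    { obj := F.obj
      map := fun {x _ _ _} h f => SkewHom.ofHom x (map_ne_nil h f) (F.map h f.toHom)
      map_id := F.map_id
      map_sub := by
        intro x y z Γ Δ Θ Γ' Δ' Θ' b c l r f g hΓ hΘ hz h₁ h₂ h₃ h₄ h₅ h₆
        refine congrArg (SkewHom.ofHom _ _) ?_
        refine (congrArg (F.map _) (SkewHom.toHom_ofHom _ _)).trans ?_
        refine (F.map_sub (h₁ := h₁) (h₂ := h₂) (h₄ := h₄) (h₅ := h₅)).trans ?_
        exact congr (congrArg (N.sub _ _ _ _) (SkewHom.toHom_ofHom _ _).symm)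
          (SkewHom.toHom_ofHom _ _).symm
      map_j := by
        intros
        refine congrArg (SkewHom.ofHom _ _) ?_
        exact (SkewHom.toHom_ofHom _ _).symm }
  map_id M := by
    refine SkewMultifunctor.ext' rfl ?_
    intro x Γ Γ' b h h' f
    have e := h.trans (List.map_id' _)
    subst e
    exact SkewHom.ofHom_toHom _ f
  map_comp {M N P} F G := by
    refine SkewMultifunctor.ext' rfl ?_
    intro x Γ Γ' b h h' f
    refine congrArg (SkewHom.ofHom x _) (congrArg (G.map _) ?_)
    exact (SkewHom.toHom_ofHom _ _).symm

/-- The underlying category of a multicategory: morphisms are the unary maps. -/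
instance (M : Multicategory.{v, u}) : Category.{v} M.Ob :=
  inferInstanceAs (Category.{v} M.toSkew.Ob)

/-- The short multicategory consisting of the multimaps of arity at most four. -/
def toShort (M : Multicategory.{v, u}) : ShortMulticategory.{v, u} where
  Ob := M.Ob
  M0 := M.toSkew.fam0 .l
  M2 := M.toSkew.fam2 .t
  M3 := M.toSkew.fam3 .t
  M4 := M.toSkew.fam4 .t
  sub22_1 {_ b₂ _ _ _} f g := M.sub [] [b₂] rfl rfl f g
  nat_22_1 := M.toSkew.toShort.nat_22_1
  din_22_1 := M.toSkew.toShort.din_22_1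
  sub22_2 {b₁ _ _ _ _} f g := M.sub [b₁] [] rfl rfl f g
  nat_22_2 := M.toSkew.toShort.nat_22_2
  din_22_2 := M.toSkew.toShort.din_22_2
  sub32_1 {_ b₂ b₃ _ _ _} f g := M.sub [] [b₂, b₃] rfl rfl f g
  nat_32_1 := M.toSkew.toShort.nat_32_1
  din_32_1 := M.toSkew.toShort.din_32_1
  sub32_2 {b₁ _ b₃ _ _ _} f g := M.sub [b₁] [b₃] rfl rfl f g
  nat_32_2 := M.toSkew.toShort.nat_32_2
  din_32_2 := M.toSkew.toShort.din_32_2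
  sub32_3 {b₁ b₂ _ _ _ _} f g := M.sub [b₁, b₂] [] rfl rfl f g
  nat_32_3 := M.toSkew.toShort.nat_32_3
  din_32_3 := M.toSkew.toShort.din_32_3
  sub23_1 {_ b₂ _ _ _ _} f g := M.sub [] [b₂] rfl rfl f g
  nat_23_1 := M.toSkew.toShort.nat_23_1
  din_23_1 := M.toSkew.toShort.din_23_1
  sub23_2 {b₁ _ _ _ _ _} f g := M.sub [b₁] [] rfl rfl f g
  nat_23_2 := M.toSkew.toShort.nat_23_2
  din_23_2 := M.toSkew.toShort.din_23_2
  sub20_1 {_ b₂ _} f g := M.sub [] [b₂] rfl rfl f g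
  nat_20_1 := M.toSkew.toShort.nat_20_1
  din_20_1 := M.toSkew.toShort.din_20_1
  sub20_2 {b₁ _ _} f g := M.sub [b₁] [] rfl rfl f g
  nat_20_2 := M.toSkew.toShort.nat_20_2
  din_20_2 := M.toSkew.toShort.din_20_2
  sub30_1 {_ b₂ b₃ _} f g := M.sub [] [b₂, b₃] rfl rfl f g
  nat_30_1 := M.toSkew.toShort.nat_30_1
  din_30_1 := M.toSkew.toShort.din_30_1
  sub30_2 {b₁ _ b₃ _} f g := M.sub [b₁] [b₃] rfl rfl f g
  nat_30_2 := M.toSkew.toShort.nat_30_2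
  din_30_2 := M.toSkew.toShort.din_30_2
  sub30_3 {b₁ b₂ _ _} f g := M.sub [b₁, b₂] [] rfl rfl f g
  nat_30_3 := M.toSkew.toShort.nat_30_3
  din_30_3 := M.toSkew.toShort.din_30_3
  line_a_11 := M.toSkew.toShort.line_a_11
  line_a_12 := M.toSkew.toShort.line_a_12
  line_a_21 := M.toSkew.toShort.line_a_21
  line_a_22 := M.toSkew.toShort.line_a_22
  line_b_11 f g h := (M.toSkew.toShort.j_2_L1_1 _ _).symm.trans (M.toSkew.toShort.line_b_11 f g h)
  line_b_12 := M.toSkew.toShort.line_b_12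
  line_b_21 f g h := (M.toSkew.toShort.j_2_L1_2 _ _).symm.trans (M.toSkew.toShort.line_b_21 f g h)
  line_b_22 := M.toSkew.toShort.line_b_22
  comm_a := M.toSkew.toShort.comm_a
  comm_b := M.toSkew.toShort.comm_b
  comm_c f g h := (M.toSkew.toShort.j_L1_2 _ _).symm.trans (M.toSkew.toShort.comm_c f g h)
  comm_d f g h := (M.toSkew.toShort.j_L1_0 _ _).symm.trans (M.toSkew.toShort.comm_d f g h)

/-- The forgetful functor from multicategories to short multicategories. -/
def forgetShort : Multicategory.{v, u} ⥤ ShortMulticategory.{v, u} where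
  obj M := M.toShort
  map F :=
    { F := (SkewMulticategory.toShortMap (inclusion.map F)).F
      M0 := fun f => F.map rfl f
      M2 := fun f => F.map rfl f
      M3 := fun f => F.map rfl f
      M4 := fun f => F.map rfl f
      nat_M0 := (SkewMulticategory.toShortMap (inclusion.map F)).nat_L0
      nat_M2 := (SkewMulticategory.toShortMap (inclusion.map F)).nat_T2
      nat_M3 := (SkewMulticategory.toShortMap (inclusion.map F)).nat_T3
      nat_M4 := (SkewMulticategory.toShortMap (inclusion.map F)).nat_T4
      map_22_1 := (SkewMulticategory.toShortMap (inclusion.map F)).map_22_1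
      map_22_2 := (SkewMulticategory.toShortMap (inclusion.map F)).map_22_2
      map_32_1 := (SkewMulticategory.toShortMap (inclusion.map F)).map_32_1
      map_32_2 := (SkewMulticategory.toShortMap (inclusion.map F)).map_32_2
      map_32_3 := (SkewMulticategory.toShortMap (inclusion.map F)).map_32_3
      map_23_1 := (SkewMulticategory.toShortMap (inclusion.map F)).map_23_1
      map_23_2 := (SkewMulticategory.toShortMap (inclusion.map F)).map_23_2
      map_20_1 := (SkewMulticategory.toShortMap (inclusion.map F)).map_20_1
      map_20_2 := (SkewMulticategory.toShortMap (inclusion.map F)).map_20_2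
      map_30_1 := (SkewMulticategory.toShortMap (inclusion.map F)).map_30_1
      map_30_2 := (SkewMulticategory.toShortMap (inclusion.map F)).map_30_2
      map_30_3 := (SkewMulticategory.toShortMap (inclusion.map F)).map_30_3 }
  map_id _ := rfl
  map_comp _ _ := rfl

end Multicategory

/-! ### Closed multicategories, closed short multicategories and closed categories -/

namespace ShortMulticategory

/-- `e : h, b → c` exhibits `h` as an internal hom `[b, c]`: all the functions `e ∘₁ -` are
bijective. -/
def IsInternalHom (C : ShortMulticategory.{v, u}) {h b c : C.Ob} (e : C.M2.obj h b c) : Prop :=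
  (Function.Bijective fun v : C.M0.obj h => C.sub20_1 e v) ∧
  (∀ x : C.Ob, Function.Bijective fun f : x ⟶ h => C.M2.map f (𝟙 b) (𝟙 c) e) ∧
  (∀ x y : C.Ob, Function.Bijective fun f : C.M2.obj x y h => C.sub22_1 e f) ∧
  (∀ x y z : C.Ob, Function.Bijective fun f : C.M3.obj x y z h => C.sub23_1 e f)

/-- A short multicategory is closed if it has all internal homs `[b, c]`. -/
def IsClosed (C : ShortMulticategory.{v, u}) : Prop :=
  ∀ b c : C.Ob, ∃ (h : C.Ob) (e : C.M2.obj h b c), C.IsInternalHom e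

/-- `u` is a unit: for every `x` there is an internal hom `e : [i, x], i → x` such that
`e ∘₂ u : [i, x] ⟶ x` is invertible. -/
def IsUnit (C : ShortMulticategory.{v, u}) {i : C.Ob} (u : C.M0.obj i) : Prop :=
  ∀ x : C.Ob, ∃ (h : C.Ob) (e : C.M2.obj h i x), C.IsInternalHom e ∧ IsIso (C.sub20_2 e u)

/-- Closed, with a unit. -/
def closedWithUnit : ObjectProperty ShortMulticategory.{v, u} :=
  fun C => C.IsClosed ∧ ∃ (i : C.Ob) (u : C.M0.obj i), C.IsUnit u

end ShortMulticategory

/-- Closed short multicategories with units; a full subcategory of the category of short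
multicategories. -/
abbrev ClosedShortMulti : Type (max (u + 1) (v + 1)) :=
  ShortMulticategory.closedWithUnit.{v, u}.FullSubcategory

namespace Multicategory

/-- `e : h, b → c` exhibits `h` as an internal hom `[b, c]`: all the functions `e ∘₁ -` are
bijective. -/
def IsInternalHom (M : Multicategory.{v, u}) {h b c : M.Ob} (e : M.Hom [h, b] c) : Prop :=
  ∀ Γ : List M.Ob, Function.Bijective fun f : M.Hom Γ h =>
    M.sub [] [b] rfl (rfl : Γ ++ [b] = [] ++ Γ ++ [b]) e f

/-- A multicategory is closed if it has all internal homs `[b, c]`. -/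
def IsClosed (M : Multicategory.{v, u}) : Prop :=
  ∀ b c : M.Ob, ∃ (h : M.Ob) (e : M.Hom [h, b] c), M.IsInternalHom e

/-- `u` is a unit: for every `x` there is an internal hom `e : [i, x], i → x` such that
`e ∘₂ u : [i, x] ⟶ x` is invertible. -/
def IsUnit (M : Multicategory.{v, u}) {i : M.Ob} (u : M.Hom [] i) : Prop :=
  ∀ x : M.Ob, ∃ (h : M.Ob) (e : M.Hom [h, i] x), M.IsInternalHom e ∧
    IsIso (show h ⟶ x from M.sub [h] [] rfl rfl e u)

/-- Closed, with a unit. -/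
def closedWithUnit : ObjectProperty Multicategory.{v, u} :=
  fun M => M.IsClosed ∧ ∃ (i : M.Ob) (u : M.Hom [] i), M.IsUnit u

theorem IsInternalHom.toShort {M : Multicategory.{v, u}} {h b c : M.Ob} {e : M.Hom [h, b] c}
    (he : M.IsInternalHom e) : M.toShort.IsInternalHom (h := h) (b := b) (c := c) e := by
  refine ⟨he [], fun x => ?_, fun x y => he [x, y], fun x y z => he [x, y, z]⟩
  have e₁ : (fun f : M.Hom [x] h => (M.toSkew.fam2 .t).map f (M.id b) (M.id c) e) =
      fun f => M.sub [] [b] rfl rfl e f :=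
    funext fun f => (M.toSkew.toShort.j_2_L1_1 e f).symm
  exact e₁ ▸ he [x]

end Multicategory

/-- Closed multicategories with units; a full subcategory of the category of multicategories. -/
abbrev ClosedMulti : Type (max (u + 1) (v + 1)) :=
  Multicategory.closedWithUnit.{v, u}.FullSubcategory

/-- The forgetful functor from closed multicategories with units to closed short multicategories
with units. -/
def multiU : ClosedMulti.{v, u} ⥤ ClosedShortMulti.{v, u} :=
  ShortMulticategory.closedWithUnit.lift
    (Multicategory.closedWithUnit.ι ⋙ Multicategory.forgetShort) fun M =>
    ⟨fun b c => (M.property.1 b c).imp fun _ h => h.imp fun _ he => he.toShort,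
      M.property.2.imp fun _ h => h.imp fun _ hu x => (hu x).imp fun _ h => h.imp fun _ he =>
        ⟨he.1.toShort, he.2⟩⟩

/-- A skew closed category is a closed category if `I : [i, a] ⟶ a` is invertible and
`f ↦ [1, f] ∘ J` is a bijection from maps `a ⟶ b` to maps `i ⟶ [a, b]`. -/
def SkewClosedCategory.isClosedCategory : ObjectProperty SkewClosedCategory.{v, u} :=
  fun V => (∀ a : V.Ob, IsIso (V.I a)) ∧
    ∀ a b : V.Ob, Function.Bijective fun f : a ⟶ b => V.J a ≫ V.homMap (𝟙 a) f

/-- Closed categories and closed functors. -/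
abbrev ClosedCategory : Type (max (u + 1) (v + 1)) :=
  SkewClosedCategory.isClosedCategory.{v, u}.FullSubcategory

namespace ShortMulticategory

variable {C : ShortMulticategory.{v, u}}

theorem IsInternalHom.toSkew {h b c : C.Ob} {e : C.M2.obj h b c} (he : C.IsInternalHom e) :
    C.toSkew.IsInternalHom (h := h) (b := b) (c := c) e :=
  ⟨he.2.1, he.2.2.1, he.2.2.2, he.1, he.2.1⟩

theorem isIso_of_bijective {x y : C.Ob} (s : x ⟶ y)
    (h : ∀ z : C.Ob, Function.Bijective fun f : z ⟶ x => f ≫ s) : IsIso s := by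
  obtain ⟨t, ht⟩ := (h y).2 (𝟙 y)
  refine ⟨t, (h x).1 ?_, ht⟩
  simp only [Category.assoc] at ht ⊢
  rw [ht]; simp

theorem comp_sub20_2 {h i a z : C.Ob} (e : C.M2.obj h i a) (u : C.M0.obj i) (f : z ⟶ h) :
    f ≫ C.sub20_2 e u = C.sub20_2 (C.M2.map f (𝟙 i) (𝟙 a) e) u := by
  rw [C.nat_20_2, Category.comp_id]

/-- `e ∘₂ u` is invertible if and only if `- ∘₂ u` is bijective on binary maps. -/
theorem IsInternalHom.isIso_iff {h i a : C.Ob} {e : C.M2.obj h i a} (he : C.IsInternalHom e)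
    (u : C.M0.obj i) : IsIso (C.sub20_2 e u) ↔
      ∀ z : C.Ob, Function.Bijective fun g : C.M2.obj z i a => C.sub20_2 g u := by
  have key : ∀ z : C.Ob, (fun f : z ⟶ h => f ≫ C.sub20_2 e u) =
      (fun g : C.M2.obj z i a => C.sub20_2 g u) ∘ fun f : z ⟶ h => C.M2.map f (𝟙 i) (𝟙 a) e :=
    fun z => funext fun f => comp_sub20_2 e u f
  constructor
  · intro hs z
    refine (Function.Bijective.of_comp_iff _ (he.2.1 z)).1 ?_
    rw [← key]
    exact ⟨fun f g hfg => (cancel_mono _).1 hfg, fun f => ⟨f ≫ inv (C.sub20_2 e u), by simp⟩⟩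
  · intro hb
    refine isIso_of_bijective _ fun z => ?_
    rw [key]
    exact (hb z).comp (he.2.1 z)

/-- A unit is a nullary map classifier. -/
theorem IsUnit.isNullaryClassifier {i : C.Ob} {u : C.M0.obj i} (hu : C.IsUnit u) :
    C.toSkew.IsNullaryClassifier (i := i) u := by
  intro (a : C.Ob)
  obtain ⟨h, e, he, hs⟩ := hu a
  refine (Function.Bijective.of_comp_iff _ he.1).1 ?_
  have key : ((fun f : i ⟶ a => C.M0.map f u) ∘ fun v : C.M0.obj h => C.sub20_1 e v) =
      fun v => C.M0.map (C.sub20_2 e u) v := funext fun v => C.comm_d e v u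
  refine (congrArg Function.Bijective key).mpr ⟨fun v w hvw => ?_, fun v => ?_⟩
  · have := congrArg (C.M0.map (inv (C.sub20_2 e u))) hvw
    simpa [C.M0.map_comp, C.M0.map_id] using this
  · exact ⟨C.M0.map (inv (C.sub20_2 e u)) v, by simp [C.M0.map_comp, C.M0.map_id]⟩

theorem toSkew_closedWithUnit (hC : closedWithUnit C) :
    ShortSkewMulticategory.closedWithUnit C.toSkew :=
  ⟨fun b c => (hC.1 b c).imp fun _ h => h.imp fun _ he => he.toSkew,
    hC.2.imp fun _ h => h.imp fun _ hu => hu.isNullaryClassifier⟩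

theorem isIso_sub20_2 (hC : closedWithUnit C) {i' h' a : C.Ob} {u' : C.M0.obj i'}
    (hu' : ∀ b : C.Ob, Function.Bijective fun f : i' ⟶ b => C.M0.map f u')
    {e' : C.M2.obj h' i' a} (he : C.IsInternalHom e') : IsIso (C.sub20_2 e' u') := by
  obtain ⟨i, u, hu⟩ := hC.2
  obtain ⟨h, e, he', hs⟩ := hu a
  have hu₁ : ∀ b : C.Ob, Function.Bijective fun f : i ⟶ b => C.M0.map f u :=
    hu.isNullaryClassifier
  obtain ⟨k, hk⟩ := (hu₁ i').2 u'
  obtain ⟨k', hk'⟩ := (hu' i).2 u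
  dsimp only at hk hk'
  have h₁ : k ≫ k' = 𝟙 i := (hu₁ i).1 <| by
    dsimp only
    rw [← C.M0.map_comp, hk, hk', C.M0.map_id]
  have h₂ : k' ≫ k = 𝟙 i' := (hu' i').1 <| by
    dsimp only
    rw [← C.M0.map_comp, hk', hk, C.M0.map_id]
  refine (he.isIso_iff u').2 fun z => ?_
  have key : (fun g : C.M2.obj z i' a => C.sub20_2 g u') =
      (fun g : C.M2.obj z i a => C.sub20_2 g u) ∘
        fun g : C.M2.obj z i' a => C.M2.map (𝟙 z) k (𝟙 a) g := by
    funext g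
    rw [Function.comp_apply, C.din_20_2, hk]
  rw [key]
  refine ((he'.isIso_iff u).1 hs z).comp
    (Function.bijective_iff_has_inverse.2 ⟨fun g => C.M2.map (𝟙 z) k' (𝟙 a) g, fun g => ?_,
      fun g => ?_⟩)
  · dsimp only
    rw [C.M2.map_comp, h₂]; simp [C.M2.map_id]
  · dsimp only
    rw [C.M2.map_comp, h₁]; simp [C.M2.map_id]

theorem isIso_I (hC : closedWithUnit C) (d : C.toSkew.ClosedData) (a : C.Ob) :
    @IsIso C.Ob C.cat (d.hom d.i a) a (d.I a) :=
  isIso_sub20_2 hC (u' := d.u) d.hu (e' := d.e d.i a)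
    ⟨(d.he d.i a).2.2.2.1, (d.he d.i a).1, (d.he d.i a).2.1, (d.he d.i a).2.2.1⟩

theorem bijective_J (d : C.toSkew.ClosedData) (a b : C.Ob) :
    Function.Bijective fun f : a ⟶ b => (d.J a ≫ d.homMap (𝟙 a) f : d.i ⟶ d.hom a b) := by
  have hψ : Function.Bijective fun k : d.i ⟶ d.hom a b =>
      C.sub20_1 (C.M2.map k (𝟙 a) (𝟙 b) (d.e a b)) d.u := by
    have key : (fun k : d.i ⟶ d.hom a b => C.sub20_1 (C.M2.map k (𝟙 a) (𝟙 b) (d.e a b)) d.u) =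
        (fun v => C.sub20_1 (d.e a b) v) ∘ fun k : d.i ⟶ d.hom a b => C.M0.map k d.u :=
      funext fun k => C.din_20_1 k (d.e a b) d.u
    exact (congrArg Function.Bijective key).mpr ((d.he a b).2.2.2.1.comp (d.hu _))
  refine (Function.Bijective.of_comp_iff' hψ _).1 ?_
  have key : ((fun k : d.i ⟶ d.hom a b => C.sub20_1 (C.M2.map k (𝟙 a) (𝟙 b) (d.e a b)) d.u) ∘
      fun f : a ⟶ b => (d.J a ≫ d.homMap (𝟙 a) f : d.i ⟶ d.hom a b)) = fun f : a ⟶ b => f :=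
    funext fun f => (d.J_homMap (𝟙 a) f).trans (Category.id_comp (X := (a : C.Ob)) f)
  exact (congrArg Function.Bijective key).mpr Function.bijective_id

end ShortMulticategory

/-- The inclusion of closed short multicategories with units into closed short skew multicategories
with a nullary map classifier. -/
def closedShortInclusion : ClosedShortMulti.{v, u} ⥤ ClosedShortSkewMulti.{v, u} :=
  ShortSkewMulticategory.closedWithUnit.lift
    (ShortMulticategory.closedWithUnit.ι ⋙ ShortMulticategory.inclusion) fun C =>
    ShortMulticategory.toSkew_closedWithUnit C.property

/-- The restriction of `skewK` to a functor from closed short multicategories with units to closed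
categories. -/
noncomputable def multiK : ClosedShortMulti.{v, u} ⥤ ClosedCategory.{v, u} :=
  SkewClosedCategory.isClosedCategory.lift (closedShortInclusion ⋙ skewK) fun C =>
    ⟨ShortMulticategory.isIso_I C.property
      (ShortSkewMulticategory.closedData (closedShortInclusion.obj C)),
    ShortMulticategory.bijective_J
      (ShortSkewMulticategory.closedData (closedShortInclusion.obj C))⟩

namespace Multicategory

variable {M : Multicategory.{v, u}}

theorem IsInternalHom.toSkew {h b c : M.Ob} {e : M.Hom [h, b] c} (he : M.IsInternalHom e) :
    M.toSkew.IsInternalHom (h := h) (b := b) (c := c) e := by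
  intro x (Γ : List M.Ob) hx
  have hΓ : x = .t → Γ ++ [b] ≠ [] := by simp
  refine Function.bijective_iff_has_inverse.2 ⟨fun g : M.SkewHom x (Γ ++ [b]) c =>
    SkewHom.ofHom x hx ((Equiv.ofBijective _ (he Γ)).symm g.toHom), fun f => ?_, fun g => ?_⟩
  · refine (congrArg (SkewHom.ofHom x hx) ?_).trans (SkewHom.ofHom_toHom hx f)
    exact (congrArg _ (SkewHom.toHom_ofHom _ _)).trans
      ((Equiv.ofBijective _ (he Γ)).symm_apply_apply (SkewHom.toHom f))
  · refine (congrArg (SkewHom.ofHom x hΓ) ?_).trans (SkewHom.ofHom_toHom hΓ g)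
    exact (congrArg _ (SkewHom.toHom_ofHom _ _)).trans
      ((Equiv.ofBijective _ (he Γ)).apply_symm_apply (SkewHom.toHom g))

theorem toSkew_closedWithUnit (hM : closedWithUnit M) :
    SkewMulticategory.closedWithUnit M.toSkew :=
  ⟨fun b c => (hM.1 b c).imp fun _ h => h.imp fun _ he => he.toSkew,
    (multiU.obj ⟨M, hM⟩).property.2.imp fun _ h => h.imp fun _ hu => hu.isNullaryClassifier⟩

end Multicategory

/-- The inclusion of closed multicategories with units into closed skew multicategories with
units. -/
def closedInclusion : ClosedMulti.{v, u} ⥤ ClosedSkewMulti.{v, u} :=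
  SkewMulticategory.closedWithUnit.lift
    (Multicategory.closedWithUnit.ι ⋙ Multicategory.inclusion) fun M =>
    Multicategory.toSkew_closedWithUnit M.property

end SkewMulti

namespace SkewMulti

/-! ### `skewK` is fully faithful -/

namespace ShortSkewMulticategory

namespace ClosedData

variable {C : ShortSkewMulticategory.{v, u}} (d : C.ClosedData)

/-- The tight unary map `i ⟶ c` corresponding to a nullary map. -/
noncomputable def name {c : C.Ob} (w : C.L0.obj c) : d.i ⟶ c := ((d.hu c).2 w).choose

theorem name_spec {c : C.Ob} (w : C.L0.obj c) : C.L0.map (d.name w) d.u = w :=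
  ((d.hu c).2 w).choose_spec

/-- The tight ternary map `x, y, z → [b, c]` corresponding to `f : x, y, z, b → c`. -/
noncomputable def curry4 {x y z b c : C.Ob} (f : C.T4.obj x y z b c) : C.T3.obj x y z (d.hom b c) :=
  (((d.he b c).2.2.1 x y z).2 f).choose

theorem curry4_spec {x y z b c : C.Ob} (f : C.T4.obj x y z b c) :
    C.sub23_1 (d.e b c) (d.curry4 f) = f :=
  (((d.he b c).2.2.1 x y z).2 f).choose_spec

/-- The nullary map with values in `[b, c]` corresponding to a loose unary map `b → c`. -/
noncomputable def curryL1 {b c : C.Ob} (f : C.L1.obj b c) : C.L0.obj (d.hom b c) :=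
  ((d.he b c).2.2.2.1.2 f).choose

theorem curryL1_spec {b c : C.Ob} (f : C.L1.obj b c) : C.sub20_1 (d.e b c) (d.curryL1 f) = f :=
  ((d.he b c).2.2.2.1.2 f).choose_spec

/-- The loose unary map `x → [b, c]` corresponding to a loose binary map `x, b → c`. -/
noncomputable def curryL2 {x b c : C.Ob} (f : C.L2.obj x b c) : C.L1.obj x (d.hom b c) :=
  (((d.he b c).2.2.2.2 x).2 f).choose

theorem curryL2_spec {x b c : C.Ob} (f : C.L2.obj x b c) :
    C.sub2_L1_1 (d.e b c) (d.curryL2 f) = f :=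
  (((d.he b c).2.2.2.2 x).2 f).choose_spec

theorem curry_eq {x b c : C.Ob} {f : C.T2.obj x b c} {k : x ⟶ d.hom b c}
    (h : C.T2.map k (𝟙 b) (𝟙 c) (d.e b c) = f) : d.curry f = k :=
  d.hom_ext ((d.curry_spec f).trans h.symm)

theorem name_eq {c : C.Ob} {w : C.L0.obj c} {k : d.i ⟶ c} (h : C.L0.map k d.u = w) :
    d.name w = k :=
  d.u_ext ((d.name_spec w).trans h.symm)

theorem exists_T2 {x b c : C.Ob} (f : C.T2.obj x b c) :
    ∃ k : x ⟶ d.hom b c, f = C.T2.map k (𝟙 b) (𝟙 c) (d.e b c) :=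
  ⟨d.curry f, (d.curry_spec f).symm⟩

theorem exists_T3 {x y b c : C.Ob} (f : C.T3.obj x y b c) :
    ∃ g : C.T2.obj x y (d.hom b c), f = C.sub22_1 (d.e b c) g :=
  ⟨d.curry3 f, (d.curry3_spec f).symm⟩

theorem exists_T4 {x y z b c : C.Ob} (f : C.T4.obj x y z b c) :
    ∃ g : C.T3.obj x y z (d.hom b c), f = C.sub23_1 (d.e b c) g :=
  ⟨d.curry4 f, (d.curry4_spec f).symm⟩

theorem exists_L0 {c : C.Ob} (w : C.L0.obj c) : ∃ k : d.i ⟶ c, w = C.L0.map k d.u :=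
  ⟨d.name w, (d.name_spec w).symm⟩

theorem exists_L1 {b c : C.Ob} (f : C.L1.obj b c) :
    ∃ w : C.L0.obj (d.hom b c), f = C.sub20_1 (d.e b c) w :=
  ⟨d.curryL1 f, (d.curryL1_spec f).symm⟩

theorem exists_L2 {x b c : C.Ob} (f : C.L2.obj x b c) :
    ∃ g : C.L1.obj x (d.hom b c), f = C.sub2_L1_1 (d.e b c) g :=
  ⟨d.curryL2 f, (d.curryL2_spec f).symm⟩

section Lift

/-- A closed functor between the skew closed categories of `C` and `D`, expressed in terms of `C`
and `D`. -/
structure ClosedMap {D : ShortSkewMulticategory.{v, u}} (d' : D.ClosedData) where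
  F : C.Ob ⥤ D.Ob
  f0 : d'.i ⟶ F.obj d.i
  f2 (a b : C.Ob) : F.obj (d.hom a b) ⟶ d'.hom (F.obj a) (F.obj b)
  nat_f2 {a a' b b' : C.Ob} (p : a' ⟶ a) (h : b ⟶ b') :
    F.map (d.homMap p h) ≫ f2 a' b' = f2 a b ≫ d'.homMap (F.map p) (F.map h)
  map_I (a : C.Ob) : f2 d.i a ≫ d'.homMap f0 (𝟙 _) ≫ d'.I (F.obj a) = F.map (d.I a)
  map_J (a : C.Ob) : f0 ≫ F.map (d.J a) ≫ f2 a a = d'.J (F.obj a)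
  map_L (a b c : C.Ob) :
    F.map (d.L a b c) ≫ f2 (d.hom a b) (d.hom a c) ≫ d'.homMap (𝟙 _) (f2 a c) =
      f2 b c ≫ d'.L (F.obj a) (F.obj b) (F.obj c) ≫ d'.homMap (f2 a b) (𝟙 _)

variable {D : ShortSkewMulticategory.{v, u}} (d' : D.ClosedData) (A : d.ClosedMap d')

/-- The image of `e : [b, c], b → c`. -/
def liftE (b c : C.Ob) : D.T2.obj (A.F.obj (d.hom b c)) (A.F.obj b)
    (A.F.obj c) :=
  D.T2.map (A.f2 b c) (𝟙 _) (𝟙 _) (d'.e _ _)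

/-- The image of `u`. -/
def liftu : D.L0.obj (A.F.obj d.i) := D.L0.map A.f0 d'.u

noncomputable def liftT2 {x b c : C.Ob} (f : C.T2.obj x b c) :
    D.T2.obj (A.F.obj x) (A.F.obj b) (A.F.obj c) :=
  D.T2.map (A.F.map (d.curry f)) (𝟙 _) (𝟙 _) (d.liftE d' A b c)

noncomputable def liftL0 {c : C.Ob} (w : C.L0.obj c) : D.L0.obj (A.F.obj c) :=
  D.L0.map (A.F.map (d.name w)) (d.liftu d' A)

noncomputable def liftT3 {x y b c : C.Ob} (f : C.T3.obj x y b c) :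
    D.T3.obj (A.F.obj x) (A.F.obj y) (A.F.obj b)
      (A.F.obj c) :=
  D.sub22_1 (d.liftE d' A b c) (d.liftT2 d' A (d.curry3 f))

noncomputable def liftT4 {x y z b c : C.Ob} (f : C.T4.obj x y z b c) :
    D.T4.obj (A.F.obj x) (A.F.obj y) (A.F.obj z)
      (A.F.obj b) (A.F.obj c) :=
  D.sub23_1 (d.liftE d' A b c) (d.liftT3 d' A (d.curry4 f))

noncomputable def liftL1 {b c : C.Ob} (f : C.L1.obj b c) :
    D.L1.obj (A.F.obj b) (A.F.obj c) :=
  D.sub20_1 (d.liftE d' A b c) (d.liftL0 d' A (d.curryL1 f))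

noncomputable def liftL2 {x b c : C.Ob} (f : C.L2.obj x b c) :
    D.L2.obj (A.F.obj x) (A.F.obj b) (A.F.obj c) :=
  D.sub2_L1_1 (d.liftE d' A b c) (d.liftL1 d' A (d.curryL2 f))

theorem liftT2_map {x b c : C.Ob} (k : x ⟶ d.hom b c) :
    d.liftT2 d' A (C.T2.map k (𝟙 b) (𝟙 c) (d.e b c)) =
      D.T2.map (A.F.map k) (𝟙 _) (𝟙 _) (d.liftE d' A b c) := by
  rw [liftT2, d.curry_eq rfl]

theorem liftT2_e (b c : C.Ob) : d.liftT2 d' A (d.e b c) = d.liftE d' A b c := by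
  have := d.liftT2_map d' A (𝟙 (d.hom b c))
  rwa [C.T2.map_id, A.F.map_id, D.T2.map_id] at this

theorem liftL0_map {c : C.Ob} (k : d.i ⟶ c) :
    d.liftL0 d' A (C.L0.map k d.u) = D.L0.map (A.F.map k) (d.liftu d' A) := by
  rw [liftL0, d.name_eq rfl]

theorem liftT3_sub {x y b c : C.Ob} (g : C.T2.obj x y (d.hom b c)) :
    d.liftT3 d' A (C.sub22_1 (d.e b c) g) = D.sub22_1 (d.liftE d' A b c) (d.liftT2 d' A g) := by
  rw [liftT3, d.T2_ext (d.curry3_spec (C.sub22_1 (d.e b c) g))]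

theorem liftT4_sub {x y z b c : C.Ob} (g : C.T3.obj x y z (d.hom b c)) :
    d.liftT4 d' A (C.sub23_1 (d.e b c) g) = D.sub23_1 (d.liftE d' A b c) (d.liftT3 d' A g) := by
  rw [liftT4, d.T3_ext (d.curry4_spec (C.sub23_1 (d.e b c) g))]

theorem liftL1_sub {b c : C.Ob} (w : C.L0.obj (d.hom b c)) :
    d.liftL1 d' A (C.sub20_1 (d.e b c) w) = D.sub20_1 (d.liftE d' A b c) (d.liftL0 d' A w) := by
  rw [liftL1, d.L0_ext (d.curryL1_spec (C.sub20_1 (d.e b c) w))]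

theorem liftL2_sub {x b c : C.Ob} (g : C.L1.obj x (d.hom b c)) :
    d.liftL2 d' A (C.sub2_L1_1 (d.e b c) g) =
      D.sub2_L1_1 (d.liftE d' A b c) (d.liftL1 d' A g) := by
  rw [liftL2, ((d.he b c).2.2.2.2 x).1 (d.curryL2_spec (C.sub2_L1_1 (d.e b c) g))]

theorem liftE_map {b b' c c' : C.Ob} (p : b' ⟶ b) (h : c ⟶ c') :
    D.T2.map (𝟙 _) (A.F.map p) (A.F.map h) (d.liftE d' A b c) =
      D.T2.map (A.F.map (d.homMap p h)) (𝟙 _) (𝟙 _) (d.liftE d' A b' c') := by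
  rw [liftE, liftE, ← d'.e_comp]
  rw [A.nat_f2, d'.e_homMap, D.T2.map_comp]; simp

theorem lift_nat_T2 {a a' b b' c c' : C.Ob} (p : a' ⟶ a) (q : b' ⟶ b) (h : c ⟶ c')
    (f : C.T2.obj a b c) : d.liftT2 d' A (C.T2.map p q h f) =
      D.T2.map (A.F.map p) (A.F.map q) (A.F.map h)
        (d.liftT2 d' A f) := by
  obtain ⟨k, rfl⟩ := d.exists_T2 f
  have e1 : C.T2.map p q h (C.T2.map k (𝟙 b) (𝟙 c) (d.e b c)) =
      C.T2.map (p ≫ k ≫ d.homMap q h) (𝟙 _) (𝟙 _) (d.e b' c') := by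
    rw [← Category.assoc, e_homMap, C.T2.map_comp]; simp
  rw [e1, liftT2_map, liftT2_map, D.T2.map_comp, A.F.map_comp, A.F.map_comp,
    ← Category.assoc, T2_comp1, ← liftE_map, D.T2.map_comp]
  simp

theorem lift_nat_L0 {c c' : C.Ob} (h : c ⟶ c') (w : C.L0.obj c) :
    d.liftL0 d' A (C.L0.map h w) = D.L0.map (A.F.map h) (d.liftL0 d' A w) := by
  obtain ⟨k, rfl⟩ := d.exists_L0 w
  rw [C.L0.map_comp, liftL0_map, liftL0_map, D.L0.map_comp, A.F.map_comp]

theorem liftT2_pre1 {a a' b c : C.Ob} (p : a' ⟶ a) (f : C.T2.obj a b c) :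
    d.liftT2 d' A (C.T2.map p (𝟙 _) (𝟙 _) f) =
      D.T2.map (A.F.map p) (𝟙 _) (𝟙 _) (d.liftT2 d' A f) := by
  rw [lift_nat_T2, A.F.map_id, A.F.map_id]

theorem liftT2_pre2 {a b b' c : C.Ob} (p : b' ⟶ b) (f : C.T2.obj a b c) :
    d.liftT2 d' A (C.T2.map (𝟙 _) p (𝟙 _) f) =
      D.T2.map (𝟙 _) (A.F.map p) (𝟙 _) (d.liftT2 d' A f) := by
  rw [lift_nat_T2, A.F.map_id, A.F.map_id]

theorem liftT2_post {a b c c' : C.Ob} (p : c ⟶ c') (f : C.T2.obj a b c) :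
    d.liftT2 d' A (C.T2.map (𝟙 _) (𝟙 _) p f) =
      D.T2.map (𝟙 _) (𝟙 _) (A.F.map p) (d.liftT2 d' A f) := by
  rw [lift_nat_T2, A.F.map_id, A.F.map_id]

theorem lift_22_1 {b₁ b₂ c a₁ a₂ : C.Ob} (f : C.T2.obj b₁ b₂ c) (g : C.T2.obj a₁ a₂ b₁) :
    d.liftT3 d' A (C.sub22_1 f g) = D.sub22_1 (d.liftT2 d' A f) (d.liftT2 d' A g) := by
  obtain ⟨k, rfl⟩ := d.exists_T2 f
  rw [C.din_22_1, liftT3_sub, liftT2_post, ← D.din_22_1, liftT2_map]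

theorem lift_nat_T3 {a₁ a₁' a₂ a₂' a₃ a₃' c c' : C.Ob} (p₁ : a₁' ⟶ a₁) (p₂ : a₂' ⟶ a₂)
    (p₃ : a₃' ⟶ a₃) (h : c ⟶ c') (f : C.T3.obj a₁ a₂ a₃ c) :
    d.liftT3 d' A (C.T3.map p₁ p₂ p₃ h f) =
      D.T3.map (A.F.map p₁) (A.F.map p₂) (A.F.map p₃)
        (A.F.map h) (d.liftT3 d' A f) := by
  obtain ⟨g, rfl⟩ := d.exists_T3 f
  rw [← C.nat_22_1, lift_22_1, lift_22_1, lift_nat_T2, lift_nat_T2, A.F.map_id,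
    D.nat_22_1]

theorem lift_23_1 {b₁ b₂ c a₁ a₂ a₃ : C.Ob} (f : C.T2.obj b₁ b₂ c) (g : C.T3.obj a₁ a₂ a₃ b₁) :
    d.liftT4 d' A (C.sub23_1 f g) = D.sub23_1 (d.liftT2 d' A f) (d.liftT3 d' A g) := by
  obtain ⟨k, rfl⟩ := d.exists_T2 f
  rw [C.din_23_1, liftT4_sub, lift_nat_T3, A.F.map_id, A.F.map_id, A.F.map_id,
    ← D.din_23_1, liftT2_map]

theorem lift_nat_T4 {a₁ a₁' a₂ a₂' a₃ a₃' a₄ a₄' c c' : C.Ob} (p₁ : a₁' ⟶ a₁) (p₂ : a₂' ⟶ a₂)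
    (p₃ : a₃' ⟶ a₃) (p₄ : a₄' ⟶ a₄) (h : c ⟶ c') (f : C.T4.obj a₁ a₂ a₃ a₄ c) :
    d.liftT4 d' A (C.T4.map p₁ p₂ p₃ p₄ h f) =
      D.T4.map (A.F.map p₁) (A.F.map p₂) (A.F.map p₃)
        (A.F.map p₄) (A.F.map h) (d.liftT4 d' A f) := by
  obtain ⟨g, rfl⟩ := d.exists_T4 f
  rw [← C.nat_23_1, lift_23_1, lift_23_1, lift_nat_T2, lift_nat_T3, A.F.map_id,
    D.nat_23_1]

theorem lift_20_1 {b₁ b₂ c : C.Ob} (f : C.T2.obj b₁ b₂ c) (w : C.L0.obj b₁) :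
    d.liftL1 d' A (C.sub20_1 f w) = D.sub20_1 (d.liftT2 d' A f) (d.liftL0 d' A w) := by
  obtain ⟨k, rfl⟩ := d.exists_T2 f
  rw [C.din_20_1, liftL1_sub, lift_nat_L0, ← D.din_20_1, liftT2_map]

theorem lift_nat_L1 {a a' c c' : C.Ob} (p : a' ⟶ a) (h : c ⟶ c') (f : C.L1.obj a c) :
    d.liftL1 d' A (C.L1.map p h f) =
      D.L1.map (A.F.map p) (A.F.map h) (d.liftL1 d' A f) := by
  obtain ⟨w, rfl⟩ := d.exists_L1 f
  rw [← C.nat_20_1, lift_20_1, lift_20_1, lift_nat_T2, A.F.map_id, D.nat_20_1]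

theorem lift_2_L1_1 {b₁ b₂ c a : C.Ob} (f : C.T2.obj b₁ b₂ c) (g : C.L1.obj a b₁) :
    d.liftL2 d' A (C.sub2_L1_1 f g) = D.sub2_L1_1 (d.liftT2 d' A f) (d.liftL1 d' A g) := by
  obtain ⟨k, rfl⟩ := d.exists_T2 f
  rw [C.din_2_L1_1, liftL2_sub, lift_nat_L1, A.F.map_id, ← D.din_2_L1_1, liftT2_map]

theorem lift_nat_L2 {a a' b b' c c' : C.Ob} (p : a' ⟶ a) (q : b' ⟶ b) (h : c ⟶ c')
    (f : C.L2.obj a b c) : d.liftL2 d' A (C.L2.map p q h f) =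
      D.L2.map (A.F.map p) (A.F.map q) (A.F.map h)
        (d.liftL2 d' A f) := by
  obtain ⟨g, rfl⟩ := d.exists_L2 f
  rw [← C.nat_2_L1_1, lift_2_L1_1, lift_2_L1_1, lift_nat_T2, lift_nat_L1, A.F.map_id,
    D.nat_2_L1_1]

theorem lift_L (a b c : C.Ob) :
    D.sub22_1 (d.liftE d' A a c) (D.T2.map (A.F.map (d.L a b c)) (𝟙 _) (𝟙 _)
      (d.liftE d' A (d.hom a b) (d.hom a c))) =
      D.sub22_2 (d.liftE d' A b c) (d.liftE d' A a b) := by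
  have e1 := d'.L_eq' (A.f2 b c) (A.f2 a b)
  unfold liftE
  refine Eq.trans ?_ e1
  have e3 := congrArg (fun k => D.T2.map k (𝟙 _) (𝟙 _) (d'.e _ _)) (A.map_L a b c)
  rw [← Category.assoc, ← Category.assoc, d'.e_homMap] at e3
  have e4 := d'.e_homMap (A.f2 b c ≫ d'.L _ _ _) (A.f2 a b) (𝟙 _)
  rw [← e4]
  refine Eq.trans ?_ (congrArg _ e3)
  rw [D.din_22_1, D.T2.map_comp, D.T2.map_comp]
  simp

theorem lift_22_2 {b₁ b₂ c a₁ a₂ : C.Ob} (f : C.T2.obj b₁ b₂ c) (g : C.T2.obj a₁ a₂ b₂) :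
    d.liftT3 d' A (C.sub22_2 f g) = D.sub22_2 (d.liftT2 d' A f) (d.liftT2 d' A g) := by
  obtain ⟨k, rfl⟩ := d.exists_T2 f
  obtain ⟨l, rfl⟩ := d.exists_T2 g
  rw [C.nat_22_2, ← L_spec, lift_nat_T3, liftT3_sub, liftT2_map, liftT2_map, liftT2_map, lift_L,
    A.F.map_id, A.F.map_id, ← D.nat_22_2]

theorem lift_32_1 {b₁ b₂ b₃ c a₁ a₂ : C.Ob} (f : C.T3.obj b₁ b₂ b₃ c) (g : C.T2.obj a₁ a₂ b₁) :
    d.liftT4 d' A (C.sub32_1 f g) = D.sub32_1 (d.liftT3 d' A f) (d.liftT2 d' A g) := by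
  obtain ⟨k, rfl⟩ := d.exists_T3 f
  rw [← C.line_a_11, lift_23_1, lift_22_1, lift_22_1, D.line_a_11]

theorem lift_32_2 {b₁ b₂ b₃ c a₁ a₂ : C.Ob} (f : C.T3.obj b₁ b₂ b₃ c) (g : C.T2.obj a₁ a₂ b₂) :
    d.liftT4 d' A (C.sub32_2 f g) = D.sub32_2 (d.liftT3 d' A f) (d.liftT2 d' A g) := by
  obtain ⟨k, rfl⟩ := d.exists_T3 f
  rw [← C.line_a_12, lift_23_1, lift_22_2, lift_22_1, D.line_a_12]

theorem lift_32_3 {b₁ b₂ b₃ c a₁ a₂ : C.Ob} (f : C.T3.obj b₁ b₂ b₃ c) (g : C.T2.obj a₁ a₂ b₃) :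
    d.liftT4 d' A (C.sub32_3 f g) = D.sub32_3 (d.liftT3 d' A f) (d.liftT2 d' A g) := by
  obtain ⟨k, rfl⟩ := d.exists_T3 f
  rw [C.comm_a, lift_32_1, lift_22_2, lift_22_1, D.comm_a]

theorem lift_23_2 {b₁ b₂ c a₁ a₂ a₃ : C.Ob} (f : C.T2.obj b₁ b₂ c) (g : C.T3.obj a₁ a₂ a₃ b₂) :
    d.liftT4 d' A (C.sub23_2 f g) = D.sub23_2 (d.liftT2 d' A f) (d.liftT3 d' A g) := by
  obtain ⟨k, rfl⟩ := d.exists_T3 g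
  rw [C.line_a_21, lift_32_2, lift_22_2, lift_22_1, D.line_a_21]

theorem lift_20_2 {b₁ b₂ c : C.Ob} (f : C.T2.obj b₁ b₂ c) (w : C.L0.obj b₂) :
    A.F.map (C.sub20_2 f w) = D.sub20_2 (d.liftT2 d' A f) (d.liftL0 d' A w) := by
  obtain ⟨k, rfl⟩ := d.exists_L0 w
  rw [← C.din_20_2, liftL0_map, ← D.din_20_2, ← liftT2_pre2]
  obtain ⟨l, hl⟩ := d.exists_T2 (C.T2.map (𝟙 b₁) k (𝟙 c) f)
  rw [hl, liftT2_map, ← d.comp_I, A.F.map_comp]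
  rw [← A.map_I, ← Category.assoc, ← Category.assoc, d'.comp_I, d'.e_homMap, liftu, ← D.din_20_2,
    liftE, D.T2.map_comp, D.T2.map_comp]
  simp

theorem lift_j1 {a c : C.Ob} (f : a ⟶ c) :
    d.liftL1 d' A (C.j1 f) = D.j1 (A.F.map f) := by
  have e0 : C.j1 f = C.L1.map f (𝟙 c) (C.j1 (𝟙 c)) := by rw [← C.nat_j1]; simp
  have e0' : D.j1 (A.F.map f) =
      D.L1.map (A.F.map f) (𝟙 _) (D.j1 (𝟙 _)) := by rw [← D.nat_j1]; simp
  have e2 := d'.J_spec (A.F.obj c)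
  rw [e0, lift_nat_L1, e0', ← J_spec, lift_20_1, liftT2_map, A.F.map_id, ← e2]
  refine congrArg _ (Eq.trans ?_ (congrArg (fun k => D.sub20_1 (D.T2.map k (𝟙 _) (𝟙 _) (d'.e _ _))
    d'.u) (A.map_J c)))
  have e3 := d.liftL0_map d' A (𝟙 d.i)
  rw [C.L0.map_id, A.F.map_id, D.L0.map_id] at e3
  rw [e3, D.din_20_1, d'.e_comp, d'.e_comp, D.din_20_1, D.din_20_1]
  rfl

theorem lift_j2 {a b c : C.Ob} (f : C.T2.obj a b c) :
    d.liftL2 d' A (C.j2 f) = D.j2 (d.liftT2 d' A f) := by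
  obtain ⟨k, rfl⟩ := d.exists_T2 f
  rw [← C.j_2_L1_1, liftL2_sub, lift_j1, D.j_2_L1_1, liftT2_map]

theorem lift_30_1 {b₁ b₂ b₃ c : C.Ob} (f : C.T3.obj b₁ b₂ b₃ c) (w : C.L0.obj b₁) :
    d.liftL2 d' A (C.sub30_1 f w) = D.sub30_1 (d.liftT3 d' A f) (d.liftL0 d' A w) := by
  obtain ⟨g, rfl⟩ := d.exists_T3 f
  rw [← C.line_b_11, lift_2_L1_1, lift_20_1, lift_22_1, D.line_b_11]

theorem lift_30_2 {b₁ b₂ b₃ c : C.Ob} (f : C.T3.obj b₁ b₂ b₃ c) (w : C.L0.obj b₂) :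
    d.liftT2 d' A (C.sub30_2 f w) = D.sub30_2 (d.liftT3 d' A f) (d.liftL0 d' A w) := by
  obtain ⟨g, rfl⟩ := d.exists_T3 f
  rw [← C.line_b_12, liftT2_pre1, lift_20_2, lift_22_1, D.line_b_12]

theorem lift_30_3 {b₁ b₂ b₃ c : C.Ob} (f : C.T3.obj b₁ b₂ b₃ c) (w : C.L0.obj b₃) :
    d.liftT2 d' A (C.sub30_3 f w) = D.sub30_3 (d.liftT3 d' A f) (d.liftL0 d' A w) := by
  obtain ⟨g, rfl⟩ := d.exists_T3 f
  rw [C.comm_b, liftT2_post, lift_20_2, lift_22_1, D.comm_b]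

theorem lift_L1_0 {b c : C.Ob} (f : C.L1.obj b c) (w : C.L0.obj b) :
    d.liftL0 d' A (C.subL1_0 f w) = D.subL1_0 (d.liftL1 d' A f) (d.liftL0 d' A w) := by
  obtain ⟨g, rfl⟩ := d.exists_L1 f
  rw [C.comm_d, lift_nat_L0, lift_20_2, lift_20_1, D.comm_d]

theorem lift_2_L1_2 {b₁ b₂ c a : C.Ob} (f : C.T2.obj b₁ b₂ c) (g : C.L1.obj a b₂) :
    d.liftT2 d' A (C.sub2_L1_2 f g) = D.sub2_L1_2 (d.liftT2 d' A f) (d.liftL1 d' A g) := by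
  obtain ⟨w, rfl⟩ := d.exists_L1 g
  rw [C.line_b_21, lift_30_2, lift_22_2, lift_20_1, D.line_b_21]

theorem lift_L1_2 {b c a₁ a₂ : C.Ob} (f : C.L1.obj b c) (g : C.T2.obj a₁ a₂ b) :
    d.liftL2 d' A (C.subL1_2 f g) = D.subL1_2 (d.liftL1 d' A f) (d.liftT2 d' A g) := by
  obtain ⟨w, rfl⟩ := d.exists_L1 f
  rw [C.comm_c, lift_30_1, lift_22_2, lift_20_1, D.comm_c]

/-- The morphism of short skew multicategories induced by a closed functor. -/
noncomputable def lift : ShortSkewMultifunctor C D where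
  F := A.F
  T2 := d.liftT2 d' A
  T3 := d.liftT3 d' A
  T4 := d.liftT4 d' A
  L0 := d.liftL0 d' A
  L1 := d.liftL1 d' A
  L2 := d.liftL2 d' A
  nat_T2 := d.lift_nat_T2 d' A
  nat_T3 := d.lift_nat_T3 d' A
  nat_T4 := d.lift_nat_T4 d' A
  nat_L0 := d.lift_nat_L0 d' A
  nat_L1 := d.lift_nat_L1 d' A
  nat_L2 := d.lift_nat_L2 d' A
  map_j1 := d.lift_j1 d' A
  map_j2 := d.lift_j2 d' A
  map_22_1 := d.lift_22_1 d' A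
  map_22_2 := d.lift_22_2 d' A
  map_32_1 := d.lift_32_1 d' A
  map_32_2 := d.lift_32_2 d' A
  map_32_3 := d.lift_32_3 d' A
  map_23_1 := d.lift_23_1 d' A
  map_23_2 := d.lift_23_2 d' A
  map_20_1 := d.lift_20_1 d' A
  map_20_2 := d.lift_20_2 d' A
  map_30_1 := d.lift_30_1 d' A
  map_30_2 := d.lift_30_2 d' A
  map_30_3 := d.lift_30_3 d' A
  map_L1_0 := d.lift_L1_0 d' A
  map_2_L1_1 := d.lift_2_L1_1 d' A
  map_2_L1_2 := d.lift_2_L1_2 d' A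
  map_L1_2 := d.lift_L1_2 d' A

theorem toClosedFunctor_surjective (A : ClosedFunctor d.toSkewClosed d'.toSkewClosed) :
    ∃ G, d.toClosedFunctor d' G = A := by
  obtain ⟨F, f0, f2, nat_f2, map_I, map_J, map_L⟩ := A
  let A : d.ClosedMap d' := ⟨F, f0, f2, nat_f2, map_I, map_J, map_L⟩
  refine ⟨d.lift d' A, ?_⟩
  have h0 : d.f0 d' (d.lift d' A) = A.f0 := d'.u_ext <| (d.f0_spec d' (d.lift d' A)).trans <| by
    have e3 := d.liftL0_map d' A (𝟙 d.i)
    rw [C.L0.map_id, A.F.map_id, D.L0.map_id] at e3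
    exact e3
  have h2 : ∀ a b, d.f2 d' (d.lift d' A) a b = A.f2 a b := fun a b =>
    d'.hom_ext ((d.f2_spec d' (d.lift d' A) a b).trans (d.liftT2_e d' A a b))
  exact ClosedFunctor.ext' rfl ((Category.comp_id _).trans h0) fun a b =>
    (h2 a b).trans ((Category.id_comp _).trans (Category.comp_id _)).symm

end Lift

section Faithful

variable {D : ShortSkewMulticategory.{v, u}} (d' : D.ClosedData)

/-- Multifunctors with the same underlying functor agree if they agree on the `e`s and on `u`. -/
theorem multifunctor_ext {G H : ShortSkewMultifunctor C D} (hF : G.F = H.F)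
    (he : ∀ b c, G.T2 (d.e b c) ≍ H.T2 (d.e b c)) (hu : G.L0 d.u ≍ H.L0 d.u) : G = H := by
  obtain ⟨F, T2, T3, T4, L0, L1, L2, nat_T2, nat_T3, nat_T4, nat_L0, nat_L1, nat_L2, map_j1, map_j2,
    map_22_1, map_22_2, map_32_1, map_32_2, map_32_3, map_23_1, map_23_2, map_20_1, map_20_2,
    map_30_1, map_30_2, map_30_3, map_L1_0, map_2_L1_1, map_2_L1_2, map_L1_2⟩ := G
  obtain ⟨F', T2', T3', T4', L0', L1', L2', nat_T2', nat_T3', nat_T4', nat_L0', nat_L1', nat_L2',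
    map_j1', map_j2',
    map_22_1', map_22_2', map_32_1', map_32_2', map_32_3', map_23_1', map_23_2', map_20_1',
    map_20_2', map_30_1', map_30_2', map_30_3', map_L1_0', map_2_L1_1', map_2_L1_2', map_L1_2'⟩ := H
  dsimp only at hF
  subst hF
  simp only [heq_eq_eq] at he hu
  have e0 : @L0 = @L0' := by
    funext c w
    obtain ⟨k, rfl⟩ := d.exists_L0 w
    rw [nat_L0, nat_L0', hu]
  have e2 : @T2 = @T2' := by
    funext a b c f
    obtain ⟨k, rfl⟩ := d.exists_T2 f
    rw [nat_T2, nat_T2', he]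
  subst e0 e2
  have e3 : @T3 = @T3' := by
    funext a b c x f
    obtain ⟨g, rfl⟩ := d.exists_T3 f
    rw [map_22_1, map_22_1']
  have e1 : @L1 = @L1' := by
    funext a b f
    obtain ⟨g, rfl⟩ := d.exists_L1 f
    rw [map_20_1, map_20_1']
  subst e3 e1
  have e4 : @T4 = @T4' := by
    funext a b c x y f
    obtain ⟨g, rfl⟩ := d.exists_T4 f
    rw [map_23_1, map_23_1']
  have e5 : @L2 = @L2' := by
    funext a b c f
    obtain ⟨g, rfl⟩ := d.exists_L2 f
    rw [map_2_L1_1, map_2_L1_1']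
  subst e4 e5
  rfl

theorem toClosedFunctor_injective {G H : ShortSkewMultifunctor C D}
    (h : d.toClosedFunctor d' G = d.toClosedFunctor d' H) : G = H := by
  have hF : G.F = H.F := congrArg ClosedFunctor.F h
  have h0 : d.f0 d' G ≍ d.f0 d' H := by
    have e : (d.toClosedFunctor d' G).f0 ≍ (d.toClosedFunctor d' H).f0 := by rw [h]
    exact e
  have h2 : ∀ b c, d.f2 d' G b c ≍ d.f2 d' H b c := fun b c => by
    have e : (d.toClosedFunctor d' G).f2 b c ≍ (d.toClosedFunctor d' H).f2 b c := by rw [h]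
    exact e
  refine d.multifunctor_ext hF (fun b c => ?_) ?_
  · rw [← d.f2_spec d' G, ← d.f2_spec d' H]
    have h2 := h2 b c
    revert h2
    generalize d.f2 d' G b c = x
    generalize d.f2 d' H b c = y
    revert x y
    rw [hF]
    rintro x y hxy
    rw [eq_of_heq hxy]
  · rw [← d.f0_spec d' G, ← d.f0_spec d' H]
    revert h0
    generalize d.f0 d' G = x
    generalize d.f0 d' H = y
    revert x y
    rw [hF]
    rintro x y hxy
    rw [eq_of_heq hxy]

end Faithful

end ClosedData

end ShortSkewMulticategory

instance : skewK.{v, u}.Faithful where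
  map_injective h := by
    ext1
    exact (ShortSkewMulticategory.closedData _).toClosedFunctor_injective _ h

open ShortSkewMulticategory in
instance : skewK.{v, u}.Full where
  map_surjective {C D} A := by
    obtain ⟨G, hG⟩ := (closedData C).toClosedFunctor_surjective (closedData D) A
    exact ⟨⟨G⟩, hG⟩


/-! ### `skewU` is fully faithful -/

namespace SkewMulticategory

/-- A choice of internal homs in a skew multicategory. -/
structure HomData (M : SkewMulticategory.{v, u}) where
  hom : M.Ob → M.Ob → M.Ob
  e (b c : M.Ob) : M.Hom .t [hom b c, b] c
  he (b c : M.Ob) : M.IsInternalHom (e b c)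

namespace HomData

variable {M : SkewMulticategory.{v, u}} (H : M.HomData)

theorem bijective {x : Tightness} {Γ Θ : List M.Ob} {b : M.Ob} (c : M.Ob) (hx : x = .t → Γ ≠ [])
    (hΘ : Θ = [] ++ Γ ++ [b]) :
    Function.Bijective fun f : M.Hom x Γ (H.hom b c) =>
      M.sub [] [b] rfl hΘ (t_comp x) (H.e b c) f := by
  subst hΘ
  exact H.he b c x Γ hx

/-- The multimap `Γ → [b, c]` corresponding to a multimap `Γ, b → c`. -/
noncomputable def curry {x : Tightness} {Γ Θ : List M.Ob} {b c : M.Ob} (hx : x = .t → Γ ≠ [])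
    (hΘ : Θ = [] ++ Γ ++ [b]) (f : M.Hom x Θ c) : M.Hom x Γ (H.hom b c) :=
  ((H.bijective c hx hΘ).2 f).choose

theorem sub_curry {x : Tightness} {Γ Θ : List M.Ob} {b c : M.Ob} (hx : x = .t → Γ ≠ [])
    (hΘ : Θ = [] ++ Γ ++ [b]) (f : M.Hom x Θ c) :
    M.sub [] [b] rfl hΘ (t_comp x) (H.e b c) (H.curry hx hΘ f) = f :=
  ((H.bijective c hx hΘ).2 f).choose_spec

theorem curry_sub {x : Tightness} {Γ Θ : List M.Ob} {b c : M.Ob} (hx : x = .t → Γ ≠ [])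
    (hΘ : Θ = [] ++ Γ ++ [b]) (f : M.Hom x Γ (H.hom b c)) :
    H.curry hx hΘ (M.sub [] [b] rfl hΘ (t_comp x) (H.e b c) f) = f :=
  (H.bijective c hx hΘ).1 (H.sub_curry hx hΘ _)

/-- Every multimap is obtained from tight unary and nullary maps by repeatedly applying `e ∘₁ -`. -/
theorem induction {P : ∀ (x : Tightness) (Γ : List M.Ob) (c : M.Ob), M.Hom x Γ c → Prop}
    (unary : ∀ (a c : M.Ob) (k : M.Hom .t [a] c), P .t [a] c k)
    (nullary : ∀ (c : M.Ob) (w : M.Hom .l [] c), P .l [] c w)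
    (step : ∀ (x : Tightness) (Γ Θ : List M.Ob) (b c : M.Ob) (f : M.Hom x Γ (H.hom b c))
      (hΘ : Θ = [] ++ Γ ++ [b]), P x Γ _ f →
        P x Θ c (M.sub [] [b] rfl hΘ (t_comp x) (H.e b c) f))
    (x : Tightness) (Γ : List M.Ob) (c : M.Ob) (f : M.Hom x Γ c) : P x Γ c f := by
  induction Γ using List.reverseRecOn generalizing c with
  | nil =>
    cases x with
    | t => exact ((M.tight_nil c).false f).elim
    | l => exact nullary c f
  | append_singleton Γ b ih =>
    by_cases h : x = .t → Γ ≠ []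
    · rw [← H.sub_curry h rfl f]
      exact step _ _ _ _ _ _ _ (ih _ _)
    · push Not at h
      obtain ⟨rfl, rfl⟩ := h
      exact unary b c f

theorem exists_unary {a b c : M.Ob} (m : M.Hom .t [a, b] c) : ∃ k : M.Hom .t [a] (H.hom b c),
    m = M.sub (z := .t) (Θ := [a, b]) [] [b] rfl rfl rfl (H.e b c) k :=
  ⟨H.curry (Γ := [a]) (by simp) rfl m, (H.sub_curry (Γ := [a]) (by simp) rfl m).symm⟩

theorem exists_binary {a b c d : M.Ob} (m : M.Hom .t [a, b, c] d) :
    ∃ k : M.Hom .t [a, b] (H.hom c d), m = M.sub (z := .t) (Θ := [a, b, c]) [] [c] rfl rfl rfl (H.e c d) k :=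
  ⟨H.curry (Γ := [a, b]) (by simp) rfl m, (H.sub_curry (Γ := [a, b]) (by simp) rfl m).symm⟩

end HomData

/-- The part of a morphism `M.toShort ⟶ N.toShort` that determines it when `M` is closed. -/
structure ShortMap (M N : SkewMulticategory.{v, u}) where
  obj : M.Ob → N.Ob
  T1 {a c : M.Ob} : M.Hom .t [a] c → N.Hom .t [obj a] (obj c)
  T2 {a b c : M.Ob} : M.Hom .t [a, b] c → N.Hom .t [obj a, obj b] (obj c)
  L0 {c : M.Ob} : M.Hom .l [] c → N.Hom .l [] (obj c)
  T1_id (a : M.Ob) : T1 (M.id a) = N.id (obj a)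
  T1_post {a c c' : M.Ob} (k : M.Hom .t [c] c') (f : M.Hom .t [a] c) :
    T1 (M.post k f) = N.post (T1 k) (T1 f)
  L0_post {c c' : M.Ob} (k : M.Hom .t [c] c') (f : M.Hom .l [] c) :
    L0 (M.post k f) = N.post (T1 k) (L0 f)
  T2_post {a b c c' : M.Ob} (k : M.Hom .t [c] c') (f : M.Hom .t [a, b] c) :
    T2 (M.post k f) = N.post (T1 k) (T2 f)
  T2_pre_left {a a' b c : M.Ob} (k : M.Hom .t [a'] a) (f : M.Hom .t [a, b] c) :
    T2 (M.sub (z := .t) (Θ := [a', b]) [] [b] rfl rfl rfl f k) =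
      N.sub (z := .t) (Θ := [obj a', obj b]) [] [obj b] rfl rfl rfl (T2 f) (T1 k)
  T2_pre_right {a b b' c : M.Ob} (k : M.Hom .t [b'] b) (f : M.Hom .t [a, b] c) :
    T2 (M.sub (z := .t) (Θ := [a, b']) [a] [] rfl rfl rfl f k) =
      N.sub (z := .t) (Θ := [obj a, obj b']) [obj a] [] rfl rfl rfl (T2 f) (T1 k)
  T1_sub {a b c : M.Ob} (f : M.Hom .t [a, b] c) (w : M.Hom .l [] b) :
    T1 (M.sub (z := .t) (Θ := [a]) [a] [] rfl rfl rfl f w) =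
      N.sub (z := .t) (Θ := [obj a]) [obj a] [] rfl rfl rfl (T2 f) (L0 w)
  T2_T2 {a b b' c x y : M.Ob} {f : M.Hom .t [a, x] c} {g : M.Hom .t [b, b'] x}
    {f' : M.Hom .t [y, b'] c} {g' : M.Hom .t [a, b] y}
    (h : M.sub (z := .t) (Θ := [a, b, b']) [a] [] rfl rfl rfl f g =
      M.sub (z := .t) (Θ := [a, b, b']) [] [b'] rfl rfl rfl f' g') :
    N.sub (z := .t) (Θ := [obj a, obj b, obj b']) [obj a] [] rfl rfl rfl (T2 f) (T2 g) =
      N.sub (z := .t) (Θ := [obj a, obj b, obj b']) [] [obj b'] rfl rfl rfl (T2 f') (T2 g')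
  j_sub {a b c : M.Ob} {k : M.Hom .t [b] c} {f : M.Hom .t [a, b] c} {w : M.Hom .l [] a}
    (h : M.j k = M.sub (z := .l) (Θ := [b]) [] [b] rfl rfl rfl f w) :
    N.j (T1 k) = N.sub (z := .l) (Θ := [obj b]) [] [obj b] rfl rfl rfl (T2 f) (L0 w)

namespace ShortMap

variable {M N : SkewMulticategory.{v, u}} (S : ShortMap M N) (H : M.HomData)

open Classical in
/-- The extension of `S` to all multimaps, by recursion on the reversed domain. -/
noncomputable def extendAux : (Δ : List M.Ob) → {x : Tightness} → {Γ : List M.Ob} →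
    {Γ' : List N.Ob} → {c : M.Ob} → Γ = Δ.reverse → Γ' = Γ.map S.obj → M.Hom x Γ c →
      N.Hom x Γ' (S.obj c)
  | [], .t, _, _, c, hΓ, _, f => by subst hΓ; exact ((M.tight_nil c).false f).elim
  | [], .l, _, _, _, hΓ, hΓ', f => by subst hΓ hΓ'; exact S.L0 f
  | b :: Δ, x, Γ, Γ', c, hΓ, hΓ', f =>
    if h : x = .t ∧ Δ = [] then by
      obtain ⟨rfl, rfl⟩ := h
      subst hΓ hΓ'
      exact S.T1 f
    else
      N.sub [] [S.obj b] rfl (by simp [hΓ, hΓ']) (t_comp x) (S.T2 (H.e b c))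
        (extendAux Δ (Γ' := Δ.reverse.map S.obj) rfl rfl
          (H.curry (by grind) (by simp [hΓ]) f))

theorem extendAux_cons {x : Tightness} {Γ Θ : List M.Ob} {Γ' Θ' : List N.Ob} {b c : M.Ob}
    (Δ : List M.Ob) (hΓ : Γ = Δ.reverse) (hΘ : Θ = (b :: Δ).reverse) (hΓ' : Γ' = Γ.map S.obj)
    (hΘ' : Θ' = Θ.map S.obj) (f : M.Hom x Γ (H.hom b c)) {h₁ : Θ = [] ++ Γ ++ [b]}
    {h₂ : Θ' = [] ++ Γ' ++ [S.obj b]} :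
    S.extendAux H (b :: Δ) hΘ hΘ' (M.sub [] [b] rfl h₁ (t_comp x) (H.e b c) f) =
      N.sub [] [S.obj b] rfl h₂ (t_comp x) (S.T2 (H.e b c)) (S.extendAux H Δ hΓ hΓ' f) := by
  subst hΓ hΓ'
  have h : ¬ (x = .t ∧ Δ = []) := by
    rintro ⟨rfl, rfl⟩
    exact (M.tight_nil _).false f
  rw [extendAux, dif_neg h, H.curry_sub]

/-- The extension of `S` to all multimaps. -/
noncomputable def extend {x : Tightness} {Γ : List M.Ob} {Γ' : List N.Ob} {c : M.Ob}
    (h : Γ' = Γ.map S.obj) (f : M.Hom x Γ c) : N.Hom x Γ' (S.obj c) :=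
  S.extendAux H Γ.reverse Γ.reverse_reverse.symm h f

theorem extend_unary {a c : M.Ob} (k : M.Hom .t [a] c) : S.extend H rfl k = S.T1 k := by
  have key (hΓ : [a] = [a].reverse) (hΓ' : [S.obj a] = [a].map S.obj) :
      S.extendAux H [a] hΓ hΓ' k = S.T1 k := by
    rw [extendAux, dif_pos ⟨rfl, rfl⟩]
  exact key rfl rfl

theorem extend_nullary {c : M.Ob} (w : M.Hom .l [] c) : S.extend H rfl w = S.L0 w := by
  have key (hΓ : [] = [].reverse) (hΓ' : [] = [].map S.obj) :
      S.extendAux H [] hΓ hΓ' w = S.L0 w := by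
    rw [extendAux]
  exact key rfl rfl

theorem extend_step {x : Tightness} {Γ Θ : List M.Ob} {Γ' Θ' : List N.Ob} {b c : M.Ob}
    {f : M.Hom x Γ (H.hom b c)} {h : Θ' = Θ.map S.obj} {h₁ : Θ = [] ++ Γ ++ [b]}
    {h₂ : Θ' = [] ++ Γ' ++ [S.obj b]} (h₃ : Γ' = Γ.map S.obj) :
    S.extend H h (M.sub [] [b] rfl h₁ (t_comp x) (H.e b c) f) =
      N.sub [] [S.obj b] rfl h₂ (t_comp x) (S.T2 (H.e b c)) (S.extend H h₃ f) := by
  have e : Θ.reverse = b :: Γ.reverse := by simp [h₁]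
  have key : ∀ (Λ : List M.Ob) (e' : Θ = Λ.reverse), Λ = b :: Γ.reverse →
      S.extendAux H Λ e' h (M.sub [] [b] rfl h₁ (t_comp x) (H.e b c) f) =
      N.sub [] [S.obj b] rfl h₂ (t_comp x) (S.T2 (H.e b c)) (S.extend H h₃ f) := by
    rintro _ e' rfl
    exact S.extendAux_cons H _ _ _ _ _ _
  exact key _ _ e

theorem extend_binary {a b c : M.Ob} (m : M.Hom .t [a, b] c) : S.extend H rfl m = S.T2 m := by
  obtain ⟨k, rfl⟩ := H.exists_unary m
  rw [S.T2_pre_left, ← S.extend_unary H]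
  exact S.extend_step H rfl

theorem extend_post {x : Tightness} {Γ : List M.Ob} {c : M.Ob} (f : M.Hom x Γ c) :
    ∀ {Γ' : List N.Ob} {c' : M.Ob} (k : M.Hom .t [c] c') (h : Γ' = Γ.map S.obj),
      S.extend H h (M.post k f) = N.post (S.T1 k) (S.extend H h f) := by
  refine H.induction (P := fun x Γ c f => ∀ {Γ' : List N.Ob} {c' : M.Ob} (k : M.Hom .t [c] c')
    (h : Γ' = Γ.map S.obj), S.extend H h (M.post k f) = N.post (S.T1 k) (S.extend H h f))
    ?_ ?_ ?_ x Γ c f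
  · rintro a c f Γ' c' k rfl
    refine Eq.trans (S.extend_unary H _) ?_
    rw [S.T1_post]
    exact congrArg _ (S.extend_unary H _).symm
  · rintro c f Γ' c' k rfl
    refine Eq.trans (S.extend_nullary H _) ?_
    rw [S.L0_post]
    exact congrArg _ (S.extend_nullary H _).symm
  · intro x Γ Θ b c f hΘ ih Θ' c' k h
    obtain ⟨k', hk'⟩ := H.exists_unary (M.post k (H.e b c))
    have e₁ : M.post k (M.sub [] [b] rfl hΘ (t_comp x) (H.e b c) f) =
        M.sub [] [b] rfl hΘ (t_comp x) (H.e b c') (M.post k' f) := by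
      rw [← sub_post, hk']
      exact sub_din (h₂ := rfl)
    have e₂ := congrArg S.T2 hk'
    rw [S.T2_post, S.T2_pre_left] at e₂
    rw [e₁, S.extend_step H rfl (h₂ := by simp [h, hΘ]), ih,
      S.extend_step H rfl (h₂ := by simp [h, hΘ]), ← sub_post, e₂]
    exact (sub_din (h₂ := rfl)).symm

theorem extend_first {x : Tightness} {Γ : List M.Ob} {c : M.Ob} (f : M.Hom x Γ c) (hx : x = .t) :
    ∀ {y : Tightness} {Γ' Δ' Θ' : List N.Ob} {Δ Θ r : List M.Ob} {b : M.Ob} (g : M.Hom y Δ b)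
      (h₁ : Γ = [] ++ b :: r) (h₂ : Θ = [] ++ Δ ++ r) (h : Θ' = Θ.map S.obj)
      (hz : y = Tightness.comp x y 1)
      (h₃ : Γ' = Γ.map S.obj) (h₄ : Δ' = Δ.map S.obj)
      (h₅ : Γ' = [] ++ S.obj b :: r.map S.obj) (h₆ : Θ' = [] ++ Δ' ++ r.map S.obj),
      S.extend H h (M.sub [] r h₁ h₂ hz f g) =
        N.sub [] (r.map S.obj) h₅ h₆ hz (S.extend H h₃ f) (S.extend H h₄ g) := by
  revert hx
  refine H.induction (P := fun x Γ c f => x = .t →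
    ∀ {y : Tightness} {Γ' Δ' Θ' : List N.Ob} {Δ Θ r : List M.Ob} {b : M.Ob} (g : M.Hom y Δ b)
      (h₁ : Γ = [] ++ b :: r) (h₂ : Θ = [] ++ Δ ++ r) (h : Θ' = Θ.map S.obj)
      (hz : y = Tightness.comp x y 1)
      (h₃ : Γ' = Γ.map S.obj) (h₄ : Δ' = Δ.map S.obj)
      (h₅ : Γ' = [] ++ S.obj b :: r.map S.obj) (h₆ : Θ' = [] ++ Δ' ++ r.map S.obj),
      S.extend H h (M.sub [] r h₁ h₂ hz f g) =
        N.sub [] (r.map S.obj) h₅ h₆ hz (S.extend H h₃ f) (S.extend H h₄ g)) ?_ ?_ ?_ x Γ c f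
  · rintro a c f - y Γ' Δ' Θ' Δ Θ r b g h₁ h₂ h hz h₃ h₄ h₅ h₆
    obtain ⟨rfl, rfl⟩ : a = b ∧ r = [] := by simpa [eq_comm] using h₁
    obtain rfl : Θ = Δ := by simpa using h₂
    subst h₃ h₄
    obtain rfl : Θ' = _ := h
    refine (S.extend_post H g f rfl).trans ?_
    rw [← S.extend_unary H]
    rfl
  · rintro c w ⟨⟩
  · rintro x Γ Θ₁ b₁ c f hΘ ih rfl y Γ' Δ' Θ' Δ Θ r b g h₁ h₂ h hz h₃ h₄ h₅ h₆
    have hΓ : Γ ≠ [] := by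
      rintro rfl
      exact (M.tight_nil _).false f
    obtain ⟨r₁, rfl⟩ : ∃ r₁, r = r₁ ++ [b₁] := by
      rcases r.eq_nil_or_concat' with rfl | ⟨r₁, b', rfl⟩
      · rw [hΘ] at h₁
        have := congrArg List.length h₁
        simp [hΓ] at this
      · rw [hΘ] at h₁
        have h₁' : Γ ++ [b₁] = (b :: r₁) ++ [b'] := by simpa using h₁
        obtain ⟨-, e⟩ := List.append_inj' h₁' rfl
        simp only [List.cons.injEq, and_true] at e
        exact ⟨r₁, by simp [e]⟩
    have h₁' : Γ = b :: r₁ := by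
      rw [hΘ] at h₁
      have h₁' : Γ ++ [b₁] = (b :: r₁) ++ [b₁] := by simpa using h₁
      exact (List.append_inj' h₁' rfl).1
    rw [S.extend_step H (Γ' := Γ.map S.obj) rfl (h₂ := by simp [h₃, hΘ])]
    have e₁ := M.assoc (l := []) (r := [b₁]) (l' := []) (r' := r₁) (f := H.e b₁ c) (g := f) (h := g)
      (Γ := [H.hom b₁ c, b₁]) (ΔΛ := Δ ++ r₁) (Θ := Θ) (ΓΔ := Θ₁) (xy := .t) (yz := y)
      (h₁ := rfl) (h₂ := h₁') (h₃ := rfl) (h₄ := by simp [h₂]) (h₅ := hΘ)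
      (h₆ := h₁) (h₇ := h₂) (t₁ := hz) (t₂ := t_comp y)
      (t₃ := rfl) (t₄ := hz)
    have e₂ := N.assoc (l := []) (r := [S.obj b₁]) (l' := []) (r' := r₁.map S.obj)
      (f := S.T2 (H.e b₁ c)) (g := S.extend H (Γ' := Γ.map S.obj) rfl f) (h := S.extend H h₄ g)
      (ΔΛ := Δ' ++ r₁.map S.obj) (Θ := Θ') (ΓΔ := Γ') (xy := .t) (yz := y)
      (h₁ := rfl) (h₂ := by simp [h₁']) (h₃ := rfl) (h₄ := by simp [h₆]) (h₅ := by simp [h₃, hΘ])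
      (h₆ := by simpa using h₅) (h₇ := by simpa using h₆) (t₁ := hz) (t₂ := t_comp y)
      (t₃ := rfl) (t₄ := hz)
    simp only [List.nil_append] at e₁ e₂
    refine (congrArg _ e₁.symm).trans ?_
    have e₃ : (r₁ ++ [b₁]).map S.obj = r₁.map S.obj ++ [S.obj b₁] := by simp
    simp only [e₃]
    refine Eq.trans ?_ e₂
    rw [S.extend_step H (Γ' := Δ' ++ r₁.map S.obj) (by simp [h₄]) (h₂ := by simp [h₆])]
    congr 1
    exact ih rfl g h₁' rfl _ hz rfl h₄ (by simp [h₁']) rfl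

theorem extend_second {y : Tightness} {Δ : List M.Ob} {b : M.Ob} (g : M.Hom y Δ b) :
    ∀ {a c : M.Ob} (f : M.Hom .t [a, b] c) {Δ' Θ' : List N.Ob} {Θ : List M.Ob}
      (h₂ : Θ = [a] ++ Δ ++ []) (h : Θ' = Θ.map S.obj) (hz : .t = Tightness.comp .t y 2)
      (h₄ : Δ' = Δ.map S.obj) (h₆ : Θ' = [S.obj a] ++ Δ' ++ []),
      S.extend H h (M.sub [a] [] rfl h₂ hz f g) =
        N.sub [S.obj a] [] rfl h₆ hz (S.T2 f) (S.extend H h₄ g) := by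
  refine H.induction (P := fun y Δ b g => ∀ {a c : M.Ob} (f : M.Hom .t [a, b] c)
      {Δ' Θ' : List N.Ob} {Θ : List M.Ob}
      (h₂ : Θ = [a] ++ Δ ++ []) (h : Θ' = Θ.map S.obj) (hz : .t = Tightness.comp .t y 2)
      (h₄ : Δ' = Δ.map S.obj) (h₆ : Θ' = [S.obj a] ++ Δ' ++ []),
      S.extend H h (M.sub [a] [] rfl h₂ hz f g) =
        N.sub [S.obj a] [] rfl h₆ hz (S.T2 f) (S.extend H h₄ g)) ?_ ?_ ?_ y Δ b g
  · rintro b' b g a c f _ _ _ rfl rfl hz rfl h₆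
    refine (S.extend_binary H _).trans ?_
    refine (S.T2_pre_right _ _).trans ?_
    rw [← S.extend_unary H]
  · rintro b g a c f _ _ _ rfl rfl hz rfl h₆
    refine (S.extend_unary H _).trans ?_
    refine (S.T1_sub _ _).trans ?_
    rw [← S.extend_nullary H]
  · intro y Δ Δ₁ b₁ b g hΔ ih a c f Δ₁' Θ' Θ h₂ h hz h₄ h₆
    obtain ⟨n, hn⟩ := H.exists_binary
      (M.sub (z := .t) (Θ := [a, H.hom b₁ b, b₁]) [a] [] rfl rfl rfl f (H.e b₁ b))
    have hn' := S.T2_T2 hn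
    have e₁ := M.assoc (l := [a]) (r := []) (l' := []) (r' := [b₁]) (f := f) (g := H.e b₁ b)
      (h := g) (ΔΛ := Δ₁) (Θ := Θ) (ΓΔ := [a, H.hom b₁ b, b₁]) (xy := .t) (yz := y)
      (h₁ := rfl) (h₂ := rfl) (h₃ := hΔ) (h₄ := h₂) (h₅ := rfl)
      (h₆ := rfl) (h₇ := by simp [h₂, hΔ]) (t₁ := t_comp y) (t₂ := hz) (t₃ := rfl) (t₄ := hz)
    have e₂ := M.assoc (l := []) (r := [b₁]) (l' := [a]) (r' := []) (f := H.e b₁ c) (g := n)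
      (h := g) (ΔΛ := [a] ++ Δ ++ []) (Θ := Θ) (ΓΔ := [a, H.hom b₁ b, b₁]) (xy := .t) (yz := .t)
      (h₁ := rfl) (h₂ := rfl) (h₃ := rfl) (h₄ := by simp [h₂, hΔ]) (h₅ := rfl)
      (h₆ := rfl) (h₇ := by simp [h₂, hΔ]) (t₁ := hz) (t₂ := rfl) (t₃ := rfl) (t₄ := hz)
    have e₁' := N.assoc (l := [S.obj a]) (r := []) (l' := []) (r' := [S.obj b₁]) (f := S.T2 f)
      (g := S.T2 (H.e b₁ b)) (h := S.extend H (Γ' := Δ.map S.obj) rfl g) (ΔΛ := Δ₁') (Θ := Θ')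
      (ΓΔ := [S.obj a, S.obj (H.hom b₁ b), S.obj b₁]) (xy := .t) (yz := y)
      (h₁ := rfl) (h₂ := rfl) (h₃ := by simp [h₄, hΔ]) (h₄ := h₆) (h₅ := rfl)
      (h₆ := rfl) (h₇ := by simp [h₆, h₄, hΔ]) (t₁ := t_comp y) (t₂ := hz) (t₃ := rfl) (t₄ := hz)
    have e₂' := N.assoc (l := []) (r := [S.obj b₁]) (l' := [S.obj a]) (r' := [])
      (f := S.T2 (H.e b₁ c)) (g := S.T2 n)
      (h := S.extend H (Γ' := Δ.map S.obj) rfl g) (ΔΛ := [S.obj a] ++ Δ.map S.obj ++ []) (Θ := Θ')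
      (ΓΔ := [S.obj a, S.obj (H.hom b₁ b), S.obj b₁]) (xy := .t) (yz := .t)
      (h₁ := rfl) (h₂ := rfl) (h₃ := rfl) (h₄ := by simp [h₆, h₄, hΔ]) (h₅ := rfl)
      (h₆ := rfl) (h₇ := by simp [h₆, h₄, hΔ]) (t₁ := hz) (t₂ := rfl) (t₃ := rfl) (t₄ := hz)
    rw [S.extend_step H (Γ' := Δ.map S.obj) rfl (h₂ := by simp [h₄, hΔ])]
    refine (congrArg _ (e₁.trans ((congrArg (fun m => M.sub _ _ _ _ _ m g) hn).trans
      e₂.symm))).trans ?_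
    refine Eq.trans ?_ (e₁'.trans ((congrArg (fun m => N.sub _ _ _ _ _ m _) hn').trans
      e₂'.symm)).symm
    refine (S.extend_step H (Γ' := [S.obj a] ++ Δ.map S.obj ++ []) (by simp)
      (h₂ := by simp [h₆, h₄, hΔ])).trans ?_
    congr 1
    exact ih n rfl _ hz rfl rfl

theorem extend_sub {x : Tightness} {Γ : List M.Ob} {c : M.Ob} (f : M.Hom x Γ c) :
    ∀ {y z : Tightness} {Γ' Δ' Θ' : List N.Ob} {Δ Θ l r : List M.Ob} {b : M.Ob} (g : M.Hom y Δ b)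
      (hΓ : Γ = l ++ b :: r) (hΘ : Θ = l ++ Δ ++ r) (hz : z = x.comp y (l.length + 1))
      (h₁ : Γ' = Γ.map S.obj) (h₂ : Δ' = Δ.map S.obj) (h₃ : Θ' = Θ.map S.obj)
      (h₄ : Γ' = l.map S.obj ++ S.obj b :: r.map S.obj)
      (h₅ : Θ' = l.map S.obj ++ Δ' ++ r.map S.obj)
      (h₆ : z = x.comp y ((l.map S.obj).length + 1)),
      S.extend H h₃ (M.sub l r hΓ hΘ hz f g) =
        N.sub (l.map S.obj) (r.map S.obj) h₄ h₅ h₆ (S.extend H h₁ f) (S.extend H h₂ g) := by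
  refine H.induction (P := fun x Γ c f =>
    ∀ {y z : Tightness} {Γ' Δ' Θ' : List N.Ob} {Δ Θ l r : List M.Ob} {b : M.Ob} (g : M.Hom y Δ b)
      (hΓ : Γ = l ++ b :: r) (hΘ : Θ = l ++ Δ ++ r) (hz : z = x.comp y (l.length + 1))
      (h₁ : Γ' = Γ.map S.obj) (h₂ : Δ' = Δ.map S.obj) (h₃ : Θ' = Θ.map S.obj)
      (h₄ : Γ' = l.map S.obj ++ S.obj b :: r.map S.obj)
      (h₅ : Θ' = l.map S.obj ++ Δ' ++ r.map S.obj)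
      (h₆ : z = x.comp y ((l.map S.obj).length + 1)),
      S.extend H h₃ (M.sub l r hΓ hΘ hz f g) =
        N.sub (l.map S.obj) (r.map S.obj) h₄ h₅ h₆ (S.extend H h₁ f) (S.extend H h₂ g))
    ?_ ?_ ?_ x Γ c f
  · intro a c f y z Γ' Δ' Θ' Δ Θ l r b g hΓ hΘ hz h₁ h₂ h₃ h₄ h₅ h₆
    obtain rfl : l = [] := by
      have := congrArg List.length hΓ
      simp at this
      exact List.length_eq_zero_iff.1 (by omega)
    obtain rfl : z = y := hz.trans (t_comp y).symm
    exact S.extend_first H f rfl g hΓ hΘ h₃ hz h₁ h₂ h₄ h₅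
  · intro c w y z Γ' Δ' Θ' Δ Θ l r b g hΓ
    simp at hΓ
  · intro x Γ Γ₁ b₁ c f hΓ₁ ih y z Γ' Δ' Θ' Δ Θ l r b g hΓ hΘ hz h₁ h₂ h₃ h₄ h₅ h₆
    rw [hΓ₁, List.nil_append] at hΓ
    rw [S.extend_step H (Γ' := Γ.map S.obj) rfl (h₂ := by simp [h₁, hΓ₁])]
    rcases r.eq_nil_or_concat' with rfl | ⟨r₁, b', rfl⟩
    · obtain ⟨rfl, e⟩ := List.append_inj' hΓ rfl
      obtain rfl : b₁ = b := by simpa using e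
      have hy : Tightness.t = Tightness.comp .t y 2 := by cases y <;> rfl
      obtain rfl : z = x := by
        have hn : x = .t → Γ ≠ [] := by
          rintro rfl rfl
          exact (M.tight_nil _).false f
        rw [hz]
        cases x
        · cases y
          · rfl
          · exact if_neg (by simpa using hn rfl)
        · rfl
      have hx : z = Tightness.comp .t z 1 := t_comp z
      have e₁ := M.comm (l := []) (m := []) (r := []) (f := H.e b₁ c) (g := f) (h := g)
        (ΓΔ := Γ₁) (ΓΛ := H.hom b₁ c :: Δ) (Θ := Θ) (xy := z) (xz := .t) (w := z) (h₁ := rfl)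
        (h₂ := hΓ₁) (h₃ := by simp [hΓ₁]) (h₄ := by simp [hΘ]) (h₅ := rfl) (h₆ := by simp)
        (h₇ := by simp) (h₈ := by simp [hΘ]) (t₁ := hx) (t₂ := by simpa using hz)
        (t₃ := hy) (t₄ := hx)
      have e₂ := N.comm (l := []) (m := []) (r := []) (f := S.T2 (H.e b₁ c))
        (g := S.extend H (Γ' := Γ.map S.obj) rfl f) (h := S.extend H h₂ g)
        (ΓΔ := Γ') (ΓΛ := S.obj (H.hom b₁ c) :: Δ') (Θ := Θ') (xy := z) (xz := .t) (w := z)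
        (h₁ := rfl) (h₂ := by simp [h₁, hΓ₁]) (h₃ := by simp [h₁, hΓ₁]) (h₄ := by simpa using h₅)
        (h₅ := rfl) (h₆ := by simp) (h₇ := by simp) (h₈ := by simpa using h₅) (t₁ := hx)
        (t₂ := by simpa using hz) (t₃ := hy) (t₄ := hx)
      simp only [List.nil_append, List.append_nil] at e₁ e₂
      refine (congrArg _ e₁).trans (Eq.trans ?_ e₂.symm)
      have a₁ : Θ = [] ++ Γ ++ Δ := by simp [hΘ]
      have a₂ : S.obj (H.hom b₁ c) :: Δ' = (H.hom b₁ c :: Δ).map S.obj := by simp [h₂]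
      have a₃ : S.obj (H.hom b₁ c) :: Δ' = [] ++ S.obj (H.hom b₁ c) :: Δ.map S.obj := by simp [h₂]
      have a₄ : Θ' = [] ++ Γ.map S.obj ++ Δ.map S.obj := by simpa [h₂] using h₅
      refine (S.extend_first H _ rfl f rfl a₁ h₃ hx a₂ rfl a₃ a₄).trans ?_
      have e₃ := S.extend_second H g (H.e b₁ c) (Δ' := Δ') (Θ' := S.obj (H.hom b₁ c) :: Δ')
        (Θ := H.hom b₁ c :: Δ) (by simp) (by simp [h₂]) hy h₂ (by simp)
      simp only [e₃, h₂]
    · have hΓ' : Γ ++ [b₁] = (l ++ b :: r₁) ++ [b'] := by simpa using hΓ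
      obtain ⟨e, e'⟩ := List.append_inj' hΓ' rfl
      obtain rfl : b₁ = b' := by simpa using e'
      have e₁ := M.assoc (l := []) (r := [b₁]) (l' := l) (r' := r₁) (f := H.e b₁ c) (g := f)
        (h := g) (ΔΛ := l ++ Δ ++ r₁) (Θ := Θ) (ΓΔ := Γ₁) (xy := x) (yz := z)
        (h₁ := rfl) (h₂ := e) (h₃ := rfl) (h₄ := by simp [hΘ]) (h₅ := hΓ₁)
        (h₆ := by simp [hΓ₁, e]) (h₇ := by simp [hΘ]) (t₁ := hz) (t₂ := t_comp z) (t₃ := t_comp x)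
        (t₄ := hz)
      have e₂ := N.assoc (l := []) (r := [S.obj b₁]) (l' := l.map S.obj) (r' := r₁.map S.obj)
        (f := S.T2 (H.e b₁ c)) (g := S.extend H (Γ' := Γ.map S.obj) rfl f)
        (h := S.extend H h₂ g) (ΔΛ := l.map S.obj ++ Δ' ++ r₁.map S.obj) (Θ := Θ') (ΓΔ := Γ')
        (xy := x) (yz := z)
        (h₁ := rfl) (h₂ := by simp [e]) (h₃ := rfl) (h₄ := by simp [h₅]) (h₅ := by simp [h₁, hΓ₁])
        (h₆ := by simp [h₁, hΓ₁, e]) (h₇ := by simp [h₅]) (t₁ := h₆) (t₂ := t_comp z)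
        (t₃ := t_comp x) (t₄ := h₆)
      simp only [List.nil_append] at e₁ e₂
      refine (congrArg _ e₁.symm).trans ?_
      have e₃ : (r₁ ++ [b₁]).map S.obj = r₁.map S.obj ++ [S.obj b₁] := by simp
      simp only [e₃]
      refine Eq.trans ?_ e₂
      rw [S.extend_step H (Γ' := l.map S.obj ++ Δ' ++ r₁.map S.obj) (by simp [h₂])
        (h₂ := by simp [h₅])]
      congr 1
      exact ih g e rfl hz rfl h₂ _ (by simp [e]) rfl h₆

theorem extend_L1 {b c : M.Ob} (f : M.Hom .t [b] c) : S.extend H rfl (M.j f) = N.j (S.T1 f) := by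
  have e₁ := H.sub_curry (Γ := []) (by simp) rfl (M.j f)
  rw [S.j_sub e₁.symm, ← S.extend_nullary H]
  refine (congrArg _ e₁).symm.trans ?_
  exact S.extend_step H (Γ' := []) rfl

theorem extend_j {x : Tightness} {Γ : List M.Ob} {c : M.Ob} (f : M.Hom x Γ c) :
    ∀ {Γ' : List N.Ob} (hx : .t = x) (h : Γ' = Γ.map S.obj),
      S.extend H h (M.j (hx ▸ f)) = N.j (S.extend H h (hx ▸ f)) := by
  refine H.induction (P := fun x Γ c f => ∀ {Γ' : List N.Ob} (hx : .t = x) (h : Γ' = Γ.map S.obj),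
      S.extend H h (M.j (hx ▸ f)) = N.j (S.extend H h (hx ▸ f))) ?_ ?_ ?_ x Γ c f
  · rintro a c f _ - rfl
    exact (S.extend_L1 H f).trans (congrArg _ (S.extend_unary H f).symm)
  · rintro c w _ ⟨⟩
  · rintro x Γ Θ b c f hΘ ih Θ' rfl h
    have e₁ := M.j_sub_right (l := []) (r := [b]) (f := H.e b c) (g := f) (Θ := Θ) (h₁ := rfl)
      (h₂ := hΘ) (t₁ := rfl) (t₂ := rfl)
    have e₂ := N.j_sub_right (l := []) (r := [S.obj b]) (f := S.T2 (H.e b c))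
      (g := S.extend H (Γ' := Γ.map S.obj) rfl f) (Θ := Θ') (h₁ := rfl)
      (h₂ := by simp [h, hΘ]) (t₁ := rfl) (t₂ := rfl)
    refine (congrArg _ e₁).trans ?_
    refine (S.extend_step H (Γ' := Γ.map S.obj) rfl (h₂ := by simp [h, hΘ])).trans ?_
    rw [S.extend_step H (Γ' := Γ.map S.obj) rfl (h₂ := by simp [h, hΘ])]
    exact (congrArg _ (ih rfl rfl)).trans e₂.symm

/-- The skew multifunctor extending `S`. -/
noncomputable def multifunctor : SkewMultifunctor M N where
  obj := S.obj
  map h f := S.extend H h f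
  map_id a := (S.extend_unary H _).trans (S.T1_id a)
  map_sub := S.extend_sub H ..
  map_j h f := S.extend_j H f rfl h

end ShortMap

end SkewMulticategory


namespace SkewMulticategory

section

variable {M : SkewMulticategory.{v, u}} {x : Tightness} {a b c : M.Ob}

theorem fam2_post {c' : M.Ob} (k : M.Hom .t [c] c') (f : M.Hom x [a, b] c) :
    (M.fam2 x).map (M.id a) (M.id b) k f = M.post k f :=
  (pre_id _ _ rfl _).trans (pre_id _ _ rfl _)

theorem fam2_pre_left {a' : M.Ob} (k : M.Hom .t [a'] a) (f : M.Hom x [a, b] c) :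
    (M.fam2 x).map k (M.id b) (M.id c) f = M.pre [] [b] rfl rfl k f :=
  (pre_id _ _ rfl _).trans (congrArg _ (post_id f))

theorem fam2_pre_right {b' : M.Ob} (k : M.Hom .t [b'] b) (f : M.Hom x [a, b] c) :
    (M.fam2 x).map (M.id a) k (M.id c) f = M.pre [a] [] rfl rfl k f :=
  congrArg (M.pre [a] [] rfl rfl k) ((pre_id _ _ rfl _).trans (post_id f))

end

section

variable {M N : SkewMulticategory.{v, u}}

/-- The restriction of a morphism of short skew multicategories. -/
def ShortMap.ofShort (G : ShortSkewMultifunctor M.toShort N.toShort) : ShortMap M N where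
  obj := G.F.obj
  T1 f := G.F.map f
  T2 f := G.T2 f
  L0 f := G.L0 f
  T1_id a := G.F.map_id a
  T1_post k f := G.F.map_comp f k
  L0_post k f := G.nat_L0 k f
  T2_post {a b _ _} k f := by
    refine (congrArg G.T2 (fam2_post k f)).symm.trans ((G.nat_T2 (M.id a) (M.id b) k f).trans ?_)
    refine Eq.trans ?_ (fam2_post (G.F.map k) (G.T2 f))
    exact congrArg₂ (fun p q => (N.fam2 .t).map p q (G.F.map k) (G.T2 f)) (G.F.map_id a)
      (G.F.map_id b)
  T2_pre_left {_ _ b c} k f := by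
    refine (congrArg G.T2 (fam2_pre_left k f)).symm.trans
      ((G.nat_T2 k (M.id b) (M.id c) f).trans ?_)
    refine Eq.trans ?_ (fam2_pre_left (G.F.map k) (G.T2 f))
    exact congrArg₂ (fun p q => (N.fam2 .t).map (G.F.map k) p q (G.T2 f)) (G.F.map_id b)
      (G.F.map_id c)
  T2_pre_right {a _ _ c} k f := by
    refine (congrArg G.T2 (fam2_pre_right k f)).symm.trans
      ((G.nat_T2 (M.id a) k (M.id c) f).trans ?_)
    refine Eq.trans ?_ (fam2_pre_right (G.F.map k) (G.T2 f))
    exact congrArg₂ (fun p q => (N.fam2 .t).map p (G.F.map k) q (G.T2 f)) (G.F.map_id a)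
      (G.F.map_id c)
  T1_sub f w := G.map_20_2 f w
  T2_T2 {_ _ _ _ _ _ f g f' g'} h :=
    (G.map_22_2 f g).symm.trans ((congrArg G.T3 h).trans (G.map_22_1 f' g'))
  j_sub {_ _ _ k f w} h :=
    (G.map_j1 k).symm.trans ((congrArg G.L1 h).trans (G.map_20_1 f w))

theorem toShortMap_multifunctor (H : M.HomData) (d : M.toShort.ClosedData) (G : M.toShort ⟶ N.toShort) :
    toShortMap ((ShortMap.ofShort G).multifunctor H) = G := by
  refine d.multifunctor_ext ?_ (fun b c => ?_) ?_
  · refine CategoryTheory.Functor.ext (fun _ => rfl) fun a b f => ?_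
    refine ((ShortMap.ofShort G).extend_unary H f).trans ?_
    exact ((Category.id_comp _).trans (Category.comp_id _)).symm
  · exact heq_of_eq ((ShortMap.ofShort G).extend_binary H _)
  · exact heq_of_eq ((ShortMap.ofShort G).extend_nullary H _)

theorem toShortMap_injective (H : M.HomData) {F G : SkewMultifunctor M N}
    (h : toShortMap (M := M) (N := N) F = toShortMap (M := M) (N := N) G) :
    F = G := by
  have h₀ : F.obj = G.obj := congrArg (fun X : ShortSkewMultifunctor _ _ => X.F.obj) h
  have h₁ : ∀ {X Y : ShortSkewMultifunctor M.toShort N.toShort}, X = Y →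
      (∀ {a c : M.Ob} (f : M.Hom .t [a] c),
        HEq (X.F.map (X := a) (Y := c) f) (Y.F.map (X := a) (Y := c) f)) ∧
      (∀ {a b c : M.Ob} (f : M.Hom .t [a, b] c),
        HEq (X.T2 (a := a) (b := b) (c := c) f) (Y.T2 (a := a) (b := b) (c := c) f)) ∧
      (∀ {c : M.Ob} (f : M.Hom .l [] c), HEq (X.L0 (c := c) f) (Y.L0 (c := c) f)) := by
    rintro X _ rfl
    exact ⟨fun _ => HEq.rfl, fun _ => HEq.rfl, fun _ => HEq.rfl⟩
  obtain ⟨hT1, hT2, hL0⟩ := h₁ h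
  clear h h₁
  cases F with
  | mk Fo Fm Fid Fsub Fj =>
  cases G with
  | mk Go Gm Gid Gsub Gj =>
  dsimp only at h₀
  subst h₀
  suffices e : ∀ (x : Tightness) (Γ : List M.Ob) (c : M.Ob) (f : M.Hom x Γ c) {Γ' : List N.Ob}
      (h : Γ' = Γ.map Fo), Fm h f = Gm h f by
    have : @Fm = @Gm := by
      funext x Γ Γ' b h f
      exact e _ _ _ f h
    subst this
    rfl
  refine H.induction ?_ ?_ ?_
  · rintro a c k _ rfl
    exact eq_of_heq (hT1 k)
  · rintro c w _ rfl
    exact eq_of_heq (hL0 w)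
  · rintro x Γ Θ b c f hΘ ih Γ' h
    have h₅ : Γ' = [] ++ Γ.map Fo ++ [Fo b] := by simp [h, hΘ]
    refine (Fsub (h₁ := rfl) (h₂ := rfl) (h₄ := rfl) (h₅ := h₅) (h₆ := t_comp x)).trans
      (Eq.trans ?_ (Gsub (h₁ := rfl) (h₂ := rfl) (h₄ := rfl) (h₅ := h₅) (h₆ := t_comp x)).symm)
    rw [ih]
    congr 1
    exact eq_of_heq (hT2 (H.e b c))

end

/-- A choice of internal homs. -/
noncomputable def homData (M : ClosedSkewMulti.{v, u}) : M.obj.HomData where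
  hom b c := (M.property.1 b c).choose
  e b c := (M.property.1 b c).choose_spec.choose
  he b c := (M.property.1 b c).choose_spec.choose_spec

end SkewMulticategory

instance : skewU.{v, u}.Faithful where
  map_injective {M _ _ _} h :=
    ObjectProperty.hom_ext _ (SkewMulticategory.toShortMap_injective (SkewMulticategory.homData M)
      (congrArg (fun f => f.hom) h))

instance : skewU.{v, u}.Full where
  map_surjective {M _} G :=
    ⟨ObjectProperty.homMk ((SkewMulticategory.ShortMap.ofShort G.hom).multifunctor
      (SkewMulticategory.homData M)), ObjectProperty.hom_ext _
      (SkewMulticategory.toShortMap_multifunctor _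
        (ShortSkewMulticategory.closedData (skewU.obj M)) G.hom)⟩


/-! ### The closed skew multicategory of a skew closed category -/

namespace SkewClosedCategory

variable {V : SkewClosedCategory.{v, u}}

theorem homMap_homMap {b b' b'' c c' c'' : V.Ob} (p : b' ⟶ b) (p' : b'' ⟶ b') (h : c ⟶ c')
    (h' : c' ⟶ c'') {z : V.Ob} (k : V.hom b'' c'' ⟶ z) :
    V.homMap p h ≫ V.homMap p' h' ≫ k = V.homMap (p' ≫ p) (h ≫ h') ≫ k := by
  rw [← Category.assoc, V.homMap_comp]

/-- An endofunctor of a skew closed category with an action on internal homs. -/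
structure Endo (V : SkewClosedCategory.{v, u}) where
  F : V.Ob ⥤ V.Ob
  S (c d : V.Ob) : V.hom c d ⟶ V.hom (F.obj c) (F.obj d)
  nat_S {b b' c c' : V.Ob} (p : b' ⟶ b) (h : c ⟶ c') :
    V.homMap p h ≫ S b' c' = S b c ≫ V.homMap (F.map p) (F.map h)
  S_L (b c d : V.Ob) : S c d ≫ V.L (F.obj b) (F.obj c) (F.obj d) ≫ V.homMap (S b c) (𝟙 _) =
    V.L b c d ≫ V.homMap (𝟙 _) (S b d)
  J_S (c : V.Ob) : V.J c ≫ S c c = V.J (F.obj c)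

namespace Endo

/-- Transformations compatible with the actions on internal homs. -/
@[ext]
structure Hom (P Q : Endo V) where
  app (c : V.Ob) : P.F.obj c ⟶ Q.F.obj c
  nat {c c' : V.Ob} (h : c ⟶ c') : P.F.map h ≫ app c' = app c ≫ Q.F.map h
  nat_S (c d : V.Ob) : Q.S c d ≫ V.homMap (app c) (𝟙 _) = P.S c d ≫ V.homMap (𝟙 _) (app d)

instance : Category (Endo V) where
  Hom P Q := Hom P Q
  id P := { app := fun _ => 𝟙 _, nat := fun _ => by simp, nat_S := fun _ _ => rfl }
  comp {P Q R} α β :=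
    { app := fun c => α.app c ≫ β.app c
      nat := fun h => by rw [← Category.assoc, α.nat, Category.assoc, β.nat, Category.assoc]
      nat_S := fun c d => by
        have e₁ : V.homMap (α.app c ≫ β.app c) (𝟙 (R.F.obj d)) =
            V.homMap (β.app c) (𝟙 _) ≫ V.homMap (α.app c) (𝟙 _) := by
          rw [V.homMap_comp, Category.comp_id]
        have e₂ : V.homMap (𝟙 (P.F.obj c)) (α.app d ≫ β.app d) =
            V.homMap (𝟙 _) (α.app d) ≫ V.homMap (𝟙 _) (β.app d) := by
          rw [V.homMap_comp, Category.comp_id]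
        rw [e₁, e₂, ← Category.assoc, β.nat_S, Category.assoc, V.homMap_comp, ← Category.assoc,
          ← α.nat_S, Category.assoc, V.homMap_comp]
        simp }
  id_comp _ := Hom.ext (funext fun _ => Category.id_comp _)
  comp_id _ := Hom.ext (funext fun _ => Category.comp_id _)
  assoc _ _ _ := Hom.ext (funext fun _ => Category.assoc _ _ _)

@[ext]
theorem hom_ext {P Q : Endo V} {α β : P ⟶ Q} (h : ∀ c, α.app c = β.app c) : α = β :=
  Hom.ext (funext h)

theorem comp_app {P Q R : Endo V} (α : P ⟶ Q) (β : Q ⟶ R) (c : V.Ob) :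
    (α ≫ β).app c = α.app c ≫ β.app c := rfl

variable (V) in
/-- The identity. -/
def ident : Endo V where
  F := 𝟭 _
  S _ _ := 𝟙 _
  nat_S _ _ := by simp
  S_L _ _ _ := by simp [V.homMap_id]
  J_S _ := by simp

/-- The endofunctor `[a, -]`. -/
def rep (a : V.Ob) : Endo V where
  F :=
    { obj := fun c => V.hom a c
      map := fun h => V.homMap (𝟙 a) h
      map_id := fun c => V.homMap_id a c
      map_comp := fun h h' => by rw [V.homMap_comp, Category.comp_id] }
  S c d := V.L a c d
  nat_S p h := V.nat_L a p h
  S_L b c d := V.pentagon a b c d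
  J_S c := V.J_L a c

/-- Composition, in diagrammatic order. -/
def comp (P Q : Endo V) : Endo V where
  F := P.F ⋙ Q.F
  S c d := P.S c d ≫ Q.S (P.F.obj c) (P.F.obj d)
  nat_S p h := by
    rw [← Category.assoc, P.nat_S, Category.assoc, Q.nat_S, Category.assoc]
    rfl
  S_L b c d := by
    have e₁ : V.homMap (P.S b c ≫ Q.S (P.F.obj b) (P.F.obj c))
        (𝟙 (V.hom (Q.F.obj (P.F.obj b)) (Q.F.obj (P.F.obj d)))) =
        V.homMap (Q.S (P.F.obj b) (P.F.obj c)) (𝟙 _) ≫ V.homMap (P.S b c) (𝟙 _) := by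
      rw [V.homMap_comp, Category.comp_id]
    have e₂ : V.homMap (𝟙 (V.hom b c)) (P.S b d ≫ Q.S (P.F.obj b) (P.F.obj d)) =
        V.homMap (𝟙 _) (P.S b d) ≫ V.homMap (𝟙 _) (Q.S (P.F.obj b) (P.F.obj d)) := by
      rw [V.homMap_comp, Category.comp_id]
    have e₃ := Q.S_L (P.F.obj b) (P.F.obj c) (P.F.obj d)
    have e₄ := P.S_L b c d
    dsimp only [Functor.comp_obj]
    rw [e₁, e₂, ← reassoc_of% e₄, Category.assoc, reassoc_of% e₃, V.homMap_comp, V.homMap_comp]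
    simp
  J_S c := by
    rw [← Category.assoc, P.J_S, Q.J_S]
    rfl

theorem comp_ident (P : Endo V) : P.comp (ident V) = P := by
  cases P
  simp [comp, ident, Functor.comp_id]

theorem comp_assoc (P Q R : Endo V) : (P.comp Q).comp R = P.comp (Q.comp R) := by
  simp [comp, Functor.assoc]

/-- Whiskering. -/
def whisker (Q : Endo V) {D E : Endo V} (α : D ⟶ E) (P : Endo V) :
    (Q.comp D).comp P ⟶ (Q.comp E).comp P where
  app c := P.F.map (α.app (Q.F.obj c))
  nat h := by
    have e := congrArg P.F.map (α.nat (Q.F.map h))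
    rw [P.F.map_comp, P.F.map_comp] at e
    exact e
  nat_S c d := by
    have e₁ := P.nat_S (α.app (Q.F.obj c)) (𝟙 (E.F.obj (Q.F.obj d)))
    have e₂ := P.nat_S (𝟙 (D.F.obj (Q.F.obj c))) (α.app (Q.F.obj d))
    rw [P.F.map_id] at e₁ e₂
    have e₃ := α.nat_S (Q.F.obj c) (Q.F.obj d)
    dsimp only [comp, Functor.comp_obj]
    simp only [Category.assoc]
    rw [← e₁, ← e₂, reassoc_of% e₃]

/-- The transformation `[c, -] ⟶ [a, P -]` corresponding to a map `a ⟶ P c`. -/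
def hatT (P : Endo V) {a c : V.Ob} (f : a ⟶ P.F.obj c) : rep c ⟶ P.comp (rep a) where
  app d := P.S c d ≫ V.homMap f (𝟙 _)
  nat {d d'} h := by
    have e := P.nat_S (𝟙 c) h
    dsimp only [rep, comp, Functor.comp_map]
    rw [← Category.assoc, e, P.F.map_id, Category.assoc, Category.assoc, V.homMap_comp,
      V.homMap_comp]
    simp
  nat_S d d' := by
    have e₁ : V.homMap (P.S c d ≫ V.homMap f (𝟙 (P.F.obj d))) (𝟙 (V.hom a (P.F.obj d'))) =
        V.homMap (V.homMap f (𝟙 _)) (𝟙 _) ≫ V.homMap (P.S c d) (𝟙 _) := by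
      rw [V.homMap_comp, Category.comp_id]
    have e₂ : V.homMap (𝟙 (V.hom c d)) (P.S c d' ≫ V.homMap f (𝟙 (P.F.obj d'))) =
        V.homMap (𝟙 _) (P.S c d') ≫ V.homMap (𝟙 _) (V.homMap f (𝟙 _)) := by
      rw [V.homMap_comp, Category.comp_id]
    have e₃ := V.din_L f (P.F.obj d) (P.F.obj d')
    have e₄ := P.S_L c d d'
    dsimp only [rep, comp, Functor.comp_obj]
    rw [e₁, e₂, ← reassoc_of% e₄, Category.assoc, reassoc_of% e₃, V.homMap_comp, V.homMap_comp]
    simp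

/-- The transformation `[c, -] ⟶ P` corresponding to a map `i ⟶ P c`. -/
def hatL (P : Endo V) {c : V.Ob} (f : V.i ⟶ P.F.obj c) : rep c ⟶ P where
  app d := P.S c d ≫ V.homMap f (𝟙 _) ≫ V.I _
  nat {d d'} h := by
    have e := P.nat_S (𝟙 c) h
    dsimp only [rep, comp, Functor.comp_map]
    simp only [Category.assoc]
    rw [← V.nat_I, homMap_homMap, ← Category.assoc, e, P.F.map_id, Category.assoc, homMap_homMap]
    simp
  nat_S d d' := by
    have e₁ : V.homMap (P.S c d ≫ V.homMap f (𝟙 (P.F.obj d)) ≫ V.I _) (𝟙 (P.F.obj d')) =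
        V.homMap (V.I _) (𝟙 _) ≫ V.homMap (V.homMap f (𝟙 _)) (𝟙 _) ≫ V.homMap (P.S c d) (𝟙 _) := by
      simp [V.homMap_comp]
    have e₂ : V.homMap (𝟙 (V.hom c d)) (P.S c d' ≫ V.homMap f (𝟙 (P.F.obj d')) ≫ V.I _) =
        V.homMap (𝟙 _) (P.S c d') ≫ V.homMap (𝟙 _) (V.homMap f (𝟙 _)) ≫ V.homMap (𝟙 _) (V.I _) := by
      simp [V.homMap_comp]
    have e₃ := V.din_L f (P.F.obj d) (P.F.obj d')
    have e₄ := P.S_L c d d'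
    have e₅ := V.L_I (P.F.obj d) (P.F.obj d')
    dsimp only [rep, comp, Functor.comp_obj]
    rw [e₁, e₂, ← reassoc_of% e₄, ← reassoc_of% e₅]
    simp only [V.homMap_comp]
    simp only [Category.comp_id, Category.id_comp]
    have e₆ : V.homMap (P.S c d ≫ V.homMap f (𝟙 (P.F.obj d))) (V.I (P.F.obj d')) =
        V.homMap (V.homMap f (𝟙 _)) (𝟙 _) ≫ V.homMap (P.S c d) (V.I _) := by
      simp [V.homMap_comp]
    have e₇ : V.homMap (P.S c d) (V.homMap f (𝟙 (P.F.obj d')) ≫ V.I (P.F.obj d')) =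
        V.homMap (𝟙 _) (V.homMap f (𝟙 _)) ≫ V.homMap (P.S c d) (V.I _) := by
      simp [V.homMap_comp]
    rw [e₆, e₇, reassoc_of% e₃]

/-- The endofunctor `[a₁, [a₂, … [aₙ, -]]]`. -/
def iter : List V.Ob → Endo V
  | [] => ident V
  | a :: Γ => (iter Γ).comp (rep a)

theorem iter_append (l r : List V.Ob) : iter (l ++ r) = (iter r).comp (iter l) := by
  induction l with
  | nil => exact (comp_ident _).symm
  | cons a l ih =>
    change (iter (l ++ r)).comp (rep a) = (iter r).comp ((iter l).comp (rep a))
    rw [ih, comp_assoc]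

theorem iter_eq {l r Θ : List V.Ob} (h : Θ = l ++ r) : iter Θ = (iter r).comp (iter l) := by
  rw [h, iter_append]

theorem iter_eq₃ {l Δ r Θ : List V.Ob} (h : Θ = l ++ Δ ++ r) :
    iter Θ = ((iter r).comp (iter Δ)).comp (iter l) := by
  rw [h, iter_append, iter_append, comp_assoc]

theorem iter_eq_cons {l r Γ : List V.Ob} {b : V.Ob} (h : Γ = l ++ b :: r) :
    iter Γ = ((iter r).comp (rep b)).comp (iter l) := iter_eq h

/-- `P ∘ α ∘ Q` up to equalities of functors. -/
def plug (Q P : Endo V) {F G D E : Endo V} (hF : F = (Q.comp D).comp P)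
    (hG : G = (Q.comp E).comp P) (α : D ⟶ E) : F ⟶ G :=
  eqToHom hF ≫ whisker Q α P ≫ eqToHom hG.symm

theorem plug_app (Q P : Endo V) {F G D E : Endo V} (hF : F = (Q.comp D).comp P)
    (hG : G = (Q.comp E).comp P) (α : D ⟶ E) (c : V.Ob) :
    (plug Q P hF hG α).app c = eqToHom (show F.F.obj c = P.F.obj (D.F.obj (Q.F.obj c)) by rw [hF]; rfl) ≫
      P.F.map (α.app (Q.F.obj c)) ≫
        eqToHom (show P.F.obj (E.F.obj (Q.F.obj c)) = G.F.obj c by rw [hG]; rfl) := by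
  subst hF hG
  exact (Category.id_comp _).trans (Category.comp_id _) |>.trans
    ((Category.id_comp _).trans (Category.comp_id _)).symm

theorem comp_obj (P Q : Endo V) (c : V.Ob) : (P.comp Q).F.obj c = Q.F.obj (P.F.obj c) := rfl

theorem comp_map (P Q : Endo V) {c d : V.Ob} (h : c ⟶ d) :
    (P.comp Q).F.map h = Q.F.map (P.F.map h) := rfl

theorem plug_comp (Q P : Endo V) {F G K D E B : Endo V} (hF : F = (Q.comp D).comp P)
    (hG : G = (Q.comp E).comp P) (hK : K = (Q.comp B).comp P) (α : D ⟶ E) (β : E ⟶ B) :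
    plug Q P hF hK (α ≫ β) = plug Q P hF hG α ≫ plug Q P hG hK β := by
  subst hF hG hK
  ext c
  simp [plug_app, comp_app]

theorem plug_plug (Q P Q' P' : Endo V) {F G Q'' P'' F' G' D E : Endo V}
    (hF : F = (Q'.comp D).comp P') (hG : G = (Q'.comp E).comp P')
    (hF' : F' = (Q.comp F).comp P) (hG' : G' = (Q.comp G).comp P) (hQ : Q'' = Q.comp Q')
    (hP : P'' = P'.comp P) (hF'' : F' = (Q''.comp D).comp P'') (hG'' : G' = (Q''.comp E).comp P'')
    (α : D ⟶ E) :
    plug Q P hF' hG' (plug Q' P' hF hG α) = plug Q'' P'' hF'' hG'' α := by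
  subst hQ hP hF hG hF' hG'
  ext c
  simp only [plug_app]
  dsimp only [comp_map, comp_obj]
  simp
  exact congrArg _ ((congrArg (· ≫ _) (P.F.map_id _)).trans (Category.id_comp _))

theorem plug_exchange (Q P X : Endo V) {D E D' E' F₁₁ F₁₂ F₂₁ F₂₂ Q₁ Q₂ P₁ P₂ : Endo V}
    (hQ₁ : Q₁ = (Q.comp D').comp X) (hQ₂ : Q₂ = (Q.comp E').comp X)
    (hP₁ : P₁ = (X.comp D).comp P) (hP₂ : P₂ = (X.comp E).comp P)
    (h₁ : F₁₁ = (Q₁.comp D).comp P) (h₂ : F₂₁ = (Q₁.comp E).comp P)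
    (h₃ : F₁₂ = (Q₂.comp D).comp P) (h₄ : F₂₂ = (Q₂.comp E).comp P)
    (k₁ : F₁₁ = (Q.comp D').comp P₁) (k₂ : F₁₂ = (Q.comp E').comp P₁)
    (k₃ : F₂₁ = (Q.comp D').comp P₂) (k₄ : F₂₂ = (Q.comp E').comp P₂)
    (α : D ⟶ E) (β : D' ⟶ E') :
    plug Q₁ P h₁ h₂ α ≫ plug Q P₂ k₃ k₄ β = plug Q P₁ k₁ k₂ β ≫ plug Q₂ P h₃ h₄ α := by
  subst hQ₁ hQ₂ hP₁ hP₂ h₁ h₂ h₃ h₄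
  ext c
  have e := congrArg P.F.map (α.nat (X.F.map (β.app (Q.F.obj c))))
  simp only [Functor.map_comp] at e
  simp only [comp_app, plug_app]
  dsimp only [comp_map, comp_obj]
  simpa using e.symm

end Endo

end SkewClosedCategory


namespace SkewClosedCategory

variable {V : SkewClosedCategory.{v, u}}

namespace Endo

theorem hatL_comp {P P' : Endo V} (α : P ⟶ P') {c : V.Ob} (f : V.i ⟶ P.F.obj c) :
    hatL P f ≫ α = hatL P' (f ≫ α.app c) := by
  ext d
  have e := α.nat_S c d
  have e₁ : V.homMap (f ≫ α.app c) (𝟙 (P'.F.obj d)) =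
      V.homMap (α.app c) (𝟙 _) ≫ V.homMap f (𝟙 _) := by
    rw [V.homMap_comp, Category.comp_id]
  change (P.S c d ≫ V.homMap f (𝟙 (P.F.obj d)) ≫ V.I (P.F.obj d)) ≫ α.app d =
    P'.S c d ≫ V.homMap (f ≫ α.app c) (𝟙 (P'.F.obj d)) ≫ V.I (P'.F.obj d)
  simp only [e₁, Category.assoc]
  rw [reassoc_of% e, ← V.nat_I, homMap_homMap, homMap_homMap]
  simp

theorem hatT_comp {P P' : Endo V} {a : V.Ob} (α : P ⟶ P') (β : P.comp (rep a) ⟶ P'.comp (rep a))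
    (h : ∀ d, β.app d = (rep a).F.map (α.app d)) {c : V.Ob} (f : a ⟶ P.F.obj c) :
    hatT P f ≫ β = hatT P' (f ≫ α.app c) := by
  ext d
  have e := α.nat_S c d
  have e₁ : V.homMap (f ≫ α.app c) (𝟙 (P'.F.obj d)) =
      V.homMap (α.app c) (𝟙 _) ≫ V.homMap f (𝟙 _) := by
    rw [V.homMap_comp, Category.comp_id]
  rw [comp_app, h]
  change (P.S c d ≫ V.homMap f (𝟙 (P.F.obj d))) ≫ V.homMap (𝟙 a) (α.app d) =
    P'.S c d ≫ V.homMap (f ≫ α.app c) (𝟙 (P'.F.obj d))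
  rw [e₁, reassoc_of% e, Category.assoc, V.homMap_comp, V.homMap_comp]
  simp

/-- The composite of `g : x ⟶ D b` and `f : b ⟶ R c`. -/
def push {R D T : Endo V} (hT : T = R.comp D) {x b c : V.Ob} (f : b ⟶ R.F.obj c)
    (g : x ⟶ D.F.obj b) : x ⟶ T.F.obj c :=
  g ≫ D.F.map f ≫ eqToHom (show D.F.obj (R.F.obj c) = T.F.obj c by rw [hT]; rfl)

theorem push_rfl {R D : Endo V} {x b c : V.Ob} (f : b ⟶ R.F.obj c) (g : x ⟶ D.F.obj b) :
    push rfl f g = g ≫ D.F.map f :=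
  congrArg _ (Category.comp_id _)

theorem push_push {R R' L T₁ T₂ T : Endo V} (h₁ : T₁ = R'.comp L) (h₂ : T = R.comp T₁)
    (h₃ : T₂ = R.comp R') (h₄ : T = T₂.comp L) {x a b c : V.Ob} (h : x ⟶ L.F.obj a)
    (g : a ⟶ R'.F.obj b) (f : b ⟶ R.F.obj c) :
    push h₂ f (push h₁ g h) = push h₄ (push h₃ f g) h := by
  subst h₁ h₂ h₃
  simp only [push]
  dsimp only [comp_map, comp_obj]
  simp

theorem push_plug_left {R Q' P' D E F G F' G' Q'' : Endo V} (hF : F = (Q'.comp D).comp P')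
    (hG : G = (Q'.comp E).comp P') (hF' : F' = R.comp F) (hG' : G' = R.comp G)
    (hQ : Q'' = R.comp Q') (hF'' : F' = (Q''.comp D).comp P') (hG'' : G' = (Q''.comp E).comp P')
    (α : D ⟶ E) {x b c : V.Ob} (f : b ⟶ R.F.obj c) (g : x ⟶ F.F.obj b) :
    push hG' f (g ≫ (plug Q' P' hF hG α).app b) =
      push hF' f g ≫ (plug Q'' P' hF'' hG'' α).app c := by
  subst hF hG hF' hG' hQ
  have e := congrArg P'.F.map (α.nat (Q'.F.map f))
  simp only [Functor.map_comp] at e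
  revert g
  intro (g : x ⟶ P'.F.obj (D.F.obj (Q'.F.obj b)))
  simp only [push, plug_app]
  change (g ≫ 𝟙 _ ≫ P'.F.map (α.app (Q'.F.obj b)) ≫ 𝟙 _) ≫ P'.F.map (E.F.map (Q'.F.map f)) ≫ 𝟙 _ =
    (g ≫ P'.F.map (D.F.map (Q'.F.map f)) ≫ 𝟙 _) ≫ 𝟙 _ ≫
      P'.F.map (α.app (Q'.F.obj (R.F.obj c))) ≫ 𝟙 _
  simp only [Category.assoc, Category.comp_id, Category.id_comp]
  rw [e]

theorem push_plug_right {Q P D E F G F' G' B P'' : Endo V} (hF : F = (Q.comp D).comp P)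
    (hG : G = (Q.comp E).comp P) (hF' : F' = F.comp B) (hG' : G' = G.comp B)
    (hP : P'' = P.comp B) (hF'' : F' = (Q.comp D).comp P'') (hG'' : G' = (Q.comp E).comp P'')
    (α : D ⟶ E) {x b c : V.Ob} (f : b ⟶ F.F.obj c) (g : x ⟶ B.F.obj b) :
    push hG' (f ≫ (plug Q P hF hG α).app c) g =
      push hF' f g ≫ (plug Q P'' hF'' hG'' α).app c := by
  subst hF hG hF' hG' hP
  revert f
  intro (f : b ⟶ P.F.obj (D.F.obj (Q.F.obj c)))
  simp only [push, plug_app]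
  change g ≫ B.F.map (f ≫ 𝟙 _ ≫ P.F.map (α.app (Q.F.obj c)) ≫ 𝟙 _) ≫ 𝟙 _ =
    (g ≫ B.F.map f ≫ 𝟙 _) ≫ 𝟙 _ ≫ B.F.map (P.F.map (α.app (Q.F.obj c))) ≫ 𝟙 _
  simp

theorem hatL_push {R D T : Endo V} (hT : T = R.comp D) {b c : V.Ob}
    (hF : R.comp (rep b) = (R.comp (rep b)).comp (ident V)) (hG : T = (R.comp D).comp (ident V))
    (f : b ⟶ R.F.obj c) (g : V.i ⟶ D.F.obj b) :
    hatL T (push hT f g) = hatT R f ≫ plug R (ident V) hF hG (hatL D g) := by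
  subst hT
  ext d
  have e := D.nat_S f (𝟙 (R.F.obj d))
  have e₁ : V.homMap (g ≫ D.F.map f) (𝟙 (D.F.obj (R.F.obj d))) =
      V.homMap (D.F.map f) (𝟙 _) ≫ V.homMap g (𝟙 _) := by
    rw [V.homMap_comp, Category.comp_id]
  rw [D.F.map_id] at e
  rw [push_rfl, comp_app, plug_app]
  refine Eq.trans ?_ (congrArg _ ((Category.id_comp _).trans (Category.comp_id _)).symm)
  change (R.S c d ≫ D.S (R.F.obj c) (R.F.obj d)) ≫
    V.homMap (g ≫ D.F.map f) (𝟙 (D.F.obj (R.F.obj d))) ≫ V.I _ =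
    (R.S c d ≫ V.homMap f (𝟙 (R.F.obj d))) ≫ D.S b (R.F.obj d) ≫
      V.homMap g (𝟙 (D.F.obj (R.F.obj d))) ≫ V.I _
  rw [e₁, Category.assoc, Category.assoc, Category.assoc, ← reassoc_of% e]

theorem hatT_push {R D T : Endo V} (hT : T = R.comp D) {a b c : V.Ob}
    (hF : R.comp (rep b) = (R.comp (rep b)).comp (ident V))
    (hG : T.comp (rep a) = (R.comp (D.comp (rep a))).comp (ident V))
    (f : b ⟶ R.F.obj c) (g : a ⟶ D.F.obj b) :
    hatT T (push hT f g) = hatT R f ≫ plug R (ident V) hF hG (hatT D g) := by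
  subst hT
  ext d
  have e := D.nat_S f (𝟙 (R.F.obj d))
  have e₁ : V.homMap (g ≫ D.F.map f) (𝟙 (D.F.obj (R.F.obj d))) =
      V.homMap (D.F.map f) (𝟙 _) ≫ V.homMap g (𝟙 _) := by
    rw [V.homMap_comp, Category.comp_id]
  rw [D.F.map_id] at e
  rw [push_rfl, comp_app, plug_app]
  refine Eq.trans ?_ (congrArg _ ((Category.id_comp _).trans (Category.comp_id _)).symm)
  change (R.S c d ≫ D.S (R.F.obj c) (R.F.obj d)) ≫
    V.homMap (g ≫ D.F.map f) (𝟙 (D.F.obj (R.F.obj d))) =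
    (R.S c d ≫ V.homMap f (𝟙 (R.F.obj d))) ≫ D.S b (R.F.obj d) ≫
      V.homMap g (𝟙 (D.F.obj (R.F.obj d)))
  rw [e₁, Category.assoc, Category.assoc, ← reassoc_of% e]

/-- Plugging a transformation in the middle of an iterated internal hom. -/
def insert {Γ Δ Θ : List V.Ob} {b : V.Ob} (l r : List V.Ob) (hΓ : Γ = l ++ b :: r)
    (hΘ : Θ = l ++ Δ ++ r) (α : rep b ⟶ iter Δ) : iter Γ ⟶ iter Θ :=
  plug (iter r) (iter l) (iter_eq_cons hΓ) (iter_eq₃ hΘ) α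

theorem insert_comp {Γ Δ Λ ΓΔ ΔΛ Θ : List V.Ob} {b c : V.Ob} {l r l' r' : List V.Ob}
    (h₁ : Γ = l ++ c :: r) (h₂ : Δ = l' ++ b :: r') (h₃ : ΔΛ = l' ++ Λ ++ r')
    (h₄ : Θ = l ++ ΔΛ ++ r) (h₅ : ΓΔ = l ++ Δ ++ r) (h₆ : ΓΔ = (l ++ l') ++ b :: (r' ++ r))
    (h₇ : Θ = (l ++ l') ++ Λ ++ (r' ++ r)) (α : rep c ⟶ iter Δ) (β : rep b ⟶ iter Λ) :
    insert l r h₁ h₄ (α ≫ insert l' r' h₂ h₃ β) =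
      insert l r h₁ h₅ α ≫ insert (l ++ l') (r' ++ r) h₆ h₇ β :=
  (plug_comp _ _ _ (iter_eq₃ h₅) _ _ _).trans
    (congrArg _ (plug_plug _ _ _ _ _ _ _ _ (iter_append _ _) (iter_append _ _) _ _ _))

theorem insert_exchange {Γ Δ Λ ΓΔ ΓΛ Θ : List V.Ob} {b c : V.Ob} {l m r : List V.Ob}
    (h₁ : Γ = l ++ b :: (m ++ c :: r)) (h₂ : ΓΔ = l ++ Δ ++ (m ++ c :: r))
    (h₃ : ΓΔ = (l ++ Δ ++ m) ++ c :: r) (h₄ : Θ = (l ++ Δ ++ m) ++ Λ ++ r)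
    (h₅ : Γ = (l ++ b :: m) ++ c :: r) (h₆ : ΓΛ = (l ++ b :: m) ++ Λ ++ r)
    (h₇ : ΓΛ = l ++ b :: (m ++ Λ ++ r)) (h₈ : Θ = l ++ Δ ++ (m ++ Λ ++ r))
    (α : rep b ⟶ iter Δ) (β : rep c ⟶ iter Λ) :
    insert l (m ++ c :: r) h₁ h₂ α ≫ insert (l ++ Δ ++ m) r h₃ h₄ β =
      insert (l ++ b :: m) r h₅ h₆ β ≫ insert l (m ++ Λ ++ r) h₇ h₈ α :=
  plug_exchange _ _ (iter m) (iter_eq_cons rfl) (iter_eq₃ rfl) (iter_eq_cons rfl) (iter_eq₃ rfl)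
    _ _ _ _ _ _ _ _ _ _

theorem insert_cons_app {Γ Δ Θ : List V.Ob} {a b : V.Ob} {l r : List V.Ob} (hΓ : Γ = l ++ b :: r)
    (hΘ : Θ = l ++ Δ ++ r) (hΓ' : a :: Γ = a :: l ++ b :: r) (hΘ' : a :: Θ = a :: l ++ Δ ++ r)
    (α : rep b ⟶ iter Δ) (d : V.Ob) :
    (insert (a :: l) r hΓ' hΘ' α).app d = (rep a).F.map ((insert l r hΓ hΘ α).app d) := by
  unfold insert
  rw [plug_app, plug_app, Functor.map_comp, Functor.map_comp, eqToHom_map, eqToHom_map]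
  rfl

theorem insert_eqToHom {Γ Δ : List V.Ob} {b : V.Ob} {l r : List V.Ob} (hΓ : Γ = l ++ b :: r)
    (hΘ : Γ = l ++ Δ ++ r) (α : rep b ⟶ iter Δ)
    (h : ∀ d, ∃ e : (rep b).F.obj d = (iter Δ).F.obj d, α.app d = eqToHom e) (d : V.Ob) :
    (insert l r hΓ hΘ α).app d = 𝟙 _ := by
  obtain ⟨e, he⟩ := h ((iter r).F.obj d)
  unfold insert
  rw [plug_app, he, eqToHom_map]
  simp

/-- Viewing a tight multimap as a loose one. -/
def loosen (P : Endo V) {a c : V.Ob} (f : a ⟶ P.F.obj c) : V.i ⟶ (P.comp (rep a)).F.obj c :=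
  V.J a ≫ V.homMap (𝟙 a) f

theorem hatL_loosen (P : Endo V) {a c : V.Ob} (f : a ⟶ P.F.obj c) :
    hatL (P.comp (rep a)) (loosen P f) = hatT P f := by
  ext d
  have e₁ := V.nat_L a f (𝟙 (P.F.obj d))
  have e₂ := V.L_J_I a (P.F.obj d)
  rw [V.homMap_id] at e₁
  change (P.S c d ≫ V.L a (P.F.obj c) (P.F.obj d)) ≫
    V.homMap (V.J a ≫ V.homMap (𝟙 a) f) (𝟙 (V.hom a (P.F.obj d))) ≫ V.I _ =
    P.S c d ≫ V.homMap f (𝟙 _)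
  have e₃ : V.homMap (V.J a ≫ V.homMap (𝟙 a) f) (𝟙 (V.hom a (P.F.obj d))) =
      V.homMap (V.homMap (𝟙 a) f) (𝟙 _) ≫ V.homMap (V.J a) (𝟙 _) := by
    rw [V.homMap_comp, Category.comp_id]
  rw [e₃, Category.assoc, Category.assoc, ← reassoc_of% e₁, e₂, Category.comp_id]

theorem J_hatL (P : Endo V) {c : V.Ob} (f : V.i ⟶ P.F.obj c) : V.J c ≫ (hatL P f).app c = f := by
  change V.J c ≫ P.S c c ≫ V.homMap f (𝟙 _) ≫ V.I _ = f
  have e := V.nat_J f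
  rw [reassoc_of% P.J_S, ← reassoc_of% e, V.nat_I, reassoc_of% V.J_I]

theorem loosen_comp (P P' : Endo V) {a c d : V.Ob} (f : a ⟶ P.F.obj c)
    (k : P.F.obj c ⟶ P'.F.obj d) :
    loosen P' (f ≫ k) = loosen P f ≫ (rep a).F.map k := by
  change V.J a ≫ V.homMap (𝟙 a) (f ≫ k) = (V.J a ≫ V.homMap (𝟙 a) f) ≫ V.homMap (𝟙 a) k
  rw [Category.assoc, V.homMap_comp, Category.comp_id]

theorem push_loosen {R D T : Endo V} (hT : T = R.comp D) {a b c : V.Ob}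
    (hT' : T.comp (rep a) = R.comp (D.comp (rep a))) (f : b ⟶ R.F.obj c) (g : a ⟶ D.F.obj b) :
    push hT' f (loosen D g) = loosen T (push hT f g) := by
  subst hT
  rw [push_rfl]
  refine Eq.trans ?_ (loosen_comp D (R.comp D) g (D.F.map f)).symm
  exact congrArg _ (Category.comp_id _)

theorem loosen_hatL {R D T : Endo V} (hT : T = R.comp D) {b c : V.Ob}
    (hF : R.comp (rep b) = (R.comp (rep b)).comp (ident V)) (hG : T = (R.comp D).comp (ident V))
    (f : b ⟶ R.F.obj c) (g : V.i ⟶ D.F.obj b) :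
    loosen R f ≫ (plug R (ident V) hF hG (hatL D g)).app c = push hT f g := by
  subst hT
  have e := (hatL D g).nat f
  have e' : V.homMap (𝟙 b) f ≫ (hatL D g).app (R.F.obj c) = (hatL D g).app b ≫ D.F.map f := e
  rw [push_rfl, plug_app]
  refine (congrArg (loosen R f ≫ ·) ((Category.id_comp _).trans (Category.comp_id _))).trans ?_
  refine (Category.assoc (V.J b) (V.homMap (𝟙 b) f) _).trans ((congrArg (V.J b ≫ ·) e').trans ?_)
  exact (Category.assoc _ _ _).symm.trans (congrArg (· ≫ D.F.map f) (J_hatL D g))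

end Endo

end SkewClosedCategory


namespace SkewClosedCategory

variable {V : SkewClosedCategory.{v, u}}

open Endo

variable (V) in
/-- Multimaps in a skew closed category. -/
def Multi : Tightness → List V.Ob → V.Ob → Type v
  | .t, [], _ => PEmpty
  | .t, a :: Γ, c => a ⟶ (iter Γ).F.obj c
  | .l, Γ, c => V.i ⟶ (iter Γ).F.obj c

namespace Multi

/-- The transformation represented by a multimap. -/
def hat : {x : Tightness} → {Γ : List V.Ob} → {c : V.Ob} → V.Multi x Γ c → (rep c ⟶ iter Γ)
  | .t, [], _, f => f.elim
  | .t, _ :: Γ, _, f => hatT (iter Γ) f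
  | .l, Γ, _, f => hatL (iter Γ) f

/-- Viewing a tight multimap as a loose one. -/
def j : {Γ : List V.Ob} → {c : V.Ob} → V.Multi .t Γ c → V.Multi .l Γ c
  | [], _, f => f.elim
  | _ :: Γ, _, f => loosen (iter Γ) f

/-- Substitution in the first variable of a tight multimap. -/
def first : {y : Tightness} → {Δ Θ r : List V.Ob} → {b c : V.Ob} → (Θ = [] ++ Δ ++ r) →
    (b ⟶ (iter r).F.obj c) → V.Multi y Δ b → V.Multi y Θ c
  | .l, _, _, _, _, _, hΘ, f, g => push (iter_eq hΘ) f g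
  | .t, [], _, _, _, _, _, _, g => g.elim
  | .t, a :: Δ, _, r, _, _, hΘ, f, g => hΘ ▸ (push (iter_append Δ r) f g : V.Multi .t (a :: (Δ ++ r)) _)

theorem t_comp_ne {x : Tightness} {n : ℕ} (h : .l = Tightness.comp .t x (n + 1 + 1)) : False := by
  cases x <;> simp [Tightness.comp] at h

/-- Substitution. -/
def sub {x y z : Tightness} {Γ Δ Θ : List V.Ob} {b c : V.Ob} (l r : List V.Ob)
    (hΓ : Γ = l ++ b :: r) (hΘ : Θ = l ++ Δ ++ r) (hz : z = x.comp y (l.length + 1))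
    (f : V.Multi x Γ c) (g : V.Multi y Δ b) : V.Multi z Θ c :=
  match x, z, l, Γ, hΓ, Θ, hΘ, hz, f with
  | .l, .l, l, _, hΓ, _, hΘ, _, f => f ≫ (insert l r hΓ hΘ g.hat).app c
  | .l, .t, _, _, _, _, _, hz, _ => False.elim (by cases hz)
  | .t, z, [], _, rfl, _, hΘ, hz, f =>
    (show y = z from (SkewMulticategory.t_comp y).trans hz.symm) ▸ first hΘ f g
  | .t, .t, _ :: l, _, rfl, _, rfl, _, f => f ≫ (insert l r rfl rfl g.hat).app c
  | .t, .l, _ :: _, _, _, _, _, hz, _ => (t_comp_ne hz).elim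

section

variable {x y z : Tightness} {Γ Δ Θ l r : List V.Ob} {a b c : V.Ob}

theorem sub_tight (hΓ : a :: Γ = a :: l ++ b :: r) (hΘ : a :: Θ = a :: l ++ Δ ++ r)
    (hΓ' : Γ = l ++ b :: r) (hΘ' : Θ = l ++ Δ ++ r)
    (hz : .t = Tightness.comp .t y ((a :: l).length + 1)) (f : a ⟶ (iter Γ).F.obj c)
    (g : V.Multi y Δ b) :
    sub (x := .t) (z := .t) (a :: l) r hΓ hΘ hz f g = f ≫ (insert l r hΓ' hΘ' g.hat).app c := by
  subst hΓ' hΘ'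
  rfl

theorem first_tight (hΘ : a :: Θ = [] ++ (a :: Δ) ++ r) (hΘ' : Θ = Δ ++ r)
    (f : b ⟶ (iter r).F.obj c) (g : V.Multi .t (a :: Δ) b) :
    first hΘ f g = push (iter_eq hΘ') f g := by
  subst hΘ'
  rfl

theorem hat_j (f : V.Multi .t Γ c) : f.j.hat = f.hat := by
  cases Γ with
  | nil => exact f.elim
  | cons a Γ => exact hatL_loosen (iter Γ) f

theorem hat_first (hΘ : Θ = [] ++ Δ ++ r) (f : b ⟶ (iter r).F.obj c) (g : V.Multi y Δ b) :
    (first hΘ f g).hat = hatT (iter r) f ≫ insert [] r rfl hΘ g.hat := by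
  cases y with
  | l => exact hatL_push (iter_eq hΘ) _ _ f g
  | t =>
    cases Δ with
    | nil => exact g.elim
    | cons a Δ =>
      subst hΘ
      exact hatT_push (iter_append Δ r) _ _ f g

theorem hat_sub (hΓ : Γ = l ++ b :: r) (hΘ : Θ = l ++ Δ ++ r)
    (hz : z = x.comp y (l.length + 1)) (f : V.Multi x Γ c) (g : V.Multi y Δ b) :
    (sub l r hΓ hΘ hz f g).hat = f.hat ≫ insert l r hΓ hΘ g.hat := by
  cases x with
  | l =>
    obtain rfl : z = .l := hz
    exact (hatL_comp _ _).symm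
  | t =>
    cases l with
    | nil =>
      obtain rfl : z = y := hz.trans (SkewMulticategory.t_comp y).symm
      subst hΓ
      exact hat_first hΘ f g
    | cons a l =>
      cases z with
      | l => exact (t_comp_ne hz).elim
      | t =>
        subst hΓ hΘ
        exact (hatT_comp _ _ (insert_cons_app rfl rfl rfl rfl _) _).symm

end

section

variable {x y z xy xz yz w : Tightness} {Γ Δ Λ Θ ΓΔ ΔΛ ΓΛ l m r l' r' : List V.Ob} {a b c d : V.Ob}

theorem first_first (h₁ : Θ = [] ++ ΔΛ ++ r) (h₂ : ΔΛ = [] ++ Λ ++ r')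
    (h₃ : Θ = [] ++ Λ ++ (r' ++ r)) (f : c ⟶ (iter r).F.obj d) (g : b ⟶ (iter r').F.obj c)
    (h : V.Multi z Λ b) :
    first h₁ f (first h₂ g h) = first h₃ (push (iter_append r' r) f g) h := by
  cases z with
  | l => exact push_push (iter_eq h₂) (iter_eq h₁) (iter_append r' r) (iter_eq h₃) h g f
  | t =>
    cases Λ with
    | nil => exact h.elim
    | cons a Λ =>
      subst h₂
      obtain rfl : Θ = a :: (Λ ++ r' ++ r) := h₁
      have h₃' : Λ ++ r' ++ r = Λ ++ (r' ++ r) := by simp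
      refine Eq.trans ?_ (first_tight h₃ h₃' (push (iter_append r' r) f g) h).symm
      exact push_push (iter_eq rfl) (iter_eq rfl) (iter_append r' r) (iter_eq h₃') h g f

theorem assoc (f : V.Multi x Γ d) (g : V.Multi y Δ c) (h : V.Multi z Λ b)
    (h₁ : Γ = l ++ c :: r) (h₂ : Δ = l' ++ b :: r') (h₃ : ΔΛ = l' ++ Λ ++ r')
    (h₄ : Θ = l ++ ΔΛ ++ r) (h₅ : ΓΔ = l ++ Δ ++ r) (h₆ : ΓΔ = (l ++ l') ++ b :: (r' ++ r))
    (h₇ : Θ = (l ++ l') ++ Λ ++ (r' ++ r))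
    (t₁ : yz = y.comp z (l'.length + 1)) (t₂ : w = x.comp yz (l.length + 1))
    (t₃ : xy = x.comp y (l.length + 1)) (t₄ : w = xy.comp z ((l ++ l').length + 1)) :
    sub l r h₁ h₄ t₂ f (sub l' r' h₂ h₃ t₁ g h) =
      sub (l ++ l') (r' ++ r) h₆ h₇ t₄ (sub l r h₁ h₅ t₃ f g) h := by
  cases x with
  | l =>
    obtain rfl : w = .l := t₂
    obtain rfl : xy = .l := t₃
    revert f
    intro (f : V.i ⟶ (iter Γ).F.obj d)
    change f ≫ (insert l r h₁ h₄ (sub l' r' h₂ h₃ t₁ g h).hat).app d =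
      (f ≫ (insert l r h₁ h₅ g.hat).app d) ≫ (insert (l ++ l') (r' ++ r) h₆ h₇ h.hat).app d
    rw [hat_sub, insert_comp h₁ h₂ h₃ h₄ h₅ h₆ h₇]
    exact (Category.assoc _ _ _).symm
  | t =>
    cases l with
    | nil =>
      obtain rfl : w = yz := t₂.trans (SkewMulticategory.t_comp yz).symm
      obtain rfl : xy = y := t₃.trans (SkewMulticategory.t_comp y).symm
      subst h₁
      revert f
      intro (f : c ⟶ (iter r).F.obj d)
      cases xy with
      | l =>
        obtain rfl : w = .l := t₁
        exact push_plug_left (iter_eq_cons h₂) (iter_eq₃ h₃) (iter_eq h₅) (iter_eq h₄)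
          (iter_append r' r) (iter_eq_cons h₆) (iter_eq₃ h₇) h.hat f g
      | t =>
        cases l' with
        | nil =>
          obtain rfl : w = z := t₁.trans (SkewMulticategory.t_comp z).symm
          subst h₂ h₅
          exact first_first h₄ h₃ h₇ f g h
        | cons a l' =>
          cases w with
          | l => exact (t_comp_ne t₁).elim
          | t =>
            subst h₂ h₃ h₅
            obtain rfl : Θ = a :: (l' ++ Λ ++ r' ++ r) := h₄
            have h₆' : l' ++ b :: r' ++ r = l' ++ b :: (r' ++ r) := by simp
            have h₇' : l' ++ Λ ++ r' ++ r = l' ++ Λ ++ (r' ++ r) := by simp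
            refine Eq.trans ?_ (sub_tight (a := a) (l := l') h₆ h₇ h₆' h₇' t₄
              (push (iter_append _ r) f g) h).symm
            exact push_plug_left (iter_eq_cons rfl) (iter_eq₃ rfl) (iter_append _ r)
              (iter_append _ r) (iter_append r' r) (iter_eq_cons h₆') (iter_eq₃ h₇') h.hat f g
    | cons a l =>
      cases w with
      | l => exact (t_comp_ne t₂).elim
      | t =>
        cases xy with
        | l => exact (t_comp_ne t₃).elim
        | t =>
          subst h₁ h₄ h₅
          revert f
          intro (f : a ⟶ (iter (l ++ c :: r)).F.obj d)
          have h₆' : l ++ Δ ++ r = l ++ l' ++ b :: (r' ++ r) := List.tail_eq_of_cons_eq h₆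
          have h₇' : l ++ ΔΛ ++ r = l ++ l' ++ Λ ++ (r' ++ r) := List.tail_eq_of_cons_eq h₇
          refine Eq.trans ?_ (sub_tight (a := a) (l := l ++ l') h₆ h₇ h₆' h₇' t₄
            (f ≫ (insert l r rfl rfl g.hat).app d) h).symm
          change f ≫ (insert l r rfl rfl (sub l' r' h₂ h₃ t₁ g h).hat).app d = _
          rw [hat_sub, insert_comp rfl h₂ h₃ rfl rfl h₆' h₇']
          exact (Category.assoc _ _ _).symm

theorem comm (f : V.Multi x Γ d) (g : V.Multi y Δ b) (h : V.Multi z Λ c)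
    (h₁ : Γ = l ++ b :: (m ++ c :: r)) (h₂ : ΓΔ = l ++ Δ ++ (m ++ c :: r))
    (h₃ : ΓΔ = (l ++ Δ ++ m) ++ c :: r) (h₄ : Θ = (l ++ Δ ++ m) ++ Λ ++ r)
    (h₅ : Γ = (l ++ b :: m) ++ c :: r) (h₆ : ΓΛ = (l ++ b :: m) ++ Λ ++ r)
    (h₇ : ΓΛ = l ++ b :: (m ++ Λ ++ r)) (h₈ : Θ = l ++ Δ ++ (m ++ Λ ++ r))
    (t₁ : xy = x.comp y (l.length + 1)) (t₂ : w = xy.comp z ((l ++ Δ ++ m).length + 1))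
    (t₃ : xz = x.comp z ((l ++ b :: m).length + 1)) (t₄ : w = xz.comp y (l.length + 1)) :
    sub (l ++ Δ ++ m) r h₃ h₄ t₂ (sub l (m ++ c :: r) h₁ h₂ t₁ f g) h =
      sub l (m ++ Λ ++ r) h₇ h₈ t₄ (sub (l ++ b :: m) r h₅ h₆ t₃ f h) g := by
  cases x with
  | l =>
    obtain rfl : xy = .l := t₁
    obtain rfl : xz = .l := t₃
    obtain rfl : w = .l := t₂
    revert f
    intro (f : V.i ⟶ (iter Γ).F.obj d)
    change (f ≫ (insert l (m ++ c :: r) h₁ h₂ g.hat).app d) ≫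
      (insert (l ++ Δ ++ m) r h₃ h₄ h.hat).app d =
      (f ≫ (insert (l ++ b :: m) r h₅ h₆ h.hat).app d) ≫
        (insert l (m ++ Λ ++ r) h₇ h₈ g.hat).app d
    rw [Category.assoc, Category.assoc, ← comp_app, ← comp_app,
      insert_exchange h₁ h₂ h₃ h₄ h₅ h₆ h₇ h₈]
  | t =>
    cases l with
    | nil =>
      obtain rfl : xy = y := t₁.trans (SkewMulticategory.t_comp y).symm
      cases xz with
      | l => exact (t_comp_ne t₃).elim
      | t =>
        obtain rfl : w = xy := t₄.trans (SkewMulticategory.t_comp xy).symm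
        subst h₁ h₆
        revert f
        intro (f : b ⟶ (iter (m ++ c :: r)).F.obj d)
        cases w with
        | l =>
          exact (push_plug_right (iter_eq_cons rfl) (iter_eq₃ rfl) (iter_eq h₂) (iter_eq h₈)
            (iter_append Δ m) (iter_eq_cons h₃) (iter_eq₃ h₄) h.hat f g).symm
        | t =>
          cases Δ with
          | nil => exact g.elim
          | cons a Δ =>
            subst h₂ h₄
            have h₃' : Δ ++ (m ++ c :: r) = Δ ++ m ++ c :: r := by simp
            have h₈' : Δ ++ m ++ Λ ++ r = Δ ++ (m ++ Λ ++ r) := by simp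
            refine (sub_tight (a := a) (l := Δ ++ m) h₃ rfl h₃' rfl t₂
              (push (iter_append Δ _) f g) h).trans ?_
            refine Eq.trans ?_ (first_tight h₈ h₈'
              (f ≫ (insert m r rfl rfl h.hat).app d) g).symm
            exact (push_plug_right (iter_eq_cons rfl) (iter_eq₃ rfl) (iter_append Δ _) (iter_eq h₈')
              (iter_append Δ m) (iter_eq_cons h₃') (iter_eq₃ rfl) h.hat f g).symm
    | cons a l =>
      cases xy with
      | l => exact (t_comp_ne t₁).elim
      | t =>
      cases xz with
      | l => exact (t_comp_ne t₃).elim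
      | t =>
      cases w with
      | l => exact (t_comp_ne t₂).elim
      | t =>
        subst h₁ h₂ h₄ h₆
        revert f
        intro (f : a ⟶ (iter (l ++ b :: (m ++ c :: r))).F.obj d)
        have h₃' := List.tail_eq_of_cons_eq h₃
        have h₅' := List.tail_eq_of_cons_eq h₅
        have h₇' := List.tail_eq_of_cons_eq h₇
        have h₈' := List.tail_eq_of_cons_eq h₈
        refine (sub_tight (a := a) (l := l ++ Δ ++ m) h₃ rfl h₃' rfl t₂
          (f ≫ (insert l _ rfl rfl g.hat).app d) h).trans ?_
        have e := sub_tight (a := a) (l := l ++ b :: m) h₅ rfl h₅' rfl t₃ f h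
        refine Eq.trans ?_ (congrArg (fun k => sub (a :: l) (m ++ Λ ++ r) h₇ h₈ t₄ k g) e).symm
        refine Eq.trans ?_ (sub_tight (a := a) (l := l) h₇ h₈ h₇' h₈' t₄ _ g).symm
        rw [Category.assoc, Category.assoc, ← comp_app, ← comp_app]
        exact congrArg (fun k : iter _ ⟶ iter _ => f ≫ k.app d)
          (insert_exchange rfl rfl h₃' rfl h₅' rfl h₇' h₈' g.hat h.hat)

end

end Multi

end SkewClosedCategory


namespace SkewClosedCategory

variable {V : SkewClosedCategory.{v, u}}

open Endo

theorem Endo.push_bijective {R D T : Endo V} (hT : T = R.comp D) {x b c : V.Ob} (f : b ⟶ R.F.obj c)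
    (f' : R.F.obj c ⟶ b) (h : f ≫ f' = 𝟙 b) (h' : f' ≫ f = 𝟙 _) :
    Function.Bijective fun g : x ⟶ D.F.obj b => push hT f g := by
  subst hT
  have e := congrArg D.F.map h
  have e' := congrArg D.F.map h'
  rw [D.F.map_comp, D.F.map_id] at e e'
  refine Function.bijective_iff_has_inverse.2 ⟨fun g => g ≫ D.F.map f', fun g => ?_, fun g => ?_⟩
  · refine (congrArg (· ≫ D.F.map f') (push_rfl f g)).trans ?_
    exact (Category.assoc _ _ _).trans ((congrArg (g ≫ ·) e).trans (Category.comp_id g))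
  · refine (push_rfl f _).trans ?_
    exact (Category.assoc _ _ _).trans ((congrArg (g ≫ ·) e').trans (Category.comp_id g))

namespace Multi

variable {x y z : Tightness} {Γ Δ Θ l r : List V.Ob} {a b c : V.Ob}

variable (a) in
/-- The identity. -/
def ident : V.Multi .t [a] a := 𝟙 a

theorem first_id (hΘ : Γ = [] ++ Γ ++ []) (f : V.Multi x Γ b) : first hΘ (𝟙 b) f = f := by
  cases x with
  | l =>
    refine (congrArg (f ≫ ·) (congrArg (· ≫ _) ((iter Γ).F.map_id b))).trans ?_
    refine (congrArg (f ≫ ·) (Category.id_comp _)).trans ?_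
    exact Category.comp_id (X := V.i) f
  | t =>
    cases Γ with
    | nil => exact f.elim
    | cons a Γ =>
      refine (first_tight hΘ (List.append_nil Γ).symm (𝟙 b) f).trans ?_
      refine (congrArg (f ≫ ·) (congrArg (· ≫ _) ((iter Γ).F.map_id b))).trans ?_
      refine (congrArg (f ≫ ·) (Category.id_comp _)).trans ?_
      exact Category.comp_id (X := a) f

theorem hat_ident_app (d : V.Ob) : (ident a).hat.app d = eqToHom rfl := by
  change 𝟙 _ ≫ V.homMap (𝟙 a) (𝟙 d) = 𝟙 _
  rw [V.homMap_id, Category.comp_id]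

theorem sub_ident (hΓ : Γ = l ++ a :: r) (hΓ' : Γ = l ++ [a] ++ r)
    (hx : x = x.comp .t (l.length + 1)) (f : V.Multi x Γ c) :
    sub l r hΓ hΓ' hx f (ident a) = f := by
  cases x with
  | l =>
    refine (congrArg (f ≫ ·) (insert_eqToHom hΓ hΓ' _ (fun d => ⟨_, hat_ident_app d⟩) c)).trans ?_
    exact Category.comp_id (X := V.i) f
  | t =>
    cases l with
    | nil =>
      subst hΓ
      exact (congrArg (𝟙 a ≫ ·) (Category.comp_id (X := a) f)).trans (Category.id_comp (X := a) f)
    | cons a' l =>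
      subst hΓ
      have h := List.tail_eq_of_cons_eq hΓ'
      refine (sub_tight (a := a') (l := l) rfl hΓ' rfl h hx f (ident a)).trans ?_
      refine (congrArg (f ≫ ·) (insert_eqToHom rfl h _ (fun d => ⟨_, hat_ident_app d⟩) c)).trans ?_
      exact Category.comp_id (X := a') f

/-- The loose multimap underlying a multimap. -/
def toLoose : {x : Tightness} → {Γ : List V.Ob} → {c : V.Ob} → V.Multi x Γ c → V.Multi .l Γ c
  | .t, _, _, f => f.j
  | .l, _, _, f => f

theorem j_comp_insert (h₁ : Γ = [] ++ b :: r) (h₂ : Θ = [] ++ Δ ++ r) (f : V.Multi .t Γ c)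
    (g : V.Multi y Δ b) (t₁ : y = Tightness.comp .t y 1) (t₂ : .l = Tightness.comp .l y 1) :
    sub [] r h₁ h₂ t₂ f.j g = (sub [] r h₁ h₂ t₁ f g).toLoose := by
  subst h₁
  revert f
  intro (f : b ⟶ (iter r).F.obj c)
  cases y with
  | l => exact loosen_hatL (iter_eq h₂) _ _ f g
  | t =>
    cases Δ with
    | nil => exact g.elim
    | cons a Δ =>
      subst h₂
      refine Eq.trans ?_ (push_loosen (iter_append Δ r) (iter_append (a :: Δ) r) f g)
      refine Eq.trans ?_ (loosen_hatL (iter_append (a :: Δ) r)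
        (iter_eq_cons (Γ := b :: r) (l := []) rfl)
        (iter_eq₃ (l := []) rfl) f (loosen (iter Δ) g))
      exact congrArg (fun α : rep b ⟶ (iter Δ).comp (rep a) => loosen (iter r) f ≫
        (plug (iter r) (Endo.ident V) (iter_eq_cons (Γ := b :: r) (l := []) rfl)
          (iter_eq₃ (Δ := a :: Δ) (l := []) rfl) α).app c) (hatL_loosen (iter Δ) g).symm

theorem j_sub (f : V.Multi .t Γ c) (g : V.Multi y Δ b) (h₁ : Γ = l ++ b :: r)
    (h₂ : Θ = l ++ Δ ++ r) (t₁ : z = Tightness.comp .t y (l.length + 1))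
    (t₂ : .l = Tightness.comp .l y (l.length + 1)) :
    (sub l r h₁ h₂ t₁ f g).toLoose = sub l r h₁ h₂ t₂ f.j g := by
  cases l with
  | nil =>
    obtain rfl : z = y := t₁.trans (SkewMulticategory.t_comp y).symm
    exact (j_comp_insert h₁ h₂ f g t₁ t₂).symm
  | cons a l =>
    cases z with
    | l => exact (t_comp_ne t₁).elim
    | t =>
      subst h₁ h₂
      revert f
      intro (f : a ⟶ (iter (l ++ b :: r)).F.obj c)
      refine (loosen_comp _ _ f ((insert l r rfl rfl g.hat).app c)).trans ?_
      exact congrArg (loosen _ f ≫ ·) (insert_cons_app rfl rfl rfl rfl g.hat c).symm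

theorem sub_hat_congr {y' : Tightness} (f : V.Multi x Γ c) (g : V.Multi y Δ b) (g' : V.Multi y' Δ b)
    (hg : g.hat = g'.hat) (h₁ : Γ = l ++ b :: r)
    (h₂ : Θ = l ++ Δ ++ r) (t₁ : z = x.comp y (l.length + 1))
    (t₂ : z = x.comp y' (l.length + 1)) (h : x = .l ∨ l ≠ []) :
    sub l r h₁ h₂ t₁ f g = sub l r h₁ h₂ t₂ f g' := by
  cases x with
  | l =>
    obtain rfl : z = .l := t₁
    exact congrArg (fun k => f ≫ (insert l r h₁ h₂ k).app c) hg
  | t =>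
    cases l with
    | nil => simp at h
    | cons a l =>
      cases z with
      | l => exact (t_comp_ne t₁).elim
      | t =>
        subst h₁ h₂
        exact congrArg (fun k => f ≫ (insert l r rfl rfl k).app c) hg

theorem sub_j (f : V.Multi x Γ c) (g : V.Multi .t Δ b) (h₁ : Γ = l ++ b :: r)
    (h₂ : Θ = l ++ Δ ++ r) (t₁ : .t = Tightness.comp x .t (l.length + 1))
    (t₂ : .l = Tightness.comp x .l (l.length + 1)) :
    (sub l r h₁ h₂ t₁ f g).j = sub l r h₁ h₂ t₂ f g.j := by
  cases x with
  | l => cases t₁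
  | t =>
    cases l with
    | cons a l => exact (t_comp_ne t₂).elim
    | nil =>
      subst h₁
      cases Δ with
      | nil => exact g.elim
      | cons a Δ =>
        subst h₂
        exact (push_loosen (iter_append Δ r) (iter_append (a :: Δ) r) f g).symm

theorem sub_right (f : V.Multi x Γ c) (g : V.Multi .t Δ b) (h₁ : Γ = l ++ b :: r)
    (h₂ : Θ = l ++ Δ ++ r) (t₁ : z = Tightness.comp x .t (l.length + 1))
    (t₂ : z = Tightness.comp x .l (l.length + 1)) :
    sub l r h₁ h₂ t₁ f g = sub l r h₁ h₂ t₂ f g.j := by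
  refine sub_hat_congr f g g.j (hat_j g).symm h₁ h₂ t₁ t₂ ?_
  cases x with
  | l => exact Or.inl rfl
  | t =>
    refine Or.inr ?_
    rintro rfl
    rw [t₁] at t₂
    cases t₂

end Multi

variable (V) in
/-- The skew multicategory of a skew closed category. -/
def multi : SkewMulticategory.{v, u} where
  Ob := V.Ob
  Hom := V.Multi
  tight_nil _ := ⟨fun f => f.elim⟩
  id := Multi.ident
  sub := Multi.sub
  j := Multi.j
  id_sub f hΓ _ := Multi.first_id hΓ f
  sub_id _ _ hΓ hΓ' hx f := Multi.sub_ident hΓ hΓ' hx f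
  assoc := Multi.assoc ..
  comm := Multi.comm ..
  j_sub_left {_ _ _ _ _ _ _ _ f g h₁ h₂ t₁ t₂} := Multi.j_sub (z := .t) f g h₁ h₂ t₁ t₂
  sub_left {_ _ _ _ _ _ _ _ f g h₁ h₂ t₁ t₂} := Multi.j_sub (z := .l) f g h₁ h₂ t₁ t₂
  j_sub_right := Multi.sub_j ..
  sub_right := Multi.sub_right ..

variable (V) in
/-- The evaluation. -/
def eval (b c : V.Ob) : V.multi.Hom .t [V.hom b c, b] c := 𝟙 (V.hom b c)

theorem isInternalHom_eval (b c : V.Ob) : V.multi.IsInternalHom (V.eval b c) := by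
  intro x (Γ : List V.Ob) hx
  cases x with
  | l =>
    exact push_bijective (D := iter Γ) (iter_append Γ [b]) (𝟙 (V.hom b c)) (𝟙 (V.hom b c))
        (Category.id_comp _) (Category.id_comp _)
  | t =>
    cases Γ with
    | nil => exact (hx rfl rfl).elim
    | cons a Γ =>
      exact push_bijective (D := iter Γ) (iter_append Γ [b]) (𝟙 (V.hom b c)) (𝟙 (V.hom b c))
        (Category.id_comp _) (Category.id_comp _)

variable (V) in
/-- The nullary map classifier. -/
def unit : V.multi.Hom .l [] V.i := 𝟙 V.i

theorem isNullaryClassifier_unit : V.multi.IsNullaryClassifier V.unit := by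
  intro (a : V.Ob)
  have : (fun f : V.multi.Hom .t [V.i] a => V.multi.post f V.unit) = fun f => f := by
    funext f
    exact (congrArg (𝟙 V.i ≫ ·) (Category.comp_id (X := V.i) f)).trans
      (Category.id_comp (X := V.i) f)
  rw [this]
  exact Function.bijective_id

end SkewClosedCategory


namespace SkewClosedCategory

variable (V : SkewClosedCategory.{v, u})

/-- The canonical closed structure. -/
def multiClosedData : V.multi.toShort.ClosedData where
  hom := V.hom
  e := V.eval
  he b c := (isInternalHom_eval (V := V) b c).toShort
  i := V.i
  u := V.unit
  hu := isNullaryClassifier_unit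

theorem multi_comp {a b c : V.Ob} (f : a ⟶ b) (g : b ⟶ c) :
    V.multi.post (c := b) (c' := c) (x := .t) (Γ := [a]) g f = f ≫ g :=
  congrArg (f ≫ ·) (Category.comp_id g)

variable {V} in
theorem Endo.insert_last_app {b c : V.Ob} {Δ : List V.Ob} (hΘ : Δ = [] ++ Δ ++ [])
    (α : Endo.rep b ⟶ Endo.iter Δ) :
    (Endo.insert (Γ := [b]) [] [] rfl hΘ α).app c = α.app c := by
  unfold insert
  rw [plug_app]
  exact (Category.id_comp _).trans (Category.comp_id _)

variable {V} in
theorem Multi.sub_binary_last {a b c : V.Ob} {Δ : List V.Ob} {y : Tightness}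
    (h : a :: Δ = [a] ++ Δ ++ []) (h' : .t = Tightness.comp .t y 2)
    (f : a ⟶ V.hom b c) (g : V.Multi y Δ b) :
    Multi.sub (x := .t) (z := .t) (Γ := [a, b]) [a] [] rfl h h' f g = f ≫ g.hat.app c :=
  (Multi.sub_tight (l := []) rfl h rfl (List.append_nil Δ).symm h' f g).trans
    (congrArg (f ≫ ·) (Endo.insert_last_app (List.append_nil Δ).symm g.hat))

theorem multi_pre_last {a b b' c : V.Ob} (q : b' ⟶ b) (f : a ⟶ V.hom b c) :
    V.multi.pre (x := .t) (Γ := [a, b]) (Γ' := [a, b']) (a := b) (a' := b') (c := c) [a] []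
      rfl rfl q f = f ≫ V.homMap q (𝟙 c) :=
  (Multi.sub_binary_last (Δ := [b']) (y := .t) rfl rfl f q).trans
    (congrArg (f ≫ ·) (Category.id_comp (V.homMap q (𝟙 c))))

theorem multi_T2_map {a a' b b' c c' : V.Ob} (p : a' ⟶ a) (q : b' ⟶ b) (h : c ⟶ c')
    (f : a ⟶ V.hom b c) :
    (V.multi.fam2 .t).map (a := a) (a' := a') (b := b) (b' := b') (c := c) (c' := c') p q h f =
      p ≫ f ≫ V.homMap q h := by
  have e₁ : (V.multi.post (c := c) (c' := c') (x := .t) (Γ := [a, b]) h f : a ⟶ V.hom b c') =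
      f ≫ V.homMap (𝟙 b) h := congrArg (f ≫ ·) (Category.comp_id (V.homMap (𝟙 b) h))
  have e₂ (k : a ⟶ V.hom b c') : (V.multi.pre (x := .t) (Γ := [a, b]) (Γ' := [a', b]) (a := a)
      (a' := a') (c := c') [] [b] rfl rfl p k : a' ⟶ V.hom b c') = p ≫ k :=
    congrArg (p ≫ ·) (Category.comp_id k)
  refine (congrArg (V.multi.pre (x := .t) (Γ := [a', b]) (Γ' := [a', b']) (a := b)
      (a' := b') (c := c') [a'] [] rfl rfl q) ((congrArg (V.multi.pre (x := .t) (Γ := [a, b])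
      (Γ' := [a', b]) (a := a) (a' := a') (c := c') [] [b] rfl rfl p) e₁).trans (e₂ _))).trans
      ((V.multi_pre_last q _).trans ?_)
  rw [Category.assoc, Category.assoc, V.homMap_comp, Category.comp_id, Category.comp_id]

theorem multi_T2_map_eval {a b b' c c' : V.Ob} (k : a ⟶ V.hom b c) (q : b' ⟶ b) (h : c ⟶ c') :
    (V.multi.fam2 .t).map (a := V.hom b c) (a' := a) (b := b) (b' := b') (c := c) (c' := c') k q h
      (V.eval b c) = k ≫ V.homMap q h :=
  (V.multi_T2_map k q h (𝟙 _)).trans (congrArg (k ≫ ·) (Category.id_comp _))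

theorem multiClosedData_homMap {b b' c c' : V.Ob} (p : b' ⟶ b) (h : c ⟶ c') :
    V.multiClosedData.homMap (b := b) (b' := b') (c := c) (c' := c') p h = V.homMap p h := by
  have e := V.multiClosedData.homMap_spec (b := b) (b' := b') (c := c) (c' := c') p h
  have e₁ := V.multi_T2_map_eval (V.multiClosedData.homMap (b := b) (b' := b') (c := c) (c' := c')
    p h) (𝟙 b') (𝟙 c')
  have e₂ := V.multi_T2_map_eval (𝟙 (V.hom b c)) p h
  rw [V.homMap_id] at e₁
  exact (Category.comp_id (X := V.hom b c) _).symm.trans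
    (e₁.symm.trans (e.trans (e₂.trans (Category.id_comp _))))

theorem hatL_id_app (a : V.Ob) :
    (Endo.hatL (Endo.ident V) (𝟙 V.i)).app a = V.I a := by
  change 𝟙 _ ≫ V.homMap (𝟙 V.i) (𝟙 a) ≫ V.I a = V.I a
  rw [V.homMap_id, Category.id_comp, Category.id_comp]

theorem multiClosedData_I (a : V.Ob) : V.multiClosedData.I a = V.I a :=
  (Multi.sub_binary_last (V := V) (Δ := []) (y := .l) rfl rfl (𝟙 (V.hom V.i a)) (𝟙 V.i)).trans
    ((Category.id_comp _).trans (V.hatL_id_app a))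

theorem multi_sub20_1_eval {b c : V.Ob} (k : V.i ⟶ V.hom b c) :
    V.multi.sub (x := .t) (y := .l) (z := .l) (Γ := [V.i, b]) (Δ := []) (Θ := [b]) (c := c) [] [b]
      rfl rfl rfl k V.unit = k :=
  (Category.id_comp _).trans (Category.comp_id k)

theorem multiClosedData_J (a : V.Ob) : V.multiClosedData.J a = V.J a := by
  have e := V.multiClosedData.J_spec a
  have e₁ := V.multi_T2_map_eval (V.multiClosedData.J a) (𝟙 a) (𝟙 a)
  rw [V.homMap_id] at e₁
  have e₂ := V.multi_sub20_1_eval (V.multiClosedData.J a)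
  refine e₂.symm.trans ((congrArg (fun k => V.multi.sub (x := .t) (y := .l) (z := .l)
    (Γ := [V.i, a]) (Δ := []) (Θ := [a]) (c := a) [] [a] rfl rfl rfl k V.unit)
      (e₁.trans (Category.comp_id (X := V.i) _)).symm).trans (e.trans ?_))
  change V.J a ≫ V.homMap (𝟙 a) (𝟙 a) = _
  rw [V.homMap_id, Category.comp_id]

theorem multiClosedData_L (a b c : V.Ob) : V.multiClosedData.L a b c = V.L a b c := by
  have e := V.multiClosedData.L_spec a b c
  have e₁ := V.multi_T2_map_eval (b := V.hom a b) (c := V.hom a c) (V.multiClosedData.L a b c)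
    (𝟙 (V.hom a b)) (𝟙 (V.hom a c))
  rw [V.homMap_id] at e₁
  have e₂ (k : V.hom b c ⟶ V.hom (V.hom a b) (V.hom a c)) :
      V.multi.sub (x := .t) (y := .t) (z := .t) (Γ := [V.hom a c, a]) (Δ := [V.hom b c, V.hom a b])
        (Θ := [V.hom b c, V.hom a b, a]) (c := c) [] [a] rfl rfl rfl (V.eval a c) k = k := by
    refine (congrArg (k ≫ ·) (Category.comp_id (V.homMap (𝟙 _) (𝟙 _)))).trans ?_
    rw [V.homMap_id]
    exact Category.comp_id k
  have e₃ : V.multi.sub (x := .t) (y := .t) (z := .t) (Γ := [V.hom b c, b]) (Δ := [V.hom a b, a])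
        (Θ := [V.hom b c, V.hom a b, a]) (c := c) [V.hom b c] [] rfl rfl rfl (V.eval b c)
          (V.eval a b) = V.L a b c := by
    refine (Multi.sub_binary_last (V := V) (Δ := [V.hom a b, a]) (y := .t) rfl rfl
      (𝟙 (V.hom b c)) (𝟙 (V.hom a b))).trans ((Category.id_comp _).trans ?_)
    change (𝟙 _ ≫ V.L a b c) ≫ V.homMap (𝟙 _) (𝟙 _) = _
    rw [V.homMap_id, Category.id_comp, Category.comp_id]
  refine (e₂ _).symm.trans ((congrArg (fun k => V.multi.sub (x := .t) (y := .t) (z := .t)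
    (Γ := [V.hom a c, a]) (Δ := [V.hom b c, V.hom a b])
        (Θ := [V.hom b c, V.hom a b, a]) (c := c) [] [a] rfl rfl rfl (V.eval a c) k)
      (e₁.trans (Category.comp_id (X := V.hom b c) _)).symm).trans (e.trans e₃))

/-- The canonical functor from `V` to the tight unary maps of `V.multi`. -/
def toMultiFunctor : V.Ob ⥤ V.multi.toShort.Ob where
  obj a := a
  map f := f
  map_id _ := rfl
  map_comp f g := (V.multi_comp f g).symm

/-- The canonical functor from the tight unary maps of `V.multi` to `V`. -/
def ofMultiFunctor : V.multi.toShort.Ob ⥤ V.Ob where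
  obj a := a
  map f := f
  map_id _ := rfl
  map_comp f g := V.multi_comp f g

theorem multi_comp₃ {a b c d : V.Ob} (f : a ⟶ b) (g : b ⟶ c) (h : c ⟶ d) :
    V.multi.post (c := b) (c' := d) (x := .t) (Γ := [a])
      (V.multi.post (c := c) (c' := d) (x := .t) (Γ := [b]) h g) f = f ≫ g ≫ h :=
  (V.multi_comp f _).trans (congrArg (f ≫ ·) (V.multi_comp g h))

/-- The closed functor from the skew closed category of `V.multi` to `V`. -/
noncomputable def ofMulti : V.multiClosedData.toSkewClosed ⟶ V where
  F := V.ofMultiFunctor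
  f0 := 𝟙 V.i
  f2 a b := 𝟙 (V.hom a b)
  nat_f2 p h := (Category.comp_id _).trans
    ((V.multiClosedData_homMap p h).trans (Category.id_comp _).symm)
  map_I := fun (a : V.Ob) => by
    refine Eq.trans ?_ (V.multiClosedData_I a).symm
    change 𝟙 _ ≫ V.homMap (𝟙 V.i) (𝟙 a) ≫ V.I a = V.I a
    rw [V.homMap_id, Category.id_comp, Category.id_comp]
  map_J := fun (a : V.Ob) => (Category.id_comp _).trans ((Category.comp_id _).trans (V.multiClosedData_J a))
  map_L := fun (a b c : V.Ob) => by
    refine (congrArg (fun k : V.hom b c ⟶ V.hom (V.hom a b) (V.hom a c) =>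
      k ≫ 𝟙 _ ≫ V.homMap (𝟙 (V.hom a b)) (𝟙 (V.hom a c))) (V.multiClosedData_L a b c)).trans ?_
    change V.L a b c ≫ 𝟙 _ ≫ V.homMap (𝟙 (V.hom a b)) (𝟙 (V.hom a c)) =
      𝟙 _ ≫ V.L a b c ≫ V.homMap (𝟙 (V.hom a b)) (𝟙 (V.hom a c))
    rw [Category.id_comp, Category.id_comp]

/-- The closed functor from `V` to the skew closed category of `V.multi`. -/
noncomputable def toMulti : V ⟶ V.multiClosedData.toSkewClosed where
  F := V.toMultiFunctor
  f0 := V.ofMultiFunctor.map (𝟙 V.i)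
  f2 a b := 𝟙 (V.hom a b)
  nat_f2 {a a' b b'} p h := (V.multi_comp (V.homMap p h) (𝟙 (V.hom a' b'))).trans
    ((Category.comp_id _).trans ((V.multiClosedData_homMap p h).symm.trans
      ((V.multi_comp (𝟙 (V.hom a b)) (V.multiClosedData.homMap p h)).trans
        (Category.id_comp (X := V.hom a b) _)).symm))
  map_I := fun (a : V.Ob) => by
    refine (V.multi_comp₃ (𝟙 (V.hom V.i a)) (V.multiClosedData.homMap (𝟙 V.i) (𝟙 a))
      (V.multiClosedData.I a)).trans ?_
    rw [multiClosedData_homMap, V.homMap_id, multiClosedData_I]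
    exact (Category.id_comp _).trans (Category.id_comp _)
  map_J := fun (a : V.Ob) => by
    refine (V.multi_comp₃ (𝟙 V.i) (V.J a) (𝟙 (V.hom a a))).trans ?_
    refine (Category.id_comp _).trans ((Category.comp_id _).trans (V.multiClosedData_J a).symm)
  map_L := fun (a b c : V.Ob) => by
    refine (V.multi_comp₃ (V.L a b c) (𝟙 (V.hom (V.hom a b) (V.hom a c))) _).trans
      (Eq.trans ?_ (V.multi_comp₃ (𝟙 (V.hom b c)) (V.multiClosedData.L a b c) _).symm)
    have key {d : V.Ob} (X : V.hom (V.hom a b) (V.hom a c) ⟶ d) :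
        V.L a b c ≫ 𝟙 _ ≫ X = 𝟙 _ ≫ V.L a b c ≫ X := by simp
    exact (key _).trans (congrArg (fun k : V.hom b c ⟶ V.hom (V.hom a b) (V.hom a c) =>
      𝟙 _ ≫ k ≫ V.multiClosedData.homMap (𝟙 (V.hom a b)) (𝟙 (V.hom a c)))
        (V.multiClosedData_L a b c).symm)

/-- The skew closed category of `V.multi` is `V`. -/
noncomputable def multiIso : V.multiClosedData.toSkewClosed ≅ V where
  hom := V.ofMulti
  inv := V.toMulti
  hom_inv_id := ClosedFunctor.ext' rfl
    ((Category.comp_id (obj := V.multi.toShort.Ob) _).trans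
      ((V.multi_comp (𝟙 V.i) (𝟙 V.i)).trans (Category.id_comp (𝟙 V.i)))) fun a b =>
    ((V.multi_comp (𝟙 (V.hom a b)) (𝟙 (V.hom a b))).trans (Category.id_comp (𝟙 (V.hom a b)))).trans
      ((Category.id_comp (obj := V.multi.toShort.Ob) _).trans
        (Category.comp_id (obj := V.multi.toShort.Ob) _)).symm
  inv_hom_id := ClosedFunctor.ext' rfl
    ((Category.comp_id _).trans (Category.id_comp (𝟙 V.i))) fun a b =>
    (Category.id_comp (𝟙 (V.hom a b))).trans ((Category.id_comp _).trans (Category.comp_id _)).symm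

end SkewClosedCategory

namespace ShortSkewMulticategory.ClosedData

/-- The skew closed category does not depend on the choice of closed structure. -/
noncomputable def isoOfClosedData {C : ShortSkewMulticategory.{v, u}} (d d' : C.ClosedData) :
    d.toSkewClosed ≅ d'.toSkewClosed where
  hom := d.toClosedFunctor d' (𝟙 C)
  inv := d'.toClosedFunctor d (𝟙 C)
  hom_inv_id := (d.toClosedFunctor_comp d' d (𝟙 C) (𝟙 C)).symm.trans d.toClosedFunctor_id
  inv_hom_id := (d'.toClosedFunctor_comp d d' (𝟙 C) (𝟙 C)).symm.trans d'.toClosedFunctor_id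

end ShortSkewMulticategory.ClosedData

namespace SkewClosedCategory

variable (V : SkewClosedCategory.{v, u})

/-- The closed skew multicategory of a skew closed category. -/
def closedMulti : ClosedSkewMulti.{v, u} :=
  ⟨V.multi, fun b c => ⟨V.hom b c, V.eval b c, isInternalHom_eval b c⟩,
    V.i, V.unit, isNullaryClassifier_unit⟩

/-- `V` is the skew closed category of its closed skew multicategory. -/
noncomputable def skewKSkewUIso : skewK.obj (skewU.obj V.closedMulti) ≅ V :=
  ((ShortSkewMulticategory.closedData (skewU.obj V.closedMulti)).isoOfClosedData
    V.multiClosedData).trans V.multiIso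

end SkewClosedCategory


namespace ShortMulticategory

/-- The morphism of short multicategories underlying one of short skew multicategories. -/
def ofSkewMap {C D : ShortMulticategory.{v, u}} (H : ShortSkewMultifunctor C.toSkew D.toSkew) :
    ShortMultifunctor C D where
  F := H.F
  M2 := H.T2
  M3 := H.T3
  M4 := H.T4
  M0 := H.L0
  nat_M2 := H.nat_T2
  nat_M3 := H.nat_T3
  nat_M4 := H.nat_T4
  nat_M0 := H.nat_L0
  map_22_1 := H.map_22_1
  map_22_2 := H.map_22_2
  map_32_1 := H.map_32_1
  map_32_2 := H.map_32_2
  map_32_3 := H.map_32_3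
  map_23_1 := H.map_23_1
  map_23_2 := H.map_23_2
  map_20_1 f v := (H.map_j1 _).symm.trans (H.map_20_1 f v)
  map_20_2 := H.map_20_2
  map_30_1 f v := (H.map_j2 _).symm.trans (H.map_30_1 f v)
  map_30_2 := H.map_30_2
  map_30_3 := H.map_30_3

instance : inclusion.{v, u}.Faithful where
  map_injective {_ _} _ _ h := congrArg ofSkewMap h

theorem inclusion_ofSkewMap {C D : ShortMulticategory.{v, u}}
    (H : ShortSkewMultifunctor C.toSkew D.toSkew) : inclusion.map (ofSkewMap H) = H := by
  have h₁ : ∀ {a c : C.Ob} (f : a ⟶ c), H.L1 (a := a) (c := c) f = H.F.map f := fun f => H.map_j1 f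
  have h₂ : ∀ {a b c : C.Ob} (f : C.M2.obj a b c), H.L2 (a := a) (b := b) (c := c) f = H.T2 f :=
    fun f => H.map_j2 f
  cases H with
  | mk F T2 T3 T4 L0 L1 L2 =>
    obtain rfl : (fun {a c : C.Ob} (f : a ⟶ c) => F.map f) = @L1 := by
      funext a c f
      exact (h₁ f).symm
    obtain rfl : @T2 = @L2 := by
      funext a b c f
      exact (h₂ f).symm
    rfl

instance : inclusion.{v, u}.Full where
  map_surjective H := ⟨ofSkewMap H, inclusion_ofSkewMap H⟩

end ShortMulticategory

namespace Multicategory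

theorem SkewHom.toHom_injective {M : Multicategory.{v, u}} {x : Tightness} {Γ : List M.Ob}
    {b : M.Ob} {f g : M.SkewHom x Γ b} (h : f.toHom = g.toHom) : f = g := by
  rw [← SkewHom.ofHom_toHom f.ne_nil f, h, SkewHom.ofHom_toHom]

/-- The multifunctor underlying a skew multifunctor. -/
def ofSkewMap {M N : Multicategory.{v, u}} (H : SkewMultifunctor M.toSkew N.toSkew) :
    Multifunctor M N where
  obj := H.obj
  map h f := H.map (x := .l) h f
  map_id a := (H.map_j (Γ := [a]) (b := a) rfl (M.toSkew.id a)).trans (congrArg N.toSkew.j (H.map_id a))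
  map_sub := H.map_sub (x := .l) (y := .l) (z := .l) (hz := rfl) (h₆ := rfl)

instance : inclusion.{v, u}.Faithful where
  map_injective {_ _} _ _ h := congrArg ofSkewMap h

theorem inclusion_ofSkewMap {M N : Multicategory.{v, u}}
    (H : SkewMultifunctor M.toSkew N.toSkew) : inclusion.map (ofSkewMap H) = H := by
  refine SkewMultifunctor.ext' rfl ?_
  intro x Γ Γ' b h h' f
  refine SkewHom.toHom_injective ((SkewHom.toHom_ofHom _ _).trans ?_)
  cases x with
  | l => rfl
  | t => exact H.map_j h f

instance : inclusion.{v, u}.Full where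
  map_surjective H := ⟨ofSkewMap H, inclusion_ofSkewMap H⟩

end Multicategory


namespace SkewMulticategory

variable (M : SkewMulticategory.{v, u})

/-- The multicategory of loose multimaps. -/
def loose : Multicategory.{v, u} where
  Ob := M.Ob
  Hom := M.Hom .l
  id a := M.j (M.id a)
  sub l r hΓ hΘ f g := M.sub l r hΓ hΘ rfl f g
  id_sub f hΓ := (M.sub_left (t₁ := rfl)).symm.trans (M.id_sub f hΓ rfl)
  sub_id l r hΓ hΓ' f := (M.sub_right (t₁ := rfl)).symm.trans (M.sub_id l r hΓ hΓ' rfl f)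
  assoc := M.assoc
  comm := M.comm

variable {M}

/-- The loose multimap underlying a multimap. -/
def toLoose : {x : Tightness} → {Γ : List M.Ob} → {b : M.Ob} → M.Hom x Γ b → M.Hom .l Γ b
  | .t, _, _, f => M.j f
  | .l, _, _, f => f

theorem ne_nil {x : Tightness} {Γ : List M.Ob} {b : M.Ob} (f : M.Hom x Γ b) (hx : x = .t) :
    Γ ≠ [] := by
  subst hx
  rintro rfl
  exact (M.tight_nil b).false f

theorem toLoose_sub {x y z : Tightness} {Γ Δ Θ : List M.Ob} {b c : M.Ob} {l r : List M.Ob}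
    {f : M.Hom x Γ c} {g : M.Hom y Δ b} {h₁ : Γ = l ++ b :: r} {h₂ : Θ = l ++ Δ ++ r}
    {t₁ : z = Tightness.comp x y (l.length + 1)} {t₂ : .l = Tightness.comp .l .l (l.length + 1)} :
    toLoose (M.sub l r h₁ h₂ t₁ f g) = M.sub l r h₁ h₂ t₂ (toLoose f) (toLoose g) := by
  have e : toLoose (M.sub l r h₁ h₂ t₁ f g) = M.sub l r h₁ h₂ (z := .l) rfl (toLoose f) g := by
    cases x with
    | l =>
      obtain rfl : z = .l := t₁
      rfl
    | t =>
      cases z with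
      | l => exact M.sub_left
      | t => exact M.j_sub_left
  rw [e]
  cases y with
  | l => rfl
  | t => exact M.sub_right

/-- `j` is bijective on multimaps of positive arity. -/
def IsNonskew (M : SkewMulticategory.{v, u}) : Prop :=
  ∀ (Γ : List M.Ob) (b : M.Ob), Γ ≠ [] → Function.Bijective (M.j (Γ := Γ) (b := b))

theorem IsNonskew.toLoose_bijective (hM : M.IsNonskew) {x : Tightness} {Γ : List M.Ob} {b : M.Ob}
    (h : x = .t → Γ ≠ []) : Function.Bijective (toLoose (M := M) (x := x) (Γ := Γ) (b := b)) := by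
  cases x with
  | l => exact Function.bijective_id
  | t => exact hM Γ b (h rfl)

/-- The comparison with the multicategory of loose multimaps. -/
def toLooseMap (M : SkewMulticategory.{v, u}) : M ⟶ M.loose.toSkew where
  obj a := a
  map {x Γ Γ' b} h f := Multicategory.SkewHom.ofHom (M := M.loose) x
    (fun hx => (h.trans (List.map_id' Γ)) ▸ ne_nil f hx)
    (cast (congrArg (M.Hom .l · b) (h.trans (List.map_id' _)).symm) (toLoose f))
  map_id _ := rfl
  map_sub := by
    intro x y z Γ Δ Θ Γ' Δ' Θ' b c l r f g hΓ hΘ hz h₁ h₂ h₃ h₄ h₅ h₆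
    have e₁ := h₁.trans (List.map_id' _)
    have e₂ := h₂.trans (List.map_id' _)
    have e₃ := h₃.trans (List.map_id' _)
    subst e₁ e₂ e₃
    refine congrArg (Multicategory.SkewHom.ofHom (M := M.loose) z _) ?_
    refine (toLoose_sub (t₂ := rfl)).trans ?_
    have e₄ : l.map (fun a : M.Ob => a) = l := List.map_id' _
    have e₅ : r.map (fun a : M.Ob => a) = r := List.map_id' _
    refine Eq.trans ?_ (congr (congrArg (M.loose.sub _ _ h₄ h₅)
      (Multicategory.SkewHom.toHom_ofHom (M := M.loose) (fun hx => ne_nil f hx) (toLoose f)).symm)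
      (Multicategory.SkewHom.toHom_ofHom (M := M.loose) (fun hx => ne_nil g hx) (toLoose g)).symm)
    change M.sub l r _ _ _ _ _ = M.sub (l.map fun a : M.Ob => a) (r.map fun a : M.Ob => a) _ _ _ _ _
    congr 1
    · exact e₄.symm
    · exact e₅.symm
  map_j := by
    intro Γ Γ' b h f
    have e := h.trans (List.map_id' _)
    subst e
    exact (Multicategory.SkewHom.toHom_ofHom (M := M.loose) (fun hx => ne_nil f hx) (M.j f)).symm

/-- The multimap corresponding to a multimap of `M.loose`. -/
noncomputable def IsNonskew.ofLoose (hM : M.IsNonskew) {x : Tightness} {Γ : List M.Ob} {b : M.Ob}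
    (f : M.loose.SkewHom x Γ b) : M.Hom x Γ b :=
  ((hM.toLoose_bijective (Multicategory.SkewHom.ne_nil (M := M.loose) f)).2
    (Multicategory.SkewHom.toHom (M := M.loose) f)).choose

theorem IsNonskew.toLoose_ofLoose (hM : M.IsNonskew) {x : Tightness} {Γ : List M.Ob} {b : M.Ob}
    (f : M.loose.SkewHom x Γ b) :
    toLoose (hM.ofLoose f) = Multicategory.SkewHom.toHom (M := M.loose) f :=
  ((hM.toLoose_bijective (Multicategory.SkewHom.ne_nil (M := M.loose) f)).2 _).choose_spec

theorem IsNonskew.toLoose_injective (hM : M.IsNonskew) {x : Tightness} {Γ : List M.Ob} {b : M.Ob}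
    {f g : M.Hom x Γ b} (h : toLoose f = toLoose g) : f = g :=
  (hM.toLoose_bijective (ne_nil f)).1 h

/-- The inverse of `toLooseMap`. -/
noncomputable def IsNonskew.ofLooseMap (hM : M.IsNonskew) : M.loose.toSkew ⟶ M where
  obj a := a
  map {x Γ Γ' b} h f := cast (congrArg (M.Hom x · b) (h.trans (List.map_id' _)).symm) (hM.ofLoose f)
  map_id a := hM.toLoose_injective (hM.toLoose_ofLoose _)
  map_sub := by
    intro x y z Γ Δ Θ Γ' Δ' Θ' b c l r f g hΓ hΘ hz h₁ h₂ h₃ h₄ h₅ h₆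
    have e₁ := h₁.trans (List.map_id' _)
    have e₂ := h₂.trans (List.map_id' _)
    have e₃ := h₃.trans (List.map_id' _)
    subst e₁ e₂ e₃
    refine hM.toLoose_injective ((hM.toLoose_ofLoose _).trans ?_)
    refine (Multicategory.SkewHom.toHom_ofHom (M := M.loose) _ _).trans ?_
    refine Eq.trans ?_ (toLoose_sub (t₂ := rfl)).symm
    have e₄ : l.map (fun a : M.Ob => a) = l := List.map_id' _
    have e₅ : r.map (fun a : M.Ob => a) = r := List.map_id' _
    refine Eq.trans ?_ (congr (congrArg (M.sub _ _ h₄ h₅ _)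
      (hM.toLoose_ofLoose f).symm) (hM.toLoose_ofLoose g).symm)
    change M.sub l r _ _ _ _ _ = M.sub (l.map fun a : M.Ob => a) (r.map fun a : M.Ob => a) _ _ _ _ _
    congr 1
    · exact e₄.symm
    · exact e₅.symm
  map_j := by
    intro Γ Γ' b h f
    have e := h.trans (List.map_id' _)
    subst e
    exact (hM.toLoose_ofLoose (x := .l) (Γ := Γ') (b := b) (M.loose.toSkew.j f)).trans
      (hM.toLoose_ofLoose f).symm

/-- A skew multicategory in which `j` is bijective in positive arities comes from a
multicategory. -/
noncomputable def IsNonskew.looseIso (hM : M.IsNonskew) : M.loose.toSkew ≅ M where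
  hom := hM.ofLooseMap
  inv := M.toLooseMap
  hom_inv_id := by
    refine SkewMultifunctor.ext' rfl ?_
    intro x Γ Γ' b h h' f
    have e := h'.trans (List.map_id' _)
    subst e
    refine (SkewMultifunctor.map_map_congr hM.ofLooseMap M.toLooseMap rfl
      (List.map_id' _).symm (h.trans List.map_map.symm) h' f).trans ?_
    refine Multicategory.SkewHom.toHom_injective (M := M.loose)
      ((Multicategory.SkewHom.toHom_ofHom (M := M.loose) _ _).trans ?_)
    exact hM.toLoose_ofLoose f
  inv_hom_id := by
    refine SkewMultifunctor.ext' rfl ?_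
    intro x Γ Γ' b h h' f
    have e := h'.trans (List.map_id' _)
    subst e
    refine (SkewMultifunctor.map_map_congr M.toLooseMap hM.ofLooseMap rfl
      (List.map_id' _).symm (h.trans List.map_map.symm) h' f).trans ?_
    exact hM.toLoose_injective ((hM.toLoose_ofLoose _).trans
      (Multicategory.SkewHom.toHom_ofHom (M := M.loose) _ _))

theorem IsInternalHom.loose {h b c : M.Ob} {e : M.Hom .t [h, b] c} (he : M.IsInternalHom e) :
    M.loose.IsInternalHom (h := h) (b := b) (c := c) (M.j e) := by
  intro (Γ : List M.Ob)
  have e₁ : (fun f : M.Hom .l Γ h => M.sub [] [b] rfl rfl rfl (M.j e) f) =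
      fun f => M.sub [] [b] rfl (rfl : Γ ++ [b] = [] ++ Γ ++ [b]) rfl e f :=
    funext fun f => M.sub_left.symm
  exact (congrArg Function.Bijective e₁).mpr (he .l Γ (by simp))

theorem isIso_j {a b : M.Ob} (p : M.Hom .t [a] b) (q : M.Hom .t [b] a) (h : M.post q p = M.id a)
    (h' : M.post p q = M.id b) :
    IsIso (C := M.loose.Ob) (X := (a : M.Ob)) (Y := (b : M.Ob)) (M.j p) := by
  have key {a b c : M.Ob} (p : M.Hom .t [a] b) (q : M.Hom .t [b] c) :
      M.sub [] [] rfl rfl rfl (M.j q) (M.j p) = M.j (M.post q p) :=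
    (j_post.trans M.sub_left).symm
  exact ⟨M.j q, (key p q).trans (congrArg M.j h), (key q p).trans (congrArg M.j h')⟩

end SkewMulticategory


instance : skewK.{v, u}.EssSurj where
  mem_essImage V := ⟨skewU.obj V.closedMulti, ⟨V.skewKSkewUIso⟩⟩

instance : skewK.{v, u}.IsEquivalence where

instance : skewU.{v, u}.EssSurj where
  mem_essImage C := ⟨(skewK.obj C).closedMulti, ⟨skewK.preimageIso (skewK.obj C).skewKSkewUIso⟩⟩

instance : skewU.{v, u}.IsEquivalence where

namespace SkewClosedCategory

variable {V : SkewClosedCategory.{v, u}}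

theorem isNonskew_multi (hV : isClosedCategory V) : V.multi.IsNonskew := by
  intro (Γ : List V.Ob) (c : V.Ob) hΓ
  cases Γ with
  | nil => exact (hΓ rfl).elim
  | cons a Γ => exact hV.2 a ((Endo.iter Γ).F.obj c)

theorem closedWithUnit_loose (hV : isClosedCategory V) :
    Multicategory.closedWithUnit V.multi.loose := by
  refine ⟨fun b c => ⟨V.hom b c, V.multi.j (V.eval b c), (isInternalHom_eval b c).loose⟩,
    V.i, V.unit, fun (a : V.Ob) => ⟨V.hom V.i a, V.multi.j (V.eval V.i a),
      (isInternalHom_eval V.i a).loose, ?_⟩⟩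
  obtain ⟨q, hq, hq'⟩ := hV.1 a
  have e : V.multi.sub (x := .l) (y := .l) (z := .l) (Γ := [V.hom V.i a, V.i]) (Δ := [])
      (Θ := [V.hom V.i a]) (c := a) [V.hom V.i a] [] rfl rfl rfl (V.multi.j (V.eval V.i a)) V.unit =
      V.multi.j (Γ := [V.hom V.i a]) (b := a) (V.I a) :=
    (V.multi.j_sub_left (t₁ := rfl)).symm.trans
      (congrArg (V.multi.j (Γ := [V.hom V.i a]) (b := a)) (V.multiClosedData_I a))
  refine (congrArg (IsIso (C := V.multi.loose.Ob) (X := V.hom V.i a) (Y := a)) e).mpr ?_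
  exact SkewMulticategory.isIso_j (M := V.multi) (V.I a) q ((V.multi_comp _ _).trans hq)
    ((V.multi_comp _ _).trans hq')

end SkewClosedCategory

/-- The closed multicategory of a closed category. -/
def ClosedCategory.multi (V : ClosedCategory.{v, u}) : ClosedMulti.{v, u} :=
  ⟨V.obj.multi.loose, SkewClosedCategory.closedWithUnit_loose V.property⟩

/-- The two ways from multicategories to closed short skew multicategories agree. -/
def Multicategory.toShortToSkewIso (M : Multicategory.{v, u}) :
    M.toShort.toSkew ≅ M.toSkew.toShort where
  hom :=
    { F := 𝟭 _, T2 := fun f => f, T3 := fun f => f, T4 := fun f => f, L0 := fun f => f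
      L1 := fun f => f, L2 := fun f => f
      nat_T2 := fun _ _ _ _ => rfl
      nat_T3 := fun _ _ _ _ _ => rfl
      nat_T4 := fun _ _ _ _ _ _ => rfl
      nat_L0 := fun _ _ => rfl
      nat_L1 := fun _ _ _ => rfl
      nat_L2 := fun _ _ _ _ => rfl
      map_j1 := fun _ => rfl
      map_j2 := fun _ => rfl
      map_22_1 := fun _ _ => rfl
      map_22_2 := fun _ _ => rfl
      map_32_1 := fun _ _ => rfl
      map_32_2 := fun _ _ => rfl
      map_32_3 := fun _ _ => rfl
      map_23_1 := fun _ _ => rfl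
      map_23_2 := fun _ _ => rfl
      map_20_1 := fun _ _ => rfl
      map_20_2 := fun _ _ => rfl
      map_30_1 := fun _ _ => rfl
      map_30_2 := fun _ _ => rfl
      map_30_3 := fun _ _ => rfl
      map_L1_0 := fun f v => (M.toSkew.toShort.j_L1_0 f v).symm
      map_2_L1_1 := fun f g => (M.toSkew.toShort.j_2_L1_1 f g).symm
      map_2_L1_2 := fun f g => (M.toSkew.toShort.j_2_L1_2 f g).symm
      map_L1_2 := fun f g => (M.toSkew.toShort.j_L1_2 f g).symm }
  inv :=
    { F := 𝟭 _, T2 := fun f => f, T3 := fun f => f, T4 := fun f => f, L0 := fun f => f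
      L1 := fun f => f, L2 := fun f => f
      nat_T2 := fun _ _ _ _ => rfl
      nat_T3 := fun _ _ _ _ _ => rfl
      nat_T4 := fun _ _ _ _ _ _ => rfl
      nat_L0 := fun _ _ => rfl
      nat_L1 := fun _ _ _ => rfl
      nat_L2 := fun _ _ _ _ => rfl
      map_j1 := fun _ => rfl
      map_j2 := fun _ => rfl
      map_22_1 := fun _ _ => rfl
      map_22_2 := fun _ _ => rfl
      map_32_1 := fun _ _ => rfl
      map_32_2 := fun _ _ => rfl
      map_32_3 := fun _ _ => rfl
      map_23_1 := fun _ _ => rfl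
      map_23_2 := fun _ _ => rfl
      map_20_1 := fun _ _ => rfl
      map_20_2 := fun _ _ => rfl
      map_30_1 := fun _ _ => rfl
      map_30_2 := fun _ _ => rfl
      map_30_3 := fun _ _ => rfl
      map_L1_0 := fun f v => M.toSkew.toShort.j_L1_0 f v
      map_2_L1_1 := fun f g => M.toSkew.toShort.j_2_L1_1 f g
      map_2_L1_2 := fun f g => M.toSkew.toShort.j_2_L1_2 f g
      map_L1_2 := fun f g => M.toSkew.toShort.j_L1_2 f g }
  hom_inv_id := rfl
  inv_hom_id := rfl

instance : closedInclusion.{v, u}.Faithful :=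
  Functor.Faithful.of_comp_iso (G := SkewMulticategory.closedWithUnit.ι)
    (H := Multicategory.closedWithUnit.ι ⋙ Multicategory.inclusion) (Iso.refl _)

instance : closedInclusion.{v, u}.Full :=
  Functor.Full.of_comp_faithful_iso (G := SkewMulticategory.closedWithUnit.ι)
    (H := Multicategory.closedWithUnit.ι ⋙ Multicategory.inclusion) (Iso.refl _)

instance : closedShortInclusion.{v, u}.Faithful :=
  Functor.Faithful.of_comp_iso (G := ShortSkewMulticategory.closedWithUnit.ι)
    (H := ShortMulticategory.closedWithUnit.ι ⋙ ShortMulticategory.inclusion) (Iso.refl _)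

instance : closedShortInclusion.{v, u}.Full :=
  Functor.Full.of_comp_faithful_iso (G := ShortSkewMulticategory.closedWithUnit.ι)
    (H := ShortMulticategory.closedWithUnit.ι ⋙ ShortMulticategory.inclusion) (Iso.refl _)

/-- The forgetful functors commute with the inclusions. -/
def multiUSquare : multiU.{v, u} ⋙ closedShortInclusion.{v, u} ≅ closedInclusion ⋙ skewU :=
  NatIso.ofComponents
    (fun M => ShortSkewMulticategory.closedWithUnit.isoMk M.obj.toShortToSkewIso) fun _ => rfl

/-- The functors to skew closed categories commute with the inclusions. -/
noncomputable def multiKSquare : multiK.{v, u} ⋙ SkewClosedCategory.isClosedCategory.ι ≅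
    closedShortInclusion ⋙ skewK :=
  Iso.refl _

instance : multiK.{v, u}.Faithful := Functor.Faithful.of_comp_iso multiKSquare

instance : multiK.{v, u}.Full := Functor.Full.of_comp_faithful_iso multiKSquare

instance : multiU.{v, u}.Faithful := Functor.Faithful.of_comp_iso multiUSquare

instance : multiU.{v, u}.Full := Functor.Full.of_comp_faithful_iso multiUSquare

/-- `V` is the closed category of its closed multicategory. -/
noncomputable def ClosedCategory.multiKMultiUIso (V : ClosedCategory.{v, u}) :
    multiK.obj (multiU.obj V.multi) ≅ V :=
  SkewClosedCategory.isClosedCategory.isoMk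
    ((skewK.mapIso (multiUSquare.app V.multi)).trans
      ((skewK.mapIso (skewU.mapIso (SkewMulticategory.closedWithUnit.isoMk (Y := V.obj.closedMulti)
        (SkewClosedCategory.isNonskew_multi V.property).looseIso))).trans V.obj.skewKSkewUIso))

instance : multiK.{v, u}.EssSurj where
  mem_essImage V := ⟨multiU.obj V.multi, ⟨V.multiKMultiUIso⟩⟩

instance : multiK.{v, u}.IsEquivalence where

instance : multiU.{v, u}.EssSurj where
  mem_essImage C := ⟨(multiK.obj C).multi, ⟨multiK.preimageIso (multiK.obj C).multiKMultiUIso⟩⟩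

instance : multiU.{v, u}.IsEquivalence where

end SkewMulti

theorem mainTheorem10 :
    SkewMulti.skewK.{v, u}.IsEquivalence ∧
    SkewMulti.skewU.{v, u}.IsEquivalence ∧
    SkewMulti.multiK.{v, u}.IsEquivalence ∧
    SkewMulti.multiU.{v, u}.IsEquivalence ∧
    Nonempty (SkewMulti.multiK.{v, u} ⋙ SkewMulti.SkewClosedCategory.isClosedCategory.ι ≅
      SkewMulti.closedShortInclusion ⋙ SkewMulti.skewK) ∧
    Nonempty (SkewMulti.multiU.{v, u} ⋙ SkewMulti.closedShortInclusion ≅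
      SkewMulti.closedInclusion ⋙ SkewMulti.skewU) := by
  exact ⟨inferInstance, inferInstance, inferInstance, inferInstance, ⟨SkewMulti.multiKSquare⟩,
    ⟨SkewMulti.multiUSquare⟩⟩
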